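/- Let $d\ge 2$, let $S$ be a non-empty finite set and let $X=(X_v)_{v\in\mathbb Z^d}$ be a translation-invariant $S$-valued Markov random field: the law of $X$ is invariant under all translations of $\mathbb Z^d$ and, for every finite $V\subset\mathbb Z^d$, $(X_v)_{v\in V}$ and $(X_v)_{v\notin V}$ are conditionally independent given $X_{\partial V}=(X_v)_{v\in\partial V}$, where $\partial V$ is the set of vertices at distance $1$ from $V$. Distances are graph distances ($\ell^1$) on $\mathbb Z^d$. Let $\Omega$ be the set of all $x\in S^{\mathbb Z^d}$ with $\Pr(X_V=x_V)>0$ for all finite $V\subset\mathbb Z^d$, and let $\Omega_W=\{\omega_W:\omega\in\Omega\}$ for $W\subset\mathbb Z^d$. For finite $U\subset V\subset\mathbb Z^d$ and $\tau\in\Omega_{\partial V}$, let $P^\tau_{V,U}$ be the conditional law of $X_U$ given $X_{\partial V}=\tau$. Let $\|\cdot\|$ be the total-variation distance (half the $L^1$ norm). A rate function is a non-increasing function $\rho:\{1,2,\dots\}\to[0,\infty)$ which tends to $0$. $X$ satisfies exponential weak spatial mixing if there are a rate function $\rho$ and $C,c>0$ with $\rho(n)\le Ce^{-cn}$ for all $n\ge1$,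 such that for all finite $U\subset V\subset\mathbb Z^d$ and all $\tau,\tau'\in\Omega_{\partial V}$, $$\|P^\tau_{V,U}-P^{\tau'}_{V,U}\|\le |U|\cdot\rho(\mathrm{dist}(U,\partial V)).$$ It satisfies exponential strong spatial mixing if the same holds with $\mathrm{dist}(U,\Sigma_{\tau,\tau'})$ in place of $\mathrm{dist}(U,\partial V)$, where $\Sigma_{\tau,\tau'}=\{v\in\partial V:\tau_v\ne\tau'_v\}$. (When $U$ is empty or $\tau=\tau'$ the left-hand side is $0$ and the condition is regarded as satisfied.) $X$ is a finitary factor of an i.i.d. process (ffiid) if there are an i.i.d. process $Y=(Y_v)_{v\in\mathbb Z^d}$ with values in some measurable space $T$ and a measurable map $\varphi:T^{\mathbb Z^d}\to S^{\mathbb Z^d}$, commuting with every translation, such that $\varphi(Y)$ and $X$ have the same law and the coding radius $R=R_\varphi(Y)$ is almost surely finite. Here $R_\varphi(y)$ is the least integer $r\ge0$ such that $\varphi(y')_{\mathbf 0}=\varphi(y)_{\mathbf 0}$ for every $y'\in T^{\mathbb Z^d}$ which coincides with $y$ on $\{v:\|v\|_1\le r\}$, and $R_\varphi(y)=\infty$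 if there is no such $r$. $X$ is ffiid with power-law tails if $Y,\varphi$ can be chosen so that moreover $\Pr(R\ge r)\le Cr^{-c}$ for some $C,c>0$ and all $r>0$, and ffiid with exponential tails if they can be chosen so that moreover $\Pr(R\ge r)\le Ce^{-cr}$ for some $C,c>0$ and all $r>0$. Then: (a) If $X$ satisfies exponential weak spatial mixing, then $X$ is ffiid with power-law tails. (b) If $X$ satisfies exponential strong spatial mixing, then $X$ is ffiid with exponential tails. -/

import Mathlib

open MeasureTheory ProbabilityTheory Filter Topology
open scoped NNReal ENNReal

noncomputable section

/-! ## The lattice -/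

/-- The vertices of the lattice `ℤ^d`. -/
abbrev Zd (d : ℕ) : Type := Fin d → ℤ

/-- The graph distance on `ℤ^d` (nearest-neighbour graph), that is, the `ℓ¹` distance. -/
def latticeDist {d : ℕ} (u v : Zd d) : ℕ := ∑ i, (u i - v i).natAbs

/-- The minimal graph distance between a vertex of `A` and a vertex of `B`
(with value `0` if `A` or `B` is empty). -/
def setDist {d : ℕ} (A B : Set (Zd d)) : ℕ :=
  sInf {n : ℕ | ∃ a ∈ A, ∃ b ∈ B, latticeDist a b = n}

/-- The boundary `∂V`: the vertices at distance exactly `1` from `V`. -/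
def boundary {d : ℕ} (V : Set (Zd d)) : Set (Zd d) :=
  {u | u ∉ V ∧ ∃ v ∈ V, latticeDist u v = 1}

/-- Translation of a configuration by `u`. -/
def shiftConfig {d : ℕ} {A : Type*} (u : Zd d) (x : Zd d → A) : Zd d → A := fun v => x (v + u)

/-! ## Random fields

A random field on `ℤ^d` with values in `S` is represented by its law, a probability measure on
`Zd d → S`, and all notions below are properties of the law. -/

/-- The law `μ` is invariant under all translations of `ℤ^d`. -/
def TranslationInvariant {d : ℕ} {S : Type*} [MeasurableSpace S] (μ : Measure (Zd d → S)) : Prop :=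
  ∀ u : Zd d, μ.map (shiftConfig u) = μ

/-- The σ-algebra on configurations generated by the coordinates in `W`. -/
abbrev coordSigma {d : ℕ} (S : Type*) [MeasurableSpace S] (W : Set (Zd d)) :
    MeasurableSpace (Zd d → S) :=
  MeasurableSpace.comap (W.domRestrict (π := fun _ => S)) inferInstance

theorem coordSigma_le {d : ℕ} (S : Type*) [MeasurableSpace S] (W : Set (Zd d)) :
    coordSigma S W ≤ MeasurableSpace.pi :=
  Measurable.comap_le (f := W.domRestrict (π := fun _ => S))
    (measurable_pi_lambda _ fun w => measurable_pi_apply (w : Zd d))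

/-- Markov random field: for every finite `V`, the restrictions of the field to `V` and to `Vᶜ`
are conditionally independent given the restriction to `∂V`. -/
def IsMarkovRandomField {d : ℕ} {S : Type*} [Finite S] [MeasurableSpace S]
    [DiscreteMeasurableSpace S] (μ : Measure (Zd d → S)) [IsFiniteMeasure μ] : Prop :=
  ∀ V : Finset (Zd d),
    CondIndepFun (coordSigma S (boundary (V : Set (Zd d)))) (coordSigma_le S _)
      ((V : Set (Zd d)).domRestrict (π := fun _ => S))
      ((V : Set (Zd d))ᶜ.domRestrict (π := fun _ => S)) μ

/-- The topological support `Ω`: the configurations all of whose finite patterns have positive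
probability. -/
def feasible {d : ℕ} {S : Type*} [MeasurableSpace S] (μ : Measure (Zd d → S)) :
    Set (Zd d → S) :=
  {x | ∀ V : Finset (Zd d), 0 < μ {y | ∀ v ∈ V, y v = x v}}

/-- The set `Ω_W` of restrictions to `W` of feasible configurations. -/
def feasibleOn {d : ℕ} {S : Type*} [MeasurableSpace S] (μ : Measure (Zd d → S))
    (W : Set (Zd d)) : Set (W → S) :=
  W.domRestrict '' feasible μ

/-- The specification `P_V^τ`: the conditional law of the field on `V`, given that it equals `τ`
on `∂V`. -/
def specification {d : ℕ} {S : Type*} [MeasurableSpace S] (μ : Measure (Zd d → S))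
    (V : Set (Zd d)) (τ : boundary V → S) : Measure (V → S) :=
  (μ[|{x | (boundary V).domRestrict x = τ}]).map V.domRestrict

/-- The marginal `P_{V,U}^τ` of `P_V^τ` on `U ⊆ V`. -/
def specificationMarginal {d : ℕ} {S : Type*} [MeasurableSpace S] (μ : Measure (Zd d → S))
    {U V : Set (Zd d)} (hUV : U ⊆ V) (τ : boundary V → S) : Measure (U → S) :=
  (specification μ V τ).map (Set.domRestrict₂ (π := fun _ => S) hUV)

/-- Total-variation distance on a finite set (half the `L¹` norm of the difference). -/
def tvDist {A : Type*} [Fintype A] [MeasurableSpace A] (p q : Measure A) : ℝ :=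
  (1 / 2) * ∑ a : A, |p.real {a} - q.real {a}|

/-! ## Spatial mixing -/

/-- A rate function: a monotone function `{1, 2, …} → [0, ∞)` which tends to `0`.
The value at `0` is irrelevant. -/
def IsRateFunction (ρ : ℕ → ℝ≥0) : Prop :=
  AntitoneOn ρ (Set.Ici 1) ∧ Tendsto ρ atTop (𝓝 0)

/-- Exponential decay of a rate function. -/
def HasExponentialDecay (ρ : ℕ → ℝ≥0) : Prop :=
  ∃ C c : ℝ, 0 < C ∧ 0 < c ∧ ∀ n : ℕ, 1 ≤ n → (ρ n : ℝ) ≤ C * Real.exp (-c * n)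

/-- Weak spatial mixing with rate function `ρ`. (If `U` is empty, both sides vanish; otherwise
`∂V` is non-empty when `d ≥ 1`, and the distance is at least `1`.) -/
def WeakSpatialMixing {d : ℕ} {S : Type*} [Fintype S] [MeasurableSpace S]
    (μ : Measure (Zd d → S)) (ρ : ℕ → ℝ≥0) : Prop :=
  ∀ (U V : Finset (Zd d)) (hUV : (U : Set (Zd d)) ⊆ V),
    ∀ τ ∈ feasibleOn μ (boundary (V : Set (Zd d))),
    ∀ τ' ∈ feasibleOn μ (boundary (V : Set (Zd d))),
      tvDist (specificationMarginal μ hUV τ) (specificationMarginal μ hUV τ') ≤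
        U.card * ρ (setDist (U : Set (Zd d)) (boundary (V : Set (Zd d))))

/-- The set of boundary vertices on which two boundary conditions disagree. -/
def disagreement {d : ℕ} {S : Type*} {W : Set (Zd d)} (τ τ' : W → S) : Set (Zd d) :=
  {v | ∃ h : v ∈ W, τ ⟨v, h⟩ ≠ τ' ⟨v, h⟩}

/-- Strong spatial mixing with rate function `ρ`. (If `U` is empty or `τ = τ'`, the left-hand side
vanishes, so that the inequality says nothing; otherwise the distance is at least `1`.) -/
def StrongSpatialMixing {d : ℕ} {S : Type*} [Fintype S] [MeasurableSpace S]
    (μ : Measure (Zd d → S)) (ρ : ℕ → ℝ≥0) : Prop :=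
  ∀ (U V : Finset (Zd d)) (hUV : (U : Set (Zd d)) ⊆ V),
    ∀ τ ∈ feasibleOn μ (boundary (V : Set (Zd d))),
    ∀ τ' ∈ feasibleOn μ (boundary (V : Set (Zd d))),
      tvDist (specificationMarginal μ hUV τ) (specificationMarginal μ hUV τ') ≤
        U.card * ρ (setDist (U : Set (Zd d)) (disagreement τ τ'))

/-- Exponential weak spatial mixing. -/
def ExponentialWeakSpatialMixing {d : ℕ} {S : Type*} [Fintype S] [MeasurableSpace S]
    (μ : Measure (Zd d → S)) : Prop :=
  ∃ ρ : ℕ → ℝ≥0, IsRateFunction ρ ∧ HasExponentialDecay ρ ∧ WeakSpatialMixing μ ρ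

/-- Exponential strong spatial mixing. -/
def ExponentialStrongSpatialMixing {d : ℕ} {S : Type*} [Fintype S] [MeasurableSpace S]
    (μ : Measure (Zd d → S)) : Prop :=
  ∃ ρ : ℕ → ℝ≥0, IsRateFunction ρ ∧ HasExponentialDecay ρ ∧ StrongSpatialMixing μ ρ

/-! ## Codings -/

/-- `φ` is a coding from a field with law `ν` to a field with law `μ`: a measurable,
translation-equivariant map (defined everywhere) which transports `ν` to `μ`. -/
structure IsCoding {d : ℕ} {T S : Type*} [MeasurableSpace T] [MeasurableSpace S]
    (ν : Measure (Zd d → T)) (μ : Measure (Zd d → S)) (φ : (Zd d → T) → (Zd d → S)) : Prop where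
  measurable : Measurable φ
  equivariant : ∀ (u : Zd d) (y : Zd d → T), φ (shiftConfig u y) = shiftConfig u (φ y)
  map_eq : ν.map φ = μ

/-- The coding radius of `φ` at `y`: the least `r` such that the value of `φ` at the origin is
the same for all `y'` which coincide with `y` on the graph ball of radius `r` around the origin,
and `⊤` if there is no such `r`. -/
def codingRadius {d : ℕ} {T S : Type*} (φ : (Zd d → T) → (Zd d → S)) (y : Zd d → T) : ℕ∞ :=
  ⨅ (r : ℕ) (_ : ∀ y' : Zd d → T, (∀ v : Zd d, latticeDist v 0 ≤ r → y' v = y v) →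
      φ y' 0 = φ y 0), (r : ℕ∞)

/-- The coding radius is almost surely finite. -/
def IsFinitary {d : ℕ} {T S : Type*} [MeasurableSpace T]
    (ν : Measure (Zd d → T)) (φ : (Zd d → T) → (Zd d → S)) : Prop :=
  ∀ᵐ y ∂ν, codingRadius φ y ≠ ⊤

/-- The coding radius `R` satisfies `Pr(R ≥ r) ≤ C e^{-cr}` for some `C, c > 0` and all `r > 0`. -/
def HasExponentialTails {d : ℕ} {T S : Type*} [MeasurableSpace T]
    (ν : Measure (Zd d → T)) (φ : (Zd d → T) → (Zd d → S)) : Prop :=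
  ∃ C c : ℝ, 0 < C ∧ 0 < c ∧ ∀ r : ℕ, 0 < r →
    ν {y | (r : ℕ∞) ≤ codingRadius φ y} ≤ ENNReal.ofReal (C * Real.exp (-c * r))

/-- The coding radius `R` satisfies `Pr(R ≥ r) ≤ C r^{-c}` for some `C, c > 0` and all `r > 0`. -/
def HasPowerLawTails {d : ℕ} {T S : Type*} [MeasurableSpace T]
    (ν : Measure (Zd d → T)) (φ : (Zd d → T) → (Zd d → S)) : Prop :=
  ∃ C c : ℝ, 0 < C ∧ 0 < c ∧ ∀ r : ℕ, 0 < r →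
    ν {y | (r : ℕ∞) ≤ codingRadius φ y} ≤ ENNReal.ofReal (C * (r : ℝ) ^ (-c))

/-- The law of an i.i.d. process on `ℤ^d` whose single-site distribution is `m`. -/
def iidLaw (d : ℕ) {T : Type*} [MeasurableSpace T] (m : Measure T) [IsProbabilityMeasure m] :
    Measure (Zd d → T) :=
  Measure.infinitePi fun _ => m

/-- The field with law `μ` is a finitary factor of an i.i.d. process (with values in some
measurable space `T`), by a coding with power-law tails. -/
def IsFfiidWithPowerLawTails {d : ℕ} {S : Type*} [MeasurableSpace S]
    (μ : Measure (Zd d → S)) : Prop :=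
  ∃ (T : Type) (_ : MeasurableSpace T) (m : Measure T) (_ : IsProbabilityMeasure m)
    (φ : (Zd d → T) → (Zd d → S)),
    IsCoding (iidLaw d m) μ φ ∧ IsFinitary (iidLaw d m) φ ∧ HasPowerLawTails (iidLaw d m) φ

/-- The field with law `μ` is a finitary factor of an i.i.d. process (with values in some
measurable space `T`), by a coding with exponential tails. -/
def IsFfiidWithExponentialTails {d : ℕ} {S : Type*} [MeasurableSpace S]
    (μ : Measure (Zd d → S)) : Prop :=
  ∃ (T : Type) (_ : MeasurableSpace T) (m : Measure T) (_ : IsProbabilityMeasure m)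
    (φ : (Zd d → T) → (Zd d → S)),
    IsCoding (iidLaw d m) μ φ ∧ IsFinitary (iidLaw d m) φ ∧ HasExponentialTails (iidLaw d m) φ

end

/-!
Both parts construct the field by a local algorithm that reads i.i.d. variables, and stops after
finitely many steps at each vertex.

*Strong mixing.* The field is sampled sequentially, the vertices being revealed in the order of
i.i.d. arrival times. By strong spatial mixing, the conditional probability of a value at a vertex
`v`, given any pattern on the vertices before `v`, is determined up to an error `ε(r)`,
exponentially small in `r`, by the pattern in the ball of radius `r` around `v`. So the conditional
law is a mixture of rules of ranges `r₀, r₀ + 1, …` with geometric weights, where the rule of range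
`r` looks at the earlier vertices in the ball of radius `r` only
(`StrongSpatialMixing.one_sub_le_sum_lowerProb`, `measure_siteRule`). The range of each vertex is
drawn beforehand. The value at the origin is determined in the ball of radius `r` if no chain of
vertices with decreasing arrival times, in which every vertex is in the range of its predecessor,
leaves this ball; the decreasing order yields a factor `1 / k!` for chains of length `k`, and a
union bound over chains gives exponential tails (`exists_measure_compl_clanEvent_le`).

*Weak mixing.* By weak spatial mixing, the pattern in a ball of radius `2 * q` and the boundary
condition of the concentric ball of radius `4 * q` are almost independent, even in the sense of
ratios (`WeakSpatialMixing.ratio_mixing`). Hence a ball of radius `4 * q` can be resampled in such a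
way that with probability `1 / 2` the new values in the inner ball do not depend on the boundary
condition (`coupledSample`, `blockRule`). Resampling many separated balls with random centres
simultaneously preserves the law of the field (`measurePreserving_blockStep`), and with a
probability that does not depend on `q` the new values in the ball of radius `q` around the origin
do not depend on the old configuration (`le_measure_renewalEvent`). Now compose resampling steps at
the scales `q₀, 16 * q₀, 16 ^ 2 * q₀, …`, the largest scale being applied first. As the smaller
scales transport information over short distances only, the value at the origin is determined as
soon as this independence occurs at one scale (`blockIterate_eq_of_mem_renewalEvent`). Different
scales are independent, so the probability that the first `n` scales fail is exponentially small in
`n`, while the radius of the window that is read is exponentially large in `n`: the tails follow a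
power law.

In both cases, the map that is defined by the events of determination is a coding because it is a
limit of maps whose output has the right law (`isCoding_of_determined`).
-/

/-! ### Lattice geometry -/

theorem latticeDist_comm {d : ℕ} (u v : Zd d) : latticeDist u v = latticeDist v u := by
  unfold latticeDist
  exact Finset.sum_congr rfl fun i _ => by omega

theorem latticeDist_triangle {d : ℕ} (u v w : Zd d) :
    latticeDist u w ≤ latticeDist u v + latticeDist v w := by
  unfold latticeDist
  rw [← Finset.sum_add_distrib]
  exact Finset.sum_le_sum fun i _ => by omega

@[simp] theorem latticeDist_self {d : ℕ} (u : Zd d) : latticeDist u u = 0 := by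
  simp [latticeDist]

@[simp] theorem latticeDist_add_right {d : ℕ} (u v w : Zd d) :
    latticeDist (u + w) (v + w) = latticeDist u v := by
  simp [latticeDist]

theorem latticeDist_sub_left {d : ℕ} (u v w : Zd d) :
    latticeDist (u - v) w = latticeDist u (w + v) := by
  unfold latticeDist
  exact Finset.sum_congr rfl fun i _ => by simp only [Pi.sub_apply, Pi.add_apply]; omega

/-- The closed graph ball of radius `r` around `c`, as a finite set. -/
noncomputable def latticeBall {d : ℕ} (c : Zd d) (r : ℕ) : Finset (Zd d) :=
  (Fintype.piFinset fun i => Finset.Icc (c i - r) (c i + r)).filter fun v => latticeDist v c ≤ r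

@[simp] theorem mem_latticeBall {d : ℕ} {c v : Zd d} {r : ℕ} :
    v ∈ latticeBall c r ↔ latticeDist v c ≤ r := by
  simp only [latticeBall, Finset.mem_filter, Fintype.mem_piFinset, Finset.mem_Icc,
    and_iff_right_iff_imp]
  intro h i
  have h1 : (v i - c i).natAbs ≤ latticeDist v c :=
    Finset.single_le_sum (f := fun i => (v i - c i).natAbs) (fun _ _ => Nat.zero_le _)
      (Finset.mem_univ i)
  omega

theorem card_latticeBall_le {d : ℕ} (c : Zd d) (r : ℕ) :
    (latticeBall c r).card ≤ (2 * r + 1) ^ d := by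
  refine (Finset.card_filter_le _ _).trans ?_
  rw [Fintype.card_piFinset]
  have h : ∀ i, (Finset.Icc (c i - r) (c i + r)).card = 2 * r + 1 := by
    intro i
    rw [Int.card_Icc]
    omega
  simp [h]

theorem le_card_latticeBall {d : ℕ} (c : Zd d) (r : ℕ) :
    (r + 1) ^ d ≤ (latticeBall c (d * r)).card := by
  have h : (Fintype.piFinset fun i => Finset.Icc (c i) (c i + r)).card = (r + 1) ^ d := by
    rw [Fintype.card_piFinset]
    have h : ∀ i, (Finset.Icc (c i) (c i + r)).card = r + 1 := by
      intro i
      rw [Int.card_Icc]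
      omega
    simp [h]
  rw [← h]
  refine Finset.card_le_card fun v hv => ?_
  simp only [Fintype.mem_piFinset, Finset.mem_Icc] at hv
  rw [mem_latticeBall]
  calc latticeDist v c ≤ ∑ _i : Fin d, r := Finset.sum_le_sum fun i _ => by have := hv i; omega
    _ = d * r := by simp

theorem boundary_finite {d : ℕ} (V : Finset (Zd d)) : (boundary (V : Set (Zd d))).Finite := by
  refine (V.biUnion fun v => latticeBall v 1).finite_toSet.subset ?_
  rintro u ⟨_, v, hv, huv⟩
  simp only [Finset.coe_biUnion, Set.mem_iUnion]
  exact ⟨v, hv, by simp [huv]⟩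

/-- The boundary of a finite set, as a finite set. -/
noncomputable def bdry {d : ℕ} (V : Finset (Zd d)) : Finset (Zd d) :=
  (boundary_finite V).toFinset

@[simp] theorem coe_bdry {d : ℕ} (V : Finset (Zd d)) :
    (bdry V : Set (Zd d)) = boundary (V : Set (Zd d)) := by
  simp [bdry]

theorem mem_bdry {d : ℕ} {V : Finset (Zd d)} {u : Zd d} :
    u ∈ bdry V ↔ u ∉ V ∧ ∃ v ∈ V, latticeDist u v = 1 := by
  simp [bdry, boundary]

theorem latticeDist_of_mem_bdry_latticeBall {d : ℕ} {c u : Zd d} {r : ℕ}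
    (h : u ∈ bdry (latticeBall c r)) : latticeDist u c = r + 1 := by
  obtain ⟨h1, v, hv, huv⟩ := mem_bdry.1 h
  rw [mem_latticeBall] at h1 hv
  have := latticeDist_triangle u v c
  omega

theorem le_setDist {d : ℕ} {A B : Set (Zd d)} (hA : A.Nonempty) (hB : B.Nonempty) {n : ℕ}
    (h : ∀ a ∈ A, ∀ b ∈ B, n ≤ latticeDist a b) : n ≤ setDist A B := by
  obtain ⟨a, ha⟩ := hA
  obtain ⟨b, hb⟩ := hB
  refine le_csInf ⟨_, a, ha, b, hb, rfl⟩ ?_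
  rintro _ ⟨a, ha, b, hb, rfl⟩
  exact h a ha b hb

/-! ### Cylinder events -/

/-- The event that the field coincides with the configuration `ζ` on `A`. -/
def cyl {d : ℕ} {S : Type*} (A : Finset (Zd d)) (ζ : Zd d → S) : Set (Zd d → S) :=
  {x | ∀ v ∈ A, x v = ζ v}

section Cylinders

variable {d : ℕ} {S : Type*}

theorem mem_cyl {A : Finset (Zd d)} {ζ x : Zd d → S} : x ∈ cyl A ζ ↔ ∀ v ∈ A, x v = ζ v := Iff.rfl

theorem cyl_congr {A : Finset (Zd d)} {ζ ζ' : Zd d → S} (h : ∀ v ∈ A, ζ v = ζ' v) :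
    cyl A ζ = cyl A ζ' := by
  ext x
  exact forall₂_congr fun v hv => by rw [h v hv]

theorem cyl_mono {A B : Finset (Zd d)} (h : A ⊆ B) (ζ : Zd d → S) : cyl B ζ ⊆ cyl A ζ :=
  fun _ hx v hv => hx v (h hv)

theorem cyl_union [DecidableEq (Zd d)] (A B : Finset (Zd d)) (ζ : Zd d → S) :
    cyl (A ∪ B) ζ = cyl A ζ ∩ cyl B ζ := by
  ext x
  simp only [mem_cyl, Finset.mem_union, Set.mem_inter_iff]
  exact ⟨fun h => ⟨fun v hv => h v (.inl hv), fun v hv => h v (.inr hv)⟩,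
    fun h v hv => hv.elim (h.1 v) (h.2 v)⟩

@[simp] theorem cyl_empty (ζ : Zd d → S) : cyl ∅ ζ = Set.univ := by
  ext x; simp [mem_cyl]

theorem restrict_preimage_singleton (A : Finset (Zd d)) (ζ : Zd d → S) :
    A.restrict (π := fun _ => S) ⁻¹' {A.restrict ζ} = cyl A ζ := by
  ext x
  simp only [Set.mem_preimage, Set.mem_singleton_iff, funext_iff, Finset.restrict, mem_cyl]
  exact ⟨fun h v hv => h ⟨v, hv⟩, fun h v => h v v.2⟩

theorem exists_restrict_eq [Nonempty S] (A : Finset (Zd d)) (a : A → S) :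
    ∃ ζ : Zd d → S, A.restrict ζ = a := by
  classical
  refine ⟨fun v => if h : v ∈ A then a ⟨v, h⟩ else Classical.arbitrary S, ?_⟩
  ext v
  simp [Finset.restrict]

variable [MeasurableSpace S]

theorem ae_cyl_ne_zero [Finite S] (μ : Measure (Zd d → S)) (A : Finset (Zd d)) :
    ∀ᵐ x ∂μ, μ (cyl A x) ≠ 0 := by
  have h1 : {x | ¬ μ (cyl A x) ≠ 0} ⊆
      ⋃ a ∈ {a : A → S | μ (A.restrict (π := fun _ => S) ⁻¹' {a}) = 0},
        A.restrict (π := fun _ => S) ⁻¹' {a} := by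
    intro x hx
    simp only [ne_eq, not_not, Set.mem_ofPred_eq] at hx
    simp only [Set.mem_iUnion]
    exact ⟨A.restrict x, by simpa [restrict_preimage_singleton] using hx, rfl⟩
  refine measure_mono_null h1 ?_
  exact (measure_biUnion_null_iff (Set.toFinite _).countable).2 fun a ha => ha

theorem ae_mem_feasible [Finite S] (μ : Measure (Zd d → S)) : ∀ᵐ x ∂μ, x ∈ feasible μ := by
  have : ∀ᵐ x ∂μ, ∀ A : Finset (Zd d), μ (cyl A x) ≠ 0 :=
    ae_all_iff.2 fun A => ae_cyl_ne_zero μ A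
  filter_upwards [this] with x hx A
  exact pos_iff_ne_zero.2 (hx A)

variable [DiscreteMeasurableSpace S]

theorem measurableSet_eval_eq (v : Zd d) (s : S) : MeasurableSet {x : Zd d → S | x v = s} :=
  measurableSet_preimage (f := fun x : Zd d → S => x v) (measurable_pi_apply v)
    (measurableSet_singleton s)

theorem measurableSet_cyl (A : Finset (Zd d)) (ζ : Zd d → S) : MeasurableSet (cyl A ζ) := by
  have : cyl A ζ = ⋂ v ∈ A, {x : Zd d → S | x v = ζ v} := by
    ext x; simp [mem_cyl]
  rw [this]
  exact Finset.measurableSet_biInter _ fun v _ => measurableSet_eval_eq v _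

/-- A map that depends on finitely many coordinates of a finite-valued configuration is
measurable. -/
theorem measurable_of_dependsOn_finset [Finite S] {Z : Type*} [MeasurableSpace Z]
    (A : Finset (Zd d)) (f : (Zd d → S) → Z) (h : ∀ x x', (∀ v ∈ A, x v = x' v) → f x = f x') :
    Measurable f := by
  obtain hS | hS := isEmpty_or_nonempty (Zd d → S)
  · exact measurable_of_empty f
  have hf : Function.FactorsThrough f (A.restrict (π := fun _ => S)) := fun x x' hx =>
    h x x' fun v hv => congrFun hx ⟨v, hv⟩
  obtain ⟨g, hg⟩ := haveI : Nonempty Z := ⟨f hS.some⟩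
    (Function.factorsThrough_iff f).1 hf
  rw [hg]
  exact (measurable_of_countable g).comp (Finset.measurable_restrict A)

theorem map_restrict_eq_of_cyl [Finite S] {P Q : Measure (Zd d → S)}
    {W : Finset (Zd d)} (h : ∀ ζ, P (cyl W ζ) = Q (cyl W ζ)) :
    P.map (W.restrict (π := fun _ => S)) = Q.map W.restrict := by
  obtain hS | hS := isEmpty_or_nonempty S
  · obtain hE | hE := isEmpty_or_nonempty (Zd d → S)
    · rw [Measure.eq_zero_of_isEmpty P, Measure.eq_zero_of_isEmpty Q]
    · exact (hS.false (hE.some 0)).elim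
  refine Measure.ext_of_singleton fun a => ?_
  obtain ⟨ζ, rfl⟩ := exists_restrict_eq W a
  rw [Measure.map_apply (Finset.measurable_restrict W) (measurableSet_singleton _),
    Measure.map_apply (Finset.measurable_restrict W) (measurableSet_singleton _),
    restrict_preimage_singleton, h]

theorem cyl_eq_of_subset [Finite S] {P Q : Measure (Zd d → S)} {W W' : Finset (Zd d)}
    (hW : W ⊆ W') (h : ∀ ζ, P (cyl W' ζ) = Q (cyl W' ζ)) (ζ : Zd d → S) :
    P (cyl W ζ) = Q (cyl W ζ) := by
  have h1 : cyl W ζ = W'.restrict (π := fun _ => S) ⁻¹' {a | ∀ v : W, a ⟨v, hW v.2⟩ = ζ v} := by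
    ext x
    simp [mem_cyl, Finset.restrict]
  have hm : MeasurableSet {a : W' → S | ∀ v : W, a ⟨v, hW v.2⟩ = ζ v} :=
    (Set.toFinite _).measurableSet
  rw [h1, ← Measure.map_apply (Finset.measurable_restrict _) hm,
    ← Measure.map_apply (Finset.measurable_restrict _) hm, map_restrict_eq_of_cyl h]

theorem measure_eq_of_cyl [Finite S] {P Q : Measure (Zd d → S)} [IsFiniteMeasure P]
    [IsFiniteMeasure Q] (W₀ : Finset (Zd d))
    (h : ∀ W, W₀ ⊆ W → ∀ ζ, P (cyl W ζ) = Q (cyl W ζ)) : P = Q := by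
  classical
  refine IsProjectiveLimit.unique (P := fun W => P.map (W.restrict (π := fun _ => S)))
    (fun W => rfl) (fun W => ?_)
  exact (map_restrict_eq_of_cyl fun ζ => cyl_eq_of_subset (W' := W₀ ∪ W)
    Finset.subset_union_right (h _ Finset.subset_union_left) ζ).symm

end Cylinders

/-! ### Conditional probabilities of a Markov random field -/

section Markov

theorem domRestrict_boundary_eq_iff {d : ℕ} {S : Type*} (V : Finset (Zd d)) (x y : Zd d → S) :
    (boundary (V : Set (Zd d))).domRestrict y = (boundary (V : Set (Zd d))).domRestrict x ↔
      y ∈ cyl (bdry V) x := by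
  rw [mem_cyl, funext_iff]
  constructor
  · intro h v hv
    exact h ⟨v, by rwa [← coe_bdry]⟩
  · rintro h ⟨v, hv⟩
    exact h v (by rwa [← coe_bdry] at hv)

variable {d : ℕ} {S : Type*} [MeasurableSpace S]

/-- The conditional probability of the event `E` given that the field coincides with `x` on `W`
(with value `0` if the conditioning event is null). -/
noncomputable def condProb (μ : Measure (Zd d → S)) (W : Finset (Zd d)) (x : Zd d → S)
    (E : Set (Zd d → S)) : ℝ :=
  (μ[|cyl W x]).real E

theorem condProb_nonneg (μ : Measure (Zd d → S)) (W : Finset (Zd d)) (x : Zd d → S)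
    (E : Set (Zd d → S)) : 0 ≤ condProb μ W x E := measureReal_nonneg

theorem condProb_congr (μ : Measure (Zd d → S)) {W : Finset (Zd d)} {x x' : Zd d → S}
    (h : ∀ v ∈ W, x v = x' v) (E : Set (Zd d → S)) : condProb μ W x E = condProb μ W x' E := by
  rw [condProb, cyl_congr h, condProb]

variable [DiscreteMeasurableSpace S]

theorem condProb_eq_div (μ : Measure (Zd d → S)) (W : Finset (Zd d)) (x : Zd d → S)
    (E : Set (Zd d → S)) :
    condProb μ W x E = μ.real (cyl W x ∩ E) / μ.real (cyl W x) := by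
  rw [condProb, measureReal_def, cond_apply (measurableSet_cyl W x), ENNReal.toReal_mul,
    ENNReal.toReal_inv, div_eq_inv_mul]
  rfl

theorem condProb_mul (μ : Measure (Zd d → S)) [IsFiniteMeasure μ] (W : Finset (Zd d))
    (x : Zd d → S) (E : Set (Zd d → S)) :
    condProb μ W x E * μ.real (cyl W x) = μ.real (cyl W x ∩ E) := by
  rw [condProb_eq_div]
  by_cases h : μ.real (cyl W x) = 0
  · rw [h, mul_zero]
    exact (measureReal_mono_null Set.inter_subset_left h).symm
  · field_simp

theorem condProb_le_one (μ : Measure (Zd d → S)) [IsFiniteMeasure μ] (W : Finset (Zd d))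
    (x : Zd d → S) (E : Set (Zd d → S)) : condProb μ W x E ≤ 1 := by
  rw [condProb_eq_div]
  exact div_le_one_of_le₀ (measureReal_mono Set.inter_subset_left) measureReal_nonneg

theorem sum_real_inter_restrict [Fintype S] (ν : Measure (Zd d → S)) [IsFiniteMeasure ν]
    (U : Finset (Zd d)) {E : Set (Zd d → S)} (hE : MeasurableSet E) :
    ∑ a : U → S, ν.real (E ∩ U.restrict (π := fun _ => S) ⁻¹' {a}) = ν.real E := by
  rw [← measureReal_biUnion_finset]
  · congr 1
    ext x
    simp
  · intro a _ b _ hab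
    refine Set.disjoint_left.2 fun x hx hx' => hab ?_
    rw [← hx.2, ← hx'.2]
  · exact fun a _ => hE.inter (Finset.measurable_restrict U (measurableSet_singleton a))

theorem sum_condProb_restrict [Fintype S] (μ : Measure (Zd d → S)) [IsFiniteMeasure μ]
    (W U : Finset (Zd d)) {x : Zd d → S} (h : μ (cyl W x) ≠ 0) :
    ∑ a : U → S, condProb μ W x (U.restrict (π := fun _ => S) ⁻¹' {a}) = 1 := by
  have := cond_isProbabilityMeasure h
  have h1 := sum_real_inter_restrict (μ[|cyl W x]) U MeasurableSet.univ
  simpa [condProb] using h1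

variable [Finite S] {μ : Measure (Zd d → S)} [IsFiniteMeasure μ]

/-- On configurations whose boundary pattern has positive probability, the conditional expectation
given the boundary σ-algebra is the elementary conditional probability. -/
theorem condExp_boundary_eq (V : Finset (Zd d)) {E : Set (Zd d → S)} (hE : MeasurableSet E)
    {x : Zd d → S} (hx : μ (cyl (bdry V) x) ≠ 0) :
    (μ⟦E|coordSigma S (boundary (V : Set (Zd d)))⟧) x = condProb μ (bdry V) x E := by
  set m := coordSigma S (boundary (V : Set (Zd d))) with hm
  have hle : m ≤ MeasurableSpace.pi := coordSigma_le S _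
  have hfac : Function.FactorsThrough (μ⟦E|m⟧) ((boundary (V : Set (Zd d))).domRestrict
      (π := fun _ => S)) := StronglyMeasurable.factorsThrough stronglyMeasurable_condExp
  have hconst : ∀ y ∈ cyl (bdry V) x, (μ⟦E|m⟧) y = (μ⟦E|m⟧) x := fun y hy =>
    hfac ((domRestrict_boundary_eq_iff V x y).2 hy)
  have hcm : MeasurableSet[m] (cyl (bdry V) x) := by
    refine ⟨{(boundary (V : Set (Zd d))).domRestrict x}, ?_, ?_⟩
    · have : Finite (boundary (V : Set (Zd d))) := boundary_finite V
      exact measurableSet_singleton _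
    · ext y
      exact domRestrict_boundary_eq_iff V x y
  have h1 : ∫ y in cyl (bdry V) x, (μ⟦E|m⟧) y ∂μ = ∫ y in cyl (bdry V) x,
      E.indicator (fun _ => (1 : ℝ)) y ∂μ :=
    setIntegral_condExp hle ((integrable_const _).indicator hE) hcm
  rw [setIntegral_congr_fun (measurableSet_cyl _ _) hconst, setIntegral_const,
    setIntegral_indicator hE, setIntegral_const, smul_eq_mul, smul_eq_mul, mul_one] at h1
  rw [condProb_eq_div, eq_div_iff (by simpa [measureReal_def, ENNReal.toReal_eq_zero_iff] using hx),
    mul_comm, h1]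

/-- The Markov property in integrated form: the probability of an event `E` inside `V` together
with an event `B` outside `V` is obtained by averaging over `B` the conditional probability of `E`
given the boundary of `V`. -/
theorem IsMarkovRandomField.real_inter_eq_setIntegral (hμ : IsMarkovRandomField μ)
    (V : Finset (Zd d)) {U A : Finset (Zd d)} (hU : U ⊆ V) (hA : Disjoint V A)
    (s : Set (U → S)) (ζ : Zd d → S) :
    μ.real (U.restrict (π := fun _ => S) ⁻¹' s ∩ cyl A ζ) =
      ∫ x in cyl A ζ, condProb μ (bdry V) x (U.restrict (π := fun _ => S) ⁻¹' s) ∂μ := by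
  set E := U.restrict (π := fun _ => S) ⁻¹' s with hEdef
  set B := cyl A ζ with hBdef
  have hEm : MeasurableSet E := Finset.measurable_restrict U (Set.toFinite s).measurableSet
  have hBm : MeasurableSet B := measurableSet_cyl A ζ
  have hiB : Integrable (B.indicator fun _ => (1 : ℝ)) μ := (integrable_const _).indicator hBm
  have hint : μ.real (E ∩ B) = ∫ x, (E ∩ B).indicator (fun _ => (1 : ℝ)) x ∂μ := by
    rw [integral_indicator (hEm.inter hBm), setIntegral_const]; simp
  let s₁ : Set (↥(V : Set (Zd d)) → S) := {a | (fun u : U => a ⟨u, hU u.2⟩) ∈ s}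
  let s₂ : Set (↥((V : Set (Zd d))ᶜ) → S) :=
    ⋂ v : A, (fun a => a ⟨v, fun hv => Finset.disjoint_left.1 hA hv v.2⟩) ⁻¹' {ζ v}
  have hE : E = (V : Set (Zd d)).domRestrict (π := fun _ => S) ⁻¹' s₁ := rfl
  have hB : B = ((V : Set (Zd d))ᶜ).domRestrict (π := fun _ => S) ⁻¹' s₂ := by
    ext x
    simp [hBdef, mem_cyl, s₂]
  have hs₂ : MeasurableSet s₂ :=
    MeasurableSet.iInter fun v => measurable_pi_apply _ (measurableSet_singleton _)
  have hmeas : ∀ W : Set (Zd d), Measurable (W.domRestrict (π := fun _ => S)) := fun W =>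
    measurable_pi_lambda _ fun w => measurable_pi_apply (w : Zd d)
  have hind := (condIndepFun_iff_condExp_inter_preimage_eq_mul (hmeas _) (hmeas _)).1 (hμ V)
    s₁ s₂ (Set.toFinite s₁).measurableSet hs₂
  rw [← hE, ← hB] at hind
  set m := coordSigma S (boundary (V : Set (Zd d))) with hm
  have hle : m ≤ MeasurableSpace.pi := coordSigma_le S _
  have hbound : ∀ᵐ x ∂μ, ‖(μ⟦E|m⟧) x‖ ≤ 1 := by
    filter_upwards [ae_cyl_ne_zero μ (bdry V)] with x hx
    rw [condExp_boundary_eq V hEm hx, Real.norm_eq_abs, abs_of_nonneg (condProb_nonneg _ _ _ _)]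
    exact condProb_le_one μ _ _ _
  have hprod : Integrable ((μ⟦E|m⟧) * B.indicator fun _ => (1 : ℝ)) μ :=
    hiB.bdd_mul integrable_condExp.aestronglyMeasurable hbound
  calc μ.real (E ∩ B)
      = ∫ x, (E ∩ B).indicator (fun _ => (1 : ℝ)) x ∂μ := hint
    _ = ∫ x, (μ⟦E ∩ B|m⟧) x ∂μ := (integral_condExp hle).symm
    _ = ∫ x, ((μ⟦E|m⟧) * (μ⟦B|m⟧)) x ∂μ := integral_congr_ae hind
    _ = ∫ x, (μ[(μ⟦E|m⟧) * (B.indicator fun _ => (1 : ℝ))|m]) x ∂μ :=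
        integral_congr_ae (condExp_mul_of_stronglyMeasurable_left stronglyMeasurable_condExp
          hprod hiB).symm
    _ = ∫ x, ((μ⟦E|m⟧) * (B.indicator fun _ => (1 : ℝ))) x ∂μ := integral_condExp hle
    _ = ∫ x, B.indicator (μ⟦E|m⟧) x ∂μ := by
        refine integral_congr_ae (ae_of_all _ fun x => ?_)
        by_cases hx : x ∈ B <;> simp [hx]
    _ = ∫ x in B, (μ⟦E|m⟧) x ∂μ := integral_indicator hBm
    _ = ∫ x in B, condProb μ (bdry V) x E ∂μ := by
        refine setIntegral_congr_ae hBm ?_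
        filter_upwards [ae_cyl_ne_zero μ (bdry V)] with x hx _
        exact condExp_boundary_eq V hEm hx

/-- The Markov property for finite patterns. -/
theorem IsMarkovRandomField.condProb_mul_of_bdry_subset (hμ : IsMarkovRandomField μ)
    (V : Finset (Zd d)) {U A : Finset (Zd d)} (hU : U ⊆ V) (hA : Disjoint V A)
    (hbA : bdry V ⊆ A) (s : Set (U → S)) (ζ : Zd d → S) :
    condProb μ (bdry V) ζ (U.restrict (π := fun _ => S) ⁻¹' s) * μ.real (cyl A ζ) =
      μ.real (U.restrict (π := fun _ => S) ⁻¹' s ∩ cyl A ζ) := by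
  rw [hμ.real_inter_eq_setIntegral V hU hA, setIntegral_congr_fun (measurableSet_cyl A ζ)
    (g := fun _ => condProb μ (bdry V) ζ (U.restrict (π := fun _ => S) ⁻¹' s)),
    setIntegral_const, smul_eq_mul, mul_comm]
  exact fun x hx => condProb_congr μ (fun v hv => hx v (hbA hv)) _

theorem IsMarkovRandomField.condProb_eq_integral (hμ : IsMarkovRandomField μ)
    (V : Finset (Zd d)) {U A : Finset (Zd d)} (hU : U ⊆ V) (hA : Disjoint V A)
    (s : Set (U → S)) (ζ : Zd d → S) :
    condProb μ A ζ (U.restrict (π := fun _ => S) ⁻¹' s) =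
      ∫ x, condProb μ (bdry V) x (U.restrict (π := fun _ => S) ⁻¹' s) ∂(μ[|cyl A ζ]) := by
  rw [condProb_eq_div, Set.inter_comm, hμ.real_inter_eq_setIntegral V hU hA, ProbabilityTheory.cond,
    integral_smul_measure, div_eq_inv_mul, smul_eq_mul, ENNReal.toReal_inv]
  rfl

end Markov

/-! ### Spatial mixing for general conditionings -/

section Mixing

variable {d : ℕ} {S : Type*} [MeasurableSpace S]

/-- The event that the field coincides on `U` with the pattern `a`. -/
abbrev patternEvent {d : ℕ} {S : Type*} (U : Finset (Zd d)) (a : U → S) : Set (Zd d → S) :=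
  U.restrict (π := fun _ => S) ⁻¹' {a}

theorem measurable_condProb [DiscreteMeasurableSpace S] [Finite S] (μ : Measure (Zd d → S))
    (W : Finset (Zd d)) (E : Set (Zd d → S)) : Measurable fun x => condProb μ W x E :=
  measurable_of_dependsOn_finset W _ fun _ _ h => condProb_congr μ h E

theorem integrable_condProb [DiscreteMeasurableSpace S] [Finite S] (μ : Measure (Zd d → S))
    [IsFiniteMeasure μ] (ν : Measure (Zd d → S)) [IsFiniteMeasure ν]
    (W : Finset (Zd d)) (E : Set (Zd d → S)) : Integrable (fun x => condProb μ W x E) ν := by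
  refine Integrable.of_bound (measurable_condProb μ W E).aestronglyMeasurable 1
    (ae_of_all _ fun x => ?_)
  rw [Real.norm_eq_abs, abs_of_nonneg (condProb_nonneg _ _ _ _)]
  exact condProb_le_one μ W x E

theorem sum_abs_integral_sub_le {Ω ι : Type*} [MeasurableSpace Ω] [Fintype ι] {ν : Measure Ω}
    [IsProbabilityMeasure ν] {f : ι → Ω → ℝ} (hf : ∀ i, Integrable (f i) ν) (c : ι → ℝ) {ε : ℝ}
    (h : ∀ᵐ x ∂ν, ∑ i, |f i x - c i| ≤ ε) : ∑ i, |(∫ x, f i x ∂ν) - c i| ≤ ε := by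
  have hi : ∀ i, Integrable (fun x => f i x - c i) ν := fun i => (hf i).sub (integrable_const _)
  calc ∑ i, |(∫ x, f i x ∂ν) - c i| = ∑ i, |∫ x, (f i x - c i) ∂ν| := by
        refine Finset.sum_congr rfl fun i _ => ?_
        rw [integral_sub (hf i) (integrable_const _)]
        simp
    _ ≤ ∑ i, ∫ x, |f i x - c i| ∂ν := Finset.sum_le_sum fun i _ => abs_integral_le_integral_abs
    _ = ∫ x, ∑ i, |f i x - c i| ∂ν := (integral_finsetSum _ fun i _ => (hi i).abs).symm
    _ ≤ ∫ _, ε ∂ν := integral_mono_ae (integrable_finsetSum _ fun i _ => (hi i).abs)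
        (integrable_const _) h
    _ = ε := by simp

variable [DiscreteMeasurableSpace S] [Fintype S] {μ : Measure (Zd d → S)}

/-- A comparison of the conditional laws on `U` given any two feasible boundary conditions on `V`
passes to conditionings on patterns outside `V`. -/
theorem IsMarkovRandomField.sum_abs_condProb_sub_le [IsFiniteMeasure μ]
    (hμ : IsMarkovRandomField μ) (V : Finset (Zd d)) {U A A' : Finset (Zd d)} (hU : U ⊆ V)
    (hA : Disjoint V A) (hA' : Disjoint V A') {ζ ζ' : Zd d → S} (hζ : μ (cyl A ζ) ≠ 0)
    (hζ' : μ (cyl A' ζ') ≠ 0) {ε : ℝ}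
    (h : ∀ x ∈ feasible μ, x ∈ cyl A ζ → ∀ x' ∈ feasible μ, x' ∈ cyl A' ζ' →
      ∑ a : U → S, |condProb μ (bdry V) x (patternEvent U a) -
        condProb μ (bdry V) x' (patternEvent U a)| ≤ ε) :
    ∑ a : U → S, |condProb μ A ζ (patternEvent U a) - condProb μ A' ζ' (patternEvent U a)| ≤ ε := by
  have key : ∀ (B : Finset (Zd d)) (η : Zd d → S), μ (cyl B η) ≠ 0 →
      IsProbabilityMeasure (μ[|cyl B η]) ∧ ∀ᵐ x ∂(μ[|cyl B η]), x ∈ feasible μ ∧ x ∈ cyl B η := by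
    intro B η hη
    refine ⟨cond_isProbabilityMeasure hη, ?_⟩
    filter_upwards [cond_absolutelyContinuous.ae_le (ae_mem_feasible μ),
      ae_cond_mem (measurableSet_cyl B η)] with x h1 h2 using ⟨h1, h2⟩
  obtain ⟨hp, hae⟩ := key A ζ hζ
  obtain ⟨hp', hae'⟩ := key A' ζ' hζ'
  simp only [patternEvent]
  simp_rw [hμ.condProb_eq_integral V hU hA, hμ.condProb_eq_integral V hU hA']
  refine sum_abs_integral_sub_le (fun a => integrable_condProb μ _ _ _) _ ?_
  filter_upwards [hae] with x hx
  simp_rw [abs_sub_comm (condProb μ (bdry V) x _)]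
  refine sum_abs_integral_sub_le (fun a => integrable_condProb μ _ _ _) _ ?_
  filter_upwards [hae'] with x' hx'
  simp_rw [abs_sub_comm (condProb μ (bdry V) x' _)]
  exact h x hx.1 hx.2 x' hx'.1 hx'.2

theorem specificationMarginal_real_singleton {U V : Finset (Zd d)}
    (hUV : (U : Set (Zd d)) ⊆ V) (x : Zd d → S) (a : ↥(U : Set (Zd d)) → S) :
    (specificationMarginal μ hUV ((boundary (V : Set (Zd d))).domRestrict x)).real {a} =
      condProb μ (bdry V) x (patternEvent U a) := by
  have hmeas : ∀ W : Set (Zd d), Measurable (W.domRestrict (π := fun _ => S)) := fun W =>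
    measurable_pi_lambda _ fun w => measurable_pi_apply (w : Zd d)
  have hmeas₂ : Measurable (Set.domRestrict₂ (π := fun _ => S) hUV) :=
    measurable_pi_lambda _ fun w => measurable_pi_apply _
  have hset : {y | (boundary (V : Set (Zd d))).domRestrict y =
      (boundary (V : Set (Zd d))).domRestrict x} = cyl (bdry V) x := by
    ext y
    exact domRestrict_boundary_eq_iff V x y
  rw [measureReal_def, specificationMarginal, specification,
    Measure.map_apply hmeas₂ (measurableSet_singleton a),
    Measure.map_apply (hmeas _) (hmeas₂ (measurableSet_singleton a)), hset]
  rfl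

theorem sum_abs_condProb_eq_tvDist {U V : Finset (Zd d)} (hUV : (U : Set (Zd d)) ⊆ V)
    (x x' : Zd d → S) :
    ∑ a : U → S, |condProb μ (bdry V) x (patternEvent U a) -
        condProb μ (bdry V) x' (patternEvent U a)| =
      2 * tvDist (specificationMarginal μ hUV ((boundary (V : Set (Zd d))).domRestrict x))
        (specificationMarginal μ hUV ((boundary (V : Set (Zd d))).domRestrict x')) := by
  simp_rw [tvDist, specificationMarginal_real_singleton]
  rw [← mul_assoc]
  norm_num
  exact Finset.sum_bij (fun a _ => a) (fun _ _ => Finset.mem_univ _) (fun _ _ _ _ h => h)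
    (fun a _ => ⟨a, Finset.mem_univ _, rfl⟩) fun _ _ => rfl

/-- Weak spatial mixing, for conditionings on arbitrary patterns outside `V`. -/
theorem WeakSpatialMixing.sum_abs_condProb_sub_le [IsFiniteMeasure μ]
    (hμ : IsMarkovRandomField μ) {ρ : ℕ → ℝ≥0} (hw : WeakSpatialMixing μ ρ)
    (hρ : AntitoneOn ρ (Set.Ici 1)) (V : Finset (Zd d)) {U A A' : Finset (Zd d)} (hU : U ⊆ V)
    (hA : Disjoint V A) (hA' : Disjoint V A') {ζ ζ' : Zd d → S} (hζ : μ (cyl A ζ) ≠ 0)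
    (hζ' : μ (cyl A' ζ') ≠ 0) {n : ℕ} (hn : 1 ≤ n)
    (hdist : ∀ u ∈ U, ∀ v ∈ bdry V, n ≤ latticeDist u v) :
    ∑ a : U → S, |condProb μ A ζ (patternEvent U a) - condProb μ A' ζ' (patternEvent U a)| ≤
      2 * (U.card * ρ n) := by
  refine hμ.sum_abs_condProb_sub_le V hU hA hA' hζ hζ' fun x hx _ x' hx' _ => ?_
  obtain hV | hV := (bdry V).eq_empty_or_nonempty
  · have : ∀ E, condProb μ (bdry V) x E = condProb μ (bdry V) x' E :=
      fun E => condProb_congr μ (by simp [hV]) E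
    simp only [this, sub_self, abs_zero, Finset.sum_const_zero]
    positivity
  rw [sum_abs_condProb_eq_tvDist (Finset.coe_subset.2 hU)]
  refine mul_le_mul_of_nonneg_left ((hw U V (Finset.coe_subset.2 hU) _ ⟨x, hx, rfl⟩ _
    ⟨x', hx', rfl⟩).trans ?_) zero_le_two
  obtain hU0 | hU0 := U.eq_empty_or_nonempty
  · simp [hU0]
  refine mul_le_mul_of_nonneg_left ?_ (Nat.cast_nonneg _)
  have hle : n ≤ setDist (U : Set (Zd d)) (boundary (V : Set (Zd d))) := by
    refine le_setDist hU0 (by rw [← coe_bdry]; exact hV) fun a ha b hb => hdist a ha b ?_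
    rwa [← coe_bdry] at hb
  exact_mod_cast hρ hn (hn.trans hle) hle

/-- Strong spatial mixing at a single site `u`: if two conditionings, on patterns avoiding `u`,
coincide within distance `r` from `u`, then the conditional laws at `u` are close. -/
theorem StrongSpatialMixing.abs_condProb_sub_le [IsFiniteMeasure μ]
    (hμ : IsMarkovRandomField μ) {ρ : ℕ → ℝ≥0} (hs : StrongSpatialMixing μ ρ)
    (hρ : AntitoneOn ρ (Set.Ici 1)) (u : Zd d) (r : ℕ) {A A' : Finset (Zd d)}
    (hu : u ∉ A) (hu' : u ∉ A') (hAA' : ∀ v ∈ latticeBall u r, v ∈ A ↔ v ∈ A')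
    {ζ ζ' : Zd d → S} (hζζ' : ∀ v ∈ A, v ∈ latticeBall u r → ζ v = ζ' v)
    (hζ : μ (cyl A ζ) ≠ 0) (hζ' : μ (cyl A' ζ') ≠ 0) (s : S) :
    |condProb μ A ζ {y | y u = s} - condProb μ A' ζ' {y | y u = s}| ≤ 2 * ρ (r + 1) := by
  set V := latticeBall u r \ A with hV
  have huV : u ∈ V := by simp [hV, hu]
  have hA : Disjoint V A := Finset.sdiff_disjoint
  have hA' : Disjoint V A' := by
    rw [Finset.disjoint_left]
    intro v hv hvA'
    rw [hV, Finset.mem_sdiff] at hv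
    exact hv.2 ((hAA' v hv.1).2 hvA')
  have hU : {u} ⊆ V := by simpa using huV
  have hmem : ∀ v ∈ bdry V, v ∈ latticeBall u r → v ∈ A := by
    intro v hv hvr
    by_contra hvA
    exact (mem_bdry.1 hv).1 (Finset.mem_sdiff.2 ⟨hvr, hvA⟩)
  have h := hμ.sum_abs_condProb_sub_le V hU hA hA' hζ hζ' (ε := 2 * ρ (r + 1))
    fun x hx hxA x' hx' hxA' => ?_
  · have hev : {y : Zd d → S | y u = s} = patternEvent {u} fun _ => s := by
      ext y
      refine ⟨fun h => funext fun v => ?_, fun h => congrFun h ⟨u, Finset.mem_singleton_self u⟩⟩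
      obtain ⟨v, hv⟩ := v
      obtain rfl := Finset.mem_singleton.1 hv
      exact h
    rw [hev]
    exact (Finset.single_le_sum (f := fun a : ({u} : Finset (Zd d)) → S =>
      |condProb μ A ζ (patternEvent {u} a) - condProb μ A' ζ' (patternEvent {u} a)|)
      (fun _ _ => abs_nonneg _) (Finset.mem_univ _)).trans h
  · have hagree : ∀ v ∈ bdry V, v ∈ latticeBall u r → x v = x' v := fun v hv hvr => by
      rw [hxA v (hmem v hv hvr), hxA' v ((hAA' v hvr).1 (hmem v hv hvr)), hζζ' v (hmem v hv hvr) hvr]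
    set D := disagreement ((boundary (V : Set (Zd d))).domRestrict x)
      ((boundary (V : Set (Zd d))).domRestrict x') with hD
    have hDmem : ∀ v ∈ D, v ∈ bdry V ∧ x v ≠ x' v := by
      rintro v ⟨hv, hne⟩
      exact ⟨by rwa [← coe_bdry] at hv, hne⟩
    obtain hD0 | hD0 := D.eq_empty_or_nonempty
    · have : ∀ v ∈ bdry V, x v = x' v := by
        intro v hv
        by_contra hne
        have : v ∈ D := ⟨by rwa [← coe_bdry], hne⟩
        rw [hD0] at this
        exact this
      have : ∀ E, condProb μ (bdry V) x E = condProb μ (bdry V) x' E :=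
        fun E => condProb_congr μ this E
      simp only [this, sub_self, abs_zero, Finset.sum_const_zero]
      positivity
    rw [sum_abs_condProb_eq_tvDist (Finset.coe_subset.2 hU)]
    refine mul_le_mul_of_nonneg_left ((hs {u} V (Finset.coe_subset.2 hU) _ ⟨x, hx, rfl⟩ _
      ⟨x', hx', rfl⟩).trans ?_) zero_le_two
    have hle : r + 1 ≤ setDist (({u} : Finset (Zd d)) : Set (Zd d)) D := by
      refine le_setDist (by simp) hD0 fun a ha b hb => ?_
      have hb' := hDmem b hb
      have : b ∉ latticeBall u r := fun hbr => hb'.2 (hagree b hb'.1 hbr)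
      rw [mem_latticeBall] at this
      simp only [Finset.coe_singleton, Set.mem_singleton_iff] at ha
      rw [ha, latticeDist_comm]
      omega
    simp only [Finset.card_singleton, Nat.cast_one, one_mul]
    exact_mod_cast hρ (Nat.le_add_left 1 r) ((Nat.le_add_left 1 r).trans hle) hle

end Mixing

/-! ### Codings from locally determined approximations -/

section Coding

variable {d : ℕ}

theorem map_shiftConfig_iidLaw {T : Type*} [MeasurableSpace T] (m : Measure T)
    [IsProbabilityMeasure m] (u : Zd d) : (iidLaw d m).map (shiftConfig u) = iidLaw d m :=
  Measure.map_infinitePi_infinitePi_of_inj (P := fun _ : Zd d => m) (f := fun v => v + u)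
    (add_left_injective u)

theorem measurable_shiftConfig {T : Type*} [MeasurableSpace T] (u : Zd d) :
    Measurable (shiftConfig (A := T) u) :=
  measurable_pi_lambda _ fun v => measurable_pi_apply (v + u)

instance {T : Type*} [MeasurableSpace T] (m : Measure T) [IsProbabilityMeasure m] :
    IsProbabilityMeasure (iidLaw d m) := by
  unfold iidLaw; infer_instance

theorem shiftConfig_shiftConfig {A : Type*} (u v : Zd d) (y : Zd d → A) :
    shiftConfig v (shiftConfig u y) = shiftConfig (v + u) y := by
  ext w
  simp only [shiftConfig, add_assoc]

variable {S T : Type*}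

/-- The value at the origin which is read off from the determining events `D i`: it is `H i y` for
the first `i` such that `y ∈ D i`. -/
noncomputable def determinedValue (D : ℕ → Set (Zd d → T)) (H : ℕ → (Zd d → T) → S) (s₀ : S)
    (y : Zd d → T) : S :=
  open Classical in if h : ∃ i, y ∈ D i then H (Nat.find h) y else s₀

theorem determinedValue_eq {D : ℕ → Set (Zd d → T)} {H : ℕ → (Zd d → T) → S}
    (hH : ∀ i j y, y ∈ D i → y ∈ D j → H i y = H j y) (s₀ : S) {i : ℕ} {y : Zd d → T}
    (hy : y ∈ D i) : determinedValue D H s₀ y = H i y := by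
  classical
  have h : ∃ i, y ∈ D i := ⟨i, hy⟩
  rw [determinedValue, dif_pos h]
  exact hH _ _ _ (Nat.find_spec h) hy

theorem codingRadius_le_of_determined {D : ℕ → Set (Zd d → T)} {H : ℕ → (Zd d → T) → S}
    {rad : ℕ → ℕ} (hH : ∀ i j y, y ∈ D i → y ∈ D j → H i y = H j y)
    (hloc : ∀ i y y', y ∈ D i → (∀ v, latticeDist v 0 ≤ rad i → y' v = y v) →
      y' ∈ D i ∧ H i y' = H i y) (s₀ : S) {i : ℕ} {y : Zd d → T} (hy : y ∈ D i) :
    codingRadius (fun y v => determinedValue D H s₀ (shiftConfig v y)) y ≤ rad i := by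
  refine iInf₂_le_of_le (rad i) (fun y' hy' => ?_) le_rfl
  have h0 : ∀ y : Zd d → T, shiftConfig 0 y = y := fun y => by ext v; simp [shiftConfig]
  obtain ⟨h1, h2⟩ := hloc i y y' hy hy'
  simp only [h0]
  rw [determinedValue_eq hH s₀ h1, determinedValue_eq hH s₀ hy, h2]

variable [MeasurableSpace T]

theorem isFinitary_of_determined {m : Measure T} [IsProbabilityMeasure m]
    {D : ℕ → Set (Zd d → T)} {H : ℕ → (Zd d → T) → S} {rad : ℕ → ℕ}
    (hH : ∀ i j y, y ∈ D i → y ∈ D j → H i y = H j y)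
    (hloc : ∀ i y y', y ∈ D i → (∀ v, latticeDist v 0 ≤ rad i → y' v = y v) →
      y' ∈ D i ∧ H i y' = H i y)
    (hDnull : iidLaw d m (⋂ i, (D i)ᶜ) = 0) (s₀ : S) :
    IsFinitary (iidLaw d m) (fun y v => determinedValue D H s₀ (shiftConfig v y)) := by
  refine measure_mono_null (fun y hy => ?_) hDnull
  simp only [Set.mem_iInter]
  intro i hi
  refine hy fun htop => ?_
  have := codingRadius_le_of_determined hH hloc s₀ hi
  rw [htop] at this
  exact absurd this (by simp)

variable [MeasurableSpace S]

theorem measurable_determinedValue {D : ℕ → Set (Zd d → T)} {H : ℕ → (Zd d → T) → S}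
    (hH : ∀ i j y, y ∈ D i → y ∈ D j → H i y = H j y)
    (hD : ∀ i, MeasurableSet (D i)) (hHm : ∀ i, Measurable (H i)) (s₀ : S) :
    Measurable (determinedValue D H s₀) := by
  classical
  intro t ht
  have : determinedValue D H s₀ ⁻¹' t =
      (⋃ i, D i ∩ H i ⁻¹' t) ∪ ((⋃ i, D i)ᶜ ∩ {_y | s₀ ∈ t}) := by
    ext y
    by_cases h : ∃ i, y ∈ D i
    · obtain ⟨i, hi⟩ := h
      rw [Set.mem_preimage, determinedValue_eq hH s₀ hi]
      constructor
      · exact fun hy => Or.inl (Set.mem_iUnion.2 ⟨i, hi, hy⟩)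
      · rintro (hy | hy)
        · obtain ⟨j, hj, hjt⟩ := Set.mem_iUnion.1 hy
          rw [hH i j y hi hj]
          exact hjt
        · exact (hy.1 (Set.mem_iUnion.2 ⟨i, hi⟩)).elim
    · have h' : ∀ i, y ∉ D i := fun i hi => h ⟨i, hi⟩
      simp [determinedValue, h']
  rw [this]
  exact (MeasurableSet.iUnion fun i => (hD i).inter (hHm i ht)).union
    ((MeasurableSet.iUnion hD).compl.inter (MeasurableSet.const _))

variable [DiscreteMeasurableSpace S]

/-- A field `μ` is a finitary factor of the i.i.d. process with marginal `m` if it is the limit of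
the laws of maps `F n` of the process (and of some additional randomness) whose value at a vertex
is eventually determined by the process in a finite window. -/
theorem isCoding_of_determined [Finite S] {m : Measure T} [IsProbabilityMeasure m]
    {Ω : Type*} [MeasurableSpace Ω] {ν : Measure Ω} [IsProbabilityMeasure ν]
    {μ : Measure (Zd d → S)} [IsProbabilityMeasure μ]
    {D : ℕ → Set (Zd d → T)} {H : ℕ → (Zd d → T) → S} {F : ℕ → (Zd d → T) × Ω → Zd d → S}
    (hH : ∀ i j y, y ∈ D i → y ∈ D j → H i y = H j y)
    (hD : ∀ i, MeasurableSet (D i)) (hHm : ∀ i, Measurable (H i))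
    (hDnull : iidLaw d m (⋂ i, (D i)ᶜ) = 0)
    (hF : ∀ i v, ∀ᶠ n in atTop, ∀ y z, shiftConfig v y ∈ D i →
      F n (y, z) v = H i (shiftConfig v y))
    (hlaw : ∀ (W : Finset (Zd d)) (ζ : Zd d → S), ∀ᶠ n in atTop,
      ((iidLaw d m).prod ν) {p | F n p ∈ cyl W ζ} = μ (cyl W ζ)) (s₀ : S) :
    IsCoding (iidLaw d m) μ (fun y v => determinedValue D H s₀ (shiftConfig v y)) := by
  set φ : (Zd d → T) → Zd d → S := fun y v => determinedValue D H s₀ (shiftConfig v y) with hφ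
  have hφm : Measurable φ := measurable_pi_lambda _ fun v =>
    (measurable_determinedValue hH hD hHm s₀).comp (measurable_shiftConfig v)
  refine ⟨hφm, fun u y => ?_, ?_⟩
  · ext v
    simp only [hφ, shiftConfig_shiftConfig]
    rfl
  have : IsProbabilityMeasure ((iidLaw d m).map φ) := Measure.isProbabilityMeasure_map hφm.aemeasurable
  refine measure_eq_of_cyl ∅ fun W _ ζ => ?_
  set P := (iidLaw d m).prod ν with hP
  rw [Measure.map_apply hφm (measurableSet_cyl W ζ)]
  have hfst : iidLaw d m (φ ⁻¹' cyl W ζ) = P {p | φ p.1 ∈ cyl W ζ} := by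
    have := (measurePreserving_fst (μ := iidLaw d m) (ν := ν)).measure_preimage
      (hφm (measurableSet_cyl W ζ)).nullMeasurableSet
    rw [← this]
    rfl
  set Bad : ℕ → Set (Zd d → T) := fun k => ⋃ v ∈ W, shiftConfig v ⁻¹' (⋂ i ∈ Finset.range k, (D i)ᶜ)
    with hBad
  -- Outside `Bad k`, the limit map agrees with all `F n` with `n` large.
  have hBadm : ∀ k, MeasurableSet (Bad k) := fun k =>
    Finset.measurableSet_biUnion _ fun v _ => measurable_shiftConfig v
      (Finset.measurableSet_biInter _ fun i _ => (hD i).compl)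
  have hBad0 : Tendsto (fun k => iidLaw d m (Bad k)) atTop (𝓝 0) := by
    have h1 : Tendsto (fun k => iidLaw d m (⋂ i ∈ Finset.range k, (D i)ᶜ)) atTop (𝓝 0) := by
      have := tendsto_measure_iInter_atTop (μ := iidLaw d m)
        (s := fun k => ⋂ i ∈ Finset.range k, (D i)ᶜ)
        (fun k => (Finset.measurableSet_biInter _ fun i _ => (hD i).compl).nullMeasurableSet)
        (fun a b hab => Set.biInter_mono (fun i hi => by simp at hi ⊢; omega) fun _ _ => le_rfl)
        ⟨0, measure_ne_top _ _⟩
      refine this.trans ?_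
      rw [nhds_le_nhds_iff, ← hDnull]
      congr 1
      ext y
      simp only [Set.mem_iInter]
      exact ⟨fun h i => h (i + 1) i (by simp), fun h k i _ => h i⟩
    have h2 : Tendsto (fun k => W.card • iidLaw d m (⋂ i ∈ Finset.range k, (D i)ᶜ)) atTop (𝓝 0) := by
      have := ENNReal.Tendsto.const_mul (a := (W.card : ℝ≥0∞)) h1 (Or.inr (ENNReal.natCast_ne_top _))
      simpa [nsmul_eq_mul] using this
    refine tendsto_of_tendsto_of_tendsto_of_le_of_le tendsto_const_nhds h2 (fun _ => zero_le)
      fun k => ?_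
    refine (measure_biUnion_finset_le _ _).trans ?_
    refine Finset.sum_le_card_nsmul _ _ _ fun v _ => ?_
    rw [← Measure.map_apply (measurable_shiftConfig v)
      (Finset.measurableSet_biInter _ fun i _ => (hD i).compl), map_shiftConfig_iidLaw]
  have hPBad : ∀ k, P {p | p.1 ∈ Bad k} = iidLaw d m (Bad k) := fun k =>
    (measurePreserving_fst (μ := iidLaw d m) (ν := ν)).measure_preimage
      (hBadm k).nullMeasurableSet
  have hagree : ∀ k, ∀ᶠ n in atTop, ∀ p : (Zd d → T) × Ω, p.1 ∉ Bad k →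
      (φ p.1 ∈ cyl W ζ ↔ F n p ∈ cyl W ζ) := by
    intro k
    have : ∀ᶠ n in atTop, ∀ v ∈ W, ∀ i ∈ Finset.range k, ∀ y z, shiftConfig v y ∈ D i →
        F n (y, z) v = H i (shiftConfig v y) :=
      (Finset.eventually_all W).2 fun v _ => (Finset.eventually_all _).2 fun i _ => hF i v
    filter_upwards [this] with n hn p hp
    refine forall₂_congr fun v hv => ?_
    simp only [hBad, Set.mem_iUnion, Set.mem_preimage, Set.mem_iInter, not_exists, not_forall,
      Set.mem_compl_iff, not_not] at hp
    obtain ⟨i, hi, hmem⟩ := hp v hv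
    have h1 : φ p.1 v = H i (shiftConfig v p.1) := determinedValue_eq hH s₀ hmem
    have h2 : F n p v = H i (shiftConfig v p.1) := hn v hv i hi p.1 p.2 hmem
    rw [h1, h2]
  have hle : ∀ k, P {p | φ p.1 ∈ cyl W ζ} ≤ μ (cyl W ζ) + iidLaw d m (Bad k) ∧
      μ (cyl W ζ) ≤ P {p | φ p.1 ∈ cyl W ζ} + iidLaw d m (Bad k) := by
    intro k
    obtain ⟨n, hn, hn'⟩ := ((hagree k).and (hlaw W ζ)).exists
    rw [← hn', ← hPBad k]
    constructor
    · refine (measure_mono fun p hp => ?_).trans (measure_union_le _ _)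
      by_cases hb : p.1 ∈ Bad k
      · exact Or.inr hb
      · exact Or.inl ((hn p hb).1 hp)
    · refine (measure_mono fun p hp => ?_).trans (measure_union_le _ _)
      by_cases hb : p.1 ∈ Bad k
      · exact Or.inr hb
      · exact Or.inl ((hn p hb).2 hp)
  rw [hfst]
  refine le_antisymm ?_ ?_
  · refine ge_of_tendsto' (x := atTop) (f := fun k => μ (cyl W ζ) + iidLaw d m (Bad k)) ?_ fun k => (hle k).1
    simpa using tendsto_const_nhds.add hBad0
  · refine ge_of_tendsto' (x := atTop) (f := fun k => P {p | φ p.1 ∈ cyl W ζ} + iidLaw d m (Bad k)) ?_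
      fun k => (hle k).2
    simpa using tendsto_const_nhds.add hBad0

end Coding

/-! ### Decomposition of a law along increasing lower bounds -/

section Decomposition

variable {S : Type*} [Fintype S]

/-- Given lower bounds `g 0 ≤ g 1 ≤ …` for a probability vector, the mass which is allotted before
step `j`: it increases by `(1 - θ) * θ ^ j` at step `j` and stays below `g j`. -/
noncomputable def allotted (θ : ℝ) (g : ℕ → S → ℝ) : ℕ → S → ℝ
  | 0 => 0
  | j + 1 => fun s => allotted θ g j s + (1 - θ) * θ ^ j *
      ((g j s - allotted θ g j s) / (∑ b, g j b - (1 - θ ^ j)))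

/-- The probability vector that is used at step `j`, proportional to the part of `g j` that has not
been allotted before. -/
noncomputable def stepWeight (θ : ℝ) (g : ℕ → S → ℝ) (j : ℕ) (s : S) : ℝ :=
  (g j s - allotted θ g j s) / (∑ b, g j b - (1 - θ ^ j))

theorem allotted_succ (θ : ℝ) (g : ℕ → S → ℝ) (j : ℕ) (s : S) :
    allotted θ g (j + 1) s = allotted θ g j s + (1 - θ) * θ ^ j * stepWeight θ g j s := rfl

theorem allotted_congr (θ : ℝ) {g g' : ℕ → S → ℝ} {j : ℕ} (h : ∀ i < j, g i = g' i) :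
    allotted θ g j = allotted θ g' j := by
  induction j with
  | zero => rfl
  | succ j ih =>
    ext s
    rw [allotted_succ, allotted_succ, stepWeight, stepWeight, ih fun i hi => h i (by omega),
      h j (by omega)]

theorem stepWeight_congr (θ : ℝ) {g g' : ℕ → S → ℝ} {j : ℕ} (h : ∀ i ≤ j, g i = g' i) :
    stepWeight θ g j = stepWeight θ g' j := by
  ext s
  rw [stepWeight, stepWeight, allotted_congr θ fun i hi => h i hi.le, h j le_rfl]

/-- The sub-probability vectors `g 0 ≤ g 1 ≤ …` have total masses at least `1 - θ`, `1 - θ ^ 2`, …. -/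
structure IsLowerBoundSeq (θ : ℝ) (g : ℕ → S → ℝ) : Prop where
  pos : 0 < θ
  lt_one : θ < 1
  mono : ∀ j s, g j s ≤ g (j + 1) s
  nonneg : ∀ j s, 0 ≤ g j s
  le_sum : ∀ j, 1 - θ ^ (j + 1) ≤ ∑ s, g j s

variable {θ : ℝ} {g : ℕ → S → ℝ}

theorem IsLowerBoundSeq.allotted_spec (h : IsLowerBoundSeq θ g) (j : ℕ) :
    (∀ s, 0 ≤ allotted θ g j s) ∧ (∀ s, allotted θ g j s ≤ g j s) ∧
      ∑ s, allotted θ g j s = 1 - θ ^ j := by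
  obtain ⟨h0, h1, hmono, hg0, hsum⟩ := h
  induction j with
  | zero => exact ⟨fun s => le_rfl, fun s => hg0 0 s, by simp [allotted]⟩
  | succ j ih =>
    obtain ⟨ih0, ih1, ih2⟩ := ih
    have hpow : 0 < θ ^ j := pow_pos h0 j
    have hstep : (1 - θ) * θ ^ j ≤ ∑ s, g j s - (1 - θ ^ j) := by
      have := hsum j
      rw [pow_succ] at this
      linarith
    have hpos : 0 < (1 - θ) * θ ^ j := mul_pos (by linarith) hpow
    have hden : 0 < ∑ s, g j s - (1 - θ ^ j) := hpos.trans_le hstep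
    have hw0 : ∀ s, 0 ≤ stepWeight θ g j s := fun s =>
      div_nonneg (by linarith [ih1 s]) hden.le
    refine ⟨fun s => ?_, fun s => ?_, ?_⟩
    · rw [allotted_succ]
      have := mul_nonneg hpos.le (hw0 s)
      linarith [ih0 s]
    · rw [allotted_succ]
      refine le_trans ?_ (hmono j s)
      have : (1 - θ) * θ ^ j * stepWeight θ g j s ≤ g j s - allotted θ g j s := by
        rw [stepWeight, mul_div_assoc', div_le_iff₀ hden, mul_comm]
        exact mul_le_mul_of_nonneg_left hstep (by linarith [ih1 s])
      linarith
    · simp_rw [allotted_succ]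
      rw [Finset.sum_add_distrib, ← Finset.mul_sum, ih2]
      have : ∑ s, stepWeight θ g j s = 1 := by
        simp_rw [stepWeight]
        rw [← Finset.sum_div, Finset.sum_sub_distrib, ih2, div_self hden.ne']
      rw [this, pow_succ]
      ring

theorem IsLowerBoundSeq.stepWeight_spec (h : IsLowerBoundSeq θ g) (j : ℕ) :
    (∀ s, 0 ≤ stepWeight θ g j s) ∧ ∑ s, stepWeight θ g j s = 1 := by
  obtain ⟨ih0, ih1, ih2⟩ := h.allotted_spec j
  obtain ⟨h0, h1, hmono, hg0, hsum⟩ := h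
  have hpow : 0 < θ ^ j := pow_pos h0 j
  have hpos : 0 < (1 - θ) * θ ^ j := mul_pos (by linarith) hpow
  have hden : 0 < ∑ s, g j s - (1 - θ ^ j) := by
    have := hsum j
    rw [pow_succ] at this
    linarith
  refine ⟨fun s => div_nonneg (by linarith [ih1 s]) hden.le, ?_⟩
  simp_rw [stepWeight]
  rw [← Finset.sum_div, Finset.sum_sub_distrib, ih2, div_self hden.ne']

theorem IsLowerBoundSeq.hasSum_stepWeight (h : IsLowerBoundSeq θ g) {p : S → ℝ}
    (hp : ∀ j s, g j s ≤ p s) (hp1 : ∑ s, p s = 1) (s : S) :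
    HasSum (fun j => θ ^ j * (1 - θ) * stepWeight θ g j s) (p s) := by
  have h0 := h.pos
  have h1 := h.lt_one
  have hpart : ∀ n, ∑ j ∈ Finset.range n, θ ^ j * (1 - θ) * stepWeight θ g j s =
      allotted θ g n s := by
    intro n
    induction n with
    | zero => simp [allotted]
    | succ n ih => rw [Finset.sum_range_succ, ih, allotted_succ]; ring
  have hnn : ∀ j, 0 ≤ θ ^ j * (1 - θ) * stepWeight θ g j s := fun j =>
    mul_nonneg (mul_nonneg (pow_nonneg h0.le j) (by linarith))
      ((h.stepWeight_spec j).1 s)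
  rw [hasSum_iff_tendsto_nat_of_nonneg hnn]
  simp_rw [hpart]
  have hlow : ∀ n, p s - θ ^ n ≤ allotted θ g n s := by
    intro n
    obtain ⟨_, hb, hc⟩ := h.allotted_spec n
    have h2 : ∑ b, (p b - allotted θ g n b) = θ ^ n := by
      rw [Finset.sum_sub_distrib, hp1, hc]
      ring
    have h3 := Finset.single_le_sum (f := fun b => p b - allotted θ g n b)
      (fun b _ => sub_nonneg.2 ((hb b).trans (hp n b))) (Finset.mem_univ s)
    linarith
  refine tendsto_of_tendsto_of_tendsto_of_le_of_le (g := fun n => p s - θ ^ n) (h := fun _ => p s)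
    ?_ tendsto_const_nhds hlow fun n => ?_
  · simpa using tendsto_const_nhds.sub (tendsto_pow_atTop_nhds_zero_of_lt_one h0.le h1)
  · exact ((h.allotted_spec n).2.1 s).trans (hp n s)

end Decomposition

section Sampler

variable {S : Type*} [Fintype S] [MeasurableSpace S] [DiscreteMeasurableSpace S] [Nonempty S]

theorem exists_sampler (w : S → ℝ) : ∃ f : unitInterval → S, Measurable f ∧
    ((∀ s, 0 ≤ w s) → ∑ s, w s = 1 → ∀ s, volume (f ⁻¹' {s}) = ENNReal.ofReal (w s)) := by
  by_cases hw : (∀ s, 0 ≤ w s) ∧ ∑ s, w s = 1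
  · obtain ⟨hw0, hw1⟩ := hw
    have hsum : ∑ s, ENNReal.ofReal (w s) = 1 := by
      rw [← ENNReal.ofReal_sum_of_nonneg fun s _ => hw0 s, hw1, ENNReal.ofReal_one]
    obtain ⟨f, hf, hmap⟩ :=
      (PMF.ofFintype (fun s => ENNReal.ofReal (w s)) hsum).toMeasure.exists_measurable_map_eq
    refine ⟨f, hf, fun _ _ s => ?_⟩
    rw [← Measure.map_apply hf (measurableSet_singleton s), hmap,
      PMF.toMeasure_apply_singleton _ _ (measurableSet_singleton s), PMF.ofFintype_apply]
  · exact ⟨fun _ => Classical.arbitrary S, measurable_const, fun h0 h1 => (hw ⟨h0, h1⟩).elim⟩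

/-- A map from the unit interval which transports the uniform law to the probability vector `w`. -/
noncomputable def sampler (w : S → ℝ) : unitInterval → S := (exists_sampler w).choose

theorem measurable_sampler (w : S → ℝ) : Measurable (sampler w) := (exists_sampler w).choose_spec.1

theorem volume_sampler_preimage {w : S → ℝ} (h0 : ∀ s, 0 ≤ w s) (h1 : ∑ s, w s = 1) (s : S) :
    volume (sampler w ⁻¹' {s}) = ENNReal.ofReal (w s) := (exists_sampler w).choose_spec.2 h0 h1 s

end Sampler

/-! ### The conditional law at a site given earlier sites -/

section Vertex

variable {d : ℕ} {S : Type*} [MeasurableSpace S]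

/-- The set of conditional probabilities of the value `s` at the origin, given any feasible pattern
off the origin which coincides with the pattern `x` on `W` in the ball of radius `r`. -/
def localCondProbs (μ : Measure (Zd d → S)) (r : ℕ) (W : Finset (Zd d)) (x : Zd d → S) (s : S) :
    Set ℝ :=
  {t | ∃ (A : Finset (Zd d)) (x' : Zd d → S), (0 : Zd d) ∉ A ∧
    (∀ v ∈ latticeBall (0 : Zd d) r, v ∈ A ↔ v ∈ W) ∧
    (∀ v ∈ W, v ∈ latticeBall (0 : Zd d) r → x' v = x v) ∧ μ (cyl A x') ≠ 0 ∧
    t = condProb μ A x' {y | y 0 = s}}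

/-- The part of the conditional law at the origin which is certain once the pattern `x` on `W` is
known in the ball of radius `r`. -/
noncomputable def lowerProb (μ : Measure (Zd d → S)) (r : ℕ) (W : Finset (Zd d)) (x : Zd d → S)
    (s : S) : ℝ :=
  sInf (localCondProbs μ r W x s)

theorem lowerProb_congr (μ : Measure (Zd d → S)) {r : ℕ} {W W' : Finset (Zd d)}
    {x x' : Zd d → S} (hW : ∀ v ∈ latticeBall (0 : Zd d) r, v ∈ W ↔ v ∈ W')
    (hx : ∀ v ∈ W, v ∈ latticeBall (0 : Zd d) r → x v = x' v) (s : S) :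
    lowerProb μ r W x s = lowerProb μ r W' x' s := by
  unfold lowerProb localCondProbs
  congr 1
  ext t
  refine exists₂_congr fun A y => and_congr_right fun _ => and_congr ?_ (and_congr ?_ Iff.rfl)
  · exact forall₂_congr fun v hv => by rw [hW v hv]
  · constructor
    · intro h v hv hvr
      have hv' := (hW v hvr).2 hv
      rw [h v hv' hvr, hx v hv' hvr]
    · intro h v hv hvr
      rw [h v ((hW v hvr).1 hv) hvr, hx v hv hvr]

theorem localCondProbs_nonneg {μ : Measure (Zd d → S)} {r : ℕ} {W : Finset (Zd d)} {x : Zd d → S}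
    {s : S} {t : ℝ} (ht : t ∈ localCondProbs μ r W x s) : 0 ≤ t := by
  obtain ⟨A, x', _, _, _, _, rfl⟩ := ht
  exact condProb_nonneg _ _ _ _

theorem bddBelow_localCondProbs (μ : Measure (Zd d → S)) (r : ℕ) (W : Finset (Zd d))
    (x : Zd d → S) (s : S) : BddBelow (localCondProbs μ r W x s) :=
  ⟨0, fun _ ht => localCondProbs_nonneg ht⟩

theorem lowerProb_nonneg (μ : Measure (Zd d → S)) (r : ℕ) (W : Finset (Zd d)) (x : Zd d → S)
    (s : S) : 0 ≤ lowerProb μ r W x s :=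
  Real.sInf_nonneg fun _ ht => localCondProbs_nonneg ht

variable {μ : Measure (Zd d → S)} {W : Finset (Zd d)} {x : Zd d → S}

theorem condProb_mem_localCondProbs (hW : (0 : Zd d) ∉ W) (hx : μ (cyl W x) ≠ 0) (r : ℕ) (s : S) :
    condProb μ W x {y | y 0 = s} ∈ localCondProbs μ r W x s :=
  ⟨W, x, hW, fun _ _ => Iff.rfl, fun _ _ _ => rfl, hx, rfl⟩

theorem lowerProb_le (hW : (0 : Zd d) ∉ W) (hx : μ (cyl W x) ≠ 0) (r : ℕ) (s : S) :
    lowerProb μ r W x s ≤ condProb μ W x {y | y 0 = s} :=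
  csInf_le (bddBelow_localCondProbs μ r W x s) (condProb_mem_localCondProbs hW hx r s)

theorem lowerProb_mono (hW : (0 : Zd d) ∉ W) (hx : μ (cyl W x) ≠ 0) {r r' : ℕ} (hr : r ≤ r')
    (s : S) : lowerProb μ r W x s ≤ lowerProb μ r' W x s := by
  refine csInf_le_csInf (bddBelow_localCondProbs μ r W x s)
    ⟨_, condProb_mem_localCondProbs hW hx r' s⟩ ?_
  rintro t ⟨A, x', h1, h2, h3, h4⟩
  have hb : ∀ v, v ∈ latticeBall (0 : Zd d) r → v ∈ latticeBall (0 : Zd d) r' := fun v hv => by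
    rw [mem_latticeBall] at hv ⊢
    omega
  exact ⟨A, x', h1, fun v hv => h2 v (hb v hv), fun v hv hvr => h3 v hv (hb v hvr), h4⟩

theorem sum_condProb_eval [DiscreteMeasurableSpace S] [Fintype S] [IsFiniteMeasure μ]
    (hx : μ (cyl W x) ≠ 0) (u : Zd d) : ∑ s, condProb μ W x {y | y u = s} = 1 := by
  have := cond_isProbabilityMeasure hx
  unfold condProb
  rw [← measureReal_biUnion_finset]
  · have : ⋃ s ∈ Finset.univ, {y : Zd d → S | y u = s} = Set.univ := by
      ext y
      simp
    rw [this]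
    simp
  · intro a _ b _ hab
    refine Set.disjoint_left.2 fun y hy hy' => hab ?_
    exact (Eq.symm hy).trans hy'
  · exact fun s _ => measurableSet_eval_eq u s

variable [DiscreteMeasurableSpace S] [Fintype S]

/-- Strong spatial mixing bounds from below the mass of the certain part of the conditional law. -/
theorem StrongSpatialMixing.one_sub_le_sum_lowerProb [IsFiniteMeasure μ]
    (hμ : IsMarkovRandomField μ) {ρ : ℕ → ℝ≥0} (hs : StrongSpatialMixing μ ρ)
    (hρ : AntitoneOn ρ (Set.Ici 1)) (hW : (0 : Zd d) ∉ W) (hx : μ (cyl W x) ≠ 0) (r : ℕ) :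
    1 - Fintype.card S * (2 * ρ (r + 1)) ≤ ∑ s, lowerProb μ r W x s := by
  have h : ∀ s, condProb μ W x {y | y 0 = s} - 2 * ρ (r + 1) ≤ lowerProb μ r W x s := by
    intro s
    refine le_csInf ⟨_, condProb_mem_localCondProbs hW hx r s⟩ ?_
    rintro t ⟨A, x', h1, h2, h3, h4, rfl⟩
    have := hs.abs_condProb_sub_le hμ hρ 0 r hW h1 (fun v hv => (h2 v hv).symm)
      (fun v hv hvr => (h3 v hv hvr).symm) hx h4 s
    linarith [(abs_le.1 this).2]
  calc 1 - Fintype.card S * (2 * ρ (r + 1))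
      = ∑ s, (condProb μ W x {y | y 0 = s} - 2 * (ρ (r + 1) : ℝ)) := by
        rw [Finset.sum_sub_distrib, sum_condProb_eval hx]
        simp
    _ ≤ _ := Finset.sum_le_sum fun s _ => h s

/-- The single-site sampling rule: given the level `j`, which grants access to the ball of radius
`r₀ + j`, and the pattern `x` on the set `W` of known sites, it turns a uniform variable into a
value at the origin. -/
noncomputable def siteRule [Nonempty S] (μ : Measure (Zd d → S)) (θ : ℝ) (r₀ j : ℕ)
    (W : Finset (Zd d)) (x : Zd d → S) : unitInterval → S :=
  sampler (stepWeight θ (fun i => lowerProb μ (r₀ + i) W x) j)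

theorem measurable_siteRule [Nonempty S] (μ : Measure (Zd d → S)) (θ : ℝ) (r₀ j : ℕ)
    (W : Finset (Zd d)) (x : Zd d → S) : Measurable (siteRule μ θ r₀ j W x) :=
  measurable_sampler _

theorem siteRule_congr [Nonempty S] (μ : Measure (Zd d → S)) (θ : ℝ) (r₀ j : ℕ)
    {W W' : Finset (Zd d)} {x x' : Zd d → S}
    (hW : ∀ v ∈ latticeBall (0 : Zd d) (r₀ + j), v ∈ W ↔ v ∈ W')
    (hx : ∀ v ∈ W, v ∈ latticeBall (0 : Zd d) (r₀ + j) → x v = x' v) :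
    siteRule μ θ r₀ j W x = siteRule μ θ r₀ j W' x' := by
  unfold siteRule
  congr 1
  refine stepWeight_congr θ fun i hi => ?_
  have hb : ∀ v, v ∈ latticeBall (0 : Zd d) (r₀ + i) → v ∈ latticeBall (0 : Zd d) (r₀ + j) :=
    fun v hv => by
      rw [mem_latticeBall] at hv ⊢
      omega
  ext s
  exact lowerProb_congr μ (fun v hv => hW v (hb v hv)) (fun v hv hvr => hx v hv (hb v hvr)) s

/-- If the certain parts of the conditional laws have large enough masses, then the sampling rule,
with a geometric level, produces the conditional law. -/
theorem measure_siteRule [Nonempty S] [IsFiniteMeasure μ] {p : unitInterval} {θ : ℝ} {r₀ : ℕ}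
    (hp : (p : ℝ) = 1 - θ) (h0 : 0 < θ) (h1 : θ < 1) (hW : (0 : Zd d) ∉ W)
    (hx : μ (cyl W x) ≠ 0)
    (hsum : ∀ j, 1 - θ ^ (j + 1) ≤ ∑ s, lowerProb μ (r₀ + j) W x s) (s : S) :
    ((geometricMeasure p).prod volume) {q : ℕ × unitInterval | siteRule μ θ r₀ q.1 W x q.2 = s} =
      ENNReal.ofReal (condProb μ W x {y | y 0 = s}) := by
  have hp0 : p ≠ 0 := by
    rintro rfl
    simp at hp
    linarith
  have hlb : IsLowerBoundSeq θ (fun i => lowerProb μ (r₀ + i) W x) :=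
    ⟨h0, h1, fun j s => lowerProb_mono hW hx (by omega) s, fun j s => lowerProb_nonneg _ _ _ _ _,
      hsum⟩
  have hms : MeasurableSet {q : ℕ × unitInterval | siteRule μ θ r₀ q.1 W x q.2 = s} :=
    (measurable_from_prod_countable_right (f := fun q : ℕ × unitInterval =>
      siteRule μ θ r₀ q.1 W x q.2) fun j => measurable_siteRule μ θ r₀ j W x)
      (measurableSet_singleton s)
  rw [Measure.prod_apply hms, lintegral_countable']
  have hterm : ∀ j : ℕ, volume (Prod.mk j ⁻¹' {q : ℕ × unitInterval |
      siteRule μ θ r₀ q.1 W x q.2 = s}) * geometricMeasure p {j} =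
      ENNReal.ofReal (θ ^ j * (1 - θ) * stepWeight θ (fun i => lowerProb μ (r₀ + i) W x) j s) := by
    intro j
    have h2 := volume_sampler_preimage (hlb.stepWeight_spec j).1 (hlb.stepWeight_spec j).2 s
    rw [geometricMeasure_singleton hp0, hp, sub_sub_cancel, mul_comm,
      ENNReal.ofReal_mul (mul_nonneg (pow_nonneg h0.le j) (by linarith)), ← h2]
    rfl
  simp_rw [hterm]
  have hs := hlb.hasSum_stepWeight (p := fun s => condProb μ W x {y | y 0 = s})
    (fun j s => lowerProb_le hW hx _ s) (sum_condProb_eval hx 0) s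
  rw [← ENNReal.ofReal_tsum_of_nonneg _ hs.summable, hs.tsum_eq]
  exact fun j => mul_nonneg (mul_nonneg (pow_nonneg h0.le j) (by linarith))
    ((hlb.stepWeight_spec j).1 s)

end Vertex

/-! ### Sampling the sites in a random order -/

section Order

/-- A map whose value at a site of `A` only depends on the values at the sites of `A` with a
smaller label has iterates which stabilize on `A`. -/
theorem iterate_eq_of_rank_lt {V S L : Type*} [LinearOrder L] {Φ Φ' : (V → S) → V → S} {A : Finset V}
    {t : V → L} (h : ∀ u ∈ A, ∀ x x' : V → S, (∀ w ∈ A, t w < t u → x w = x' w) →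
      Φ x u = Φ' x' u) (x x' : V → S) {u : V} (hu : u ∈ A) {k k' : ℕ}
    (hk : (A.filter fun w => t w < t u).card < k) (hk' : (A.filter fun w => t w < t u).card < k') :
    Φ^[k] x u = Φ'^[k'] x' u := by
  induction k generalizing k' u with
  | zero => omega
  | succ k ih =>
    obtain ⟨k', rfl⟩ : ∃ l, k' = l + 1 := ⟨k' - 1, by omega⟩
    rw [Function.iterate_succ_apply', Function.iterate_succ_apply']
    refine h u hu _ _ fun w hw hwu => ?_
    have hlt : (A.filter fun v => t v < t w).card < (A.filter fun v => t v < t u).card := by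
      refine Finset.card_lt_card ⟨fun v hv => ?_, fun hsub => ?_⟩
      · rw [Finset.mem_filter] at hv ⊢
        exact ⟨hv.1, hv.2.trans hwu⟩
      · have := hsub (Finset.mem_filter.2 ⟨hw, hwu⟩)
        exact lt_irrefl _ (Finset.mem_filter.1 this).2
    exact ih hw (by omega) (by omega)

/-- The chain rule along an ordering of a finite set by labels. -/
theorem prod_eq_of_chain {V L : Type*} [DecidableEq V] [LinearOrder L] (t : V → L)
    (m : Finset V → ℝ≥0∞) (hm : m ∅ = 1) (φ : V → ℝ≥0∞) (Λ : Finset V)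
    (ht : Set.InjOn t Λ)
    (h : ∀ u ∈ Λ, φ u * m (Λ.filter fun w => t w < t u) =
      m (insert u (Λ.filter fun w => t w < t u))) :
    ∏ u ∈ Λ, φ u = m Λ := by
  induction Λ using Finset.induction_on_max_value t with
  | empty => simp [hm]
  | insert a s has hmax ih =>
    have hlt : ∀ x ∈ s, t x < t a := fun x hx => by
      refine lt_of_le_of_ne (hmax x hx) fun heq => has ?_
      rwa [← ht (by simp [hx]) (by simp) heq]
    have ha : (insert a s).filter (fun w => t w < t a) = s := by
      rw [Finset.filter_insert, if_neg (lt_irrefl _)]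
      exact Finset.filter_true_of_mem hlt
    have hs : ∀ u ∈ s, (insert a s).filter (fun w => t w < t u) = s.filter fun w => t w < t u :=
      fun u hu => by rw [Finset.filter_insert, if_neg (hlt u hu).le.not_gt]
    have h1 := h a (Finset.mem_insert_self a s)
    rw [ha] at h1
    rw [Finset.prod_insert has, ih (ht.mono (by simp)) fun u hu => by
      rw [← hs u hu]; exact h u (Finset.mem_insert_of_mem hu), h1]

theorem ae_injective_pi {ι : Type*} [Fintype ι] :
    ∀ᵐ t ∂(Measure.pi fun _ : ι => (volume : Measure unitInterval)), Function.Injective t := by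
  have h : ∀ i j : ι, i ≠ j →
      ∀ᵐ t ∂(Measure.pi fun _ : ι => (volume : Measure unitInterval)), t i ≠ t j := by
    intro i j hij
    have hind : IndepFun (fun t : ι → unitInterval => t i) (fun t => t j)
        (Measure.pi fun _ : ι => (volume : Measure unitInterval)) :=
      (iIndepFun_pi (μ := fun _ : ι => (volume : Measure unitInterval)) (X := fun _ => id)
        fun _ => aemeasurable_id).indepFun hij
    have hprod := (indepFun_iff_map_prod_eq_prod_map_map (measurable_pi_apply i).aemeasurable
      (measurable_pi_apply j).aemeasurable).1 hind
    have hev : ∀ k : ι, (Measure.pi fun _ : ι => (volume : Measure unitInterval)).map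
        (fun t => t k) = volume := fun k =>
      (measurePreserving_eval (fun _ : ι => (volume : Measure unitInterval)) k).map_eq
    rw [hev, hev] at hprod
    have hdiag : MeasurableSet {p : unitInterval × unitInterval | p.1 = p.2} :=
      measurableSet_eq_fun measurable_fst measurable_snd
    have h0 : ((volume : Measure unitInterval).prod volume)
        {p : unitInterval × unitInterval | p.1 = p.2} = 0 := by
      rw [Measure.measure_prod_null hdiag]
      refine ae_of_all _ fun a => ?_
      have : Prod.mk a ⁻¹' {p : unitInterval × unitInterval | p.1 = p.2} = {a} := by
        ext b
        simp [eq_comm]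
      simp [this]
    rw [← hprod, Measure.map_apply ((measurable_pi_apply i).prodMk (measurable_pi_apply j))
      hdiag] at h0
    exact measure_eq_zero_iff_ae_notMem.1 h0
  have h' : ∀ᵐ t ∂(Measure.pi fun _ : ι => (volume : Measure unitInterval)),
      ∀ i j : ι, i ≠ j → t i ≠ t j :=
    ae_all_iff.2 fun i => ae_all_iff.2 fun j => by
      by_cases hij : i = j
      · exact ae_of_all _ fun t hne => (hne hij).elim
      · filter_upwards [h i j hij] with t ht _ using ht
  filter_upwards [h'] with t ht i j hij
  by_contra hne
  exact ht i j hne hij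

end Order

section Sequential

variable {d : ℕ} {S : Type*}

/-- The randomness at a site for sequential sampling: a label which determines the position in the
random order, a level which determines the range of the sampling rule, and a uniform variable. -/
abbrev SeqSite : Type := unitInterval × ℕ × unitInterval

/-- The law of the randomness at a site for sequential sampling. -/
noncomputable def seqLaw (p : unitInterval) : Measure SeqSite :=
  (volume : Measure unitInterval).prod ((geometricMeasure p).prod volume)

instance (p : unitInterval) : IsProbabilityMeasure (seqLaw p) := by
  unfold seqLaw; infer_instance

/-- The sites of `Λ` in the range of the site `u` which precede `u` in the random order, seen
from `u`. -/
noncomputable def knownSites (r₀ : ℕ) (Λ : Set (Zd d)) (y : Zd d → SeqSite) (u : Zd d) :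
    Finset (Zd d) :=
  open Classical in (latticeBall (0 : Zd d) (r₀ + (y u).2.1)).filter fun w =>
    w + u ∈ Λ ∧ (y (w + u)).1 < (y u).1

theorem mem_knownSites {r₀ : ℕ} {Λ : Set (Zd d)} {y : Zd d → SeqSite} {u w : Zd d} :
    w ∈ knownSites r₀ Λ y u ↔ latticeDist w 0 ≤ r₀ + (y u).2.1 ∧ w + u ∈ Λ ∧
      (y (w + u)).1 < (y u).1 := by
  simp [knownSites]

theorem shiftConfig_add_image_sub (A : Finset (Zd d)) (u : Zd d) (ζ : Zd d → S) :
    shiftConfig u ⁻¹' cyl (A.image fun w => w - u) (shiftConfig u ζ) = cyl A ζ := by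
  ext x
  simp [mem_cyl, shiftConfig]

variable [MeasurableSpace S] [DiscreteMeasurableSpace S]

theorem TranslationInvariant.measure_cyl {μ : Measure (Zd d → S)} (h : TranslationInvariant μ)
    (A : Finset (Zd d)) (u : Zd d) (ζ : Zd d → S) :
    μ (cyl (A.image fun w => w - u) (shiftConfig u ζ)) = μ (cyl A ζ) := by
  conv_lhs => rw [← h u]
  rw [Measure.map_apply (measurable_shiftConfig u) (measurableSet_cyl _ _),
    shiftConfig_add_image_sub]

variable [Fintype S] [Nonempty S]

/-- One step of sequential sampling in `Λ`: at every site, the sampling rule is applied to the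
current values at the preceding sites. -/
noncomputable def seqStep (μ : Measure (Zd d → S)) (θ : ℝ) (r₀ : ℕ) (Λ : Set (Zd d))
    (y : Zd d → SeqSite) (x : Zd d → S) (u : Zd d) : S :=
  siteRule μ θ r₀ (y u).2.1 (knownSites r₀ Λ y u) (shiftConfig u x) (y u).2.2

theorem seqStep_shiftConfig (μ : Measure (Zd d → S)) (θ : ℝ) (r₀ : ℕ) (Λ : Set (Zd d))
    (y : Zd d → SeqSite) (x : Zd d → S) (v : Zd d) :
    seqStep μ θ r₀ {w | w + v ∈ Λ} (shiftConfig v y) (shiftConfig v x) =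
      shiftConfig v (seqStep μ θ r₀ Λ y x) := by
  ext u
  have h : knownSites r₀ {w | w + v ∈ Λ} (shiftConfig v y) u = knownSites r₀ Λ y (u + v) := by
    ext w
    simp [mem_knownSites, shiftConfig, add_assoc]
  simp only [seqStep, h, shiftConfig_shiftConfig]
  rfl

theorem iterate_seqStep_shiftConfig (μ : Measure (Zd d → S)) (θ : ℝ) (r₀ : ℕ) (Λ : Set (Zd d))
    (y : Zd d → SeqSite) (x : Zd d → S) (v : Zd d) (k : ℕ) :
    (seqStep μ θ r₀ {w | w + v ∈ Λ} (shiftConfig v y))^[k] (shiftConfig v x) =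
      shiftConfig v ((seqStep μ θ r₀ Λ y)^[k] x) := by
  induction k with
  | zero => rfl
  | succ k ih =>
    rw [Function.iterate_succ_apply', Function.iterate_succ_apply', ih, seqStep_shiftConfig]

/-- In a finite set, the outcome of sequential sampling is the only configuration which is
compatible with the sampling rule at every site. -/
theorem iterate_seqStep_mem_cyl_iff (μ : Measure (Zd d → S)) (θ : ℝ) (r₀ : ℕ) (Λ : Finset (Zd d))
    (y : Zd d → SeqSite) (x ζ : Zd d → S) {k : ℕ} (hk : Λ.card < k) :
    (seqStep μ θ r₀ Λ y)^[k] x ∈ cyl Λ ζ ↔ ∀ u ∈ Λ, seqStep μ θ r₀ Λ y ζ u = ζ u := by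
  set Φ := seqStep μ θ r₀ (Λ : Set (Zd d)) y with hΦ
  have hdep : ∀ u ∈ Λ, ∀ x x' : Zd d → S, (∀ w ∈ Λ, (y w).1 < (y u).1 → x w = x' w) →
      Φ x u = Φ x' u := by
    intro u _ x x' h
    refine congrFun (siteRule_congr μ θ r₀ _ (fun _ _ => Iff.rfl) fun w hw _ => ?_) _
    rw [mem_knownSites] at hw
    exact h _ hw.2.1 hw.2.2
  have hrank : ∀ u, (Λ.filter fun w => (y w).1 < (y u).1).card < k := fun u =>
    (Finset.card_filter_le _ _).trans_lt hk
  constructor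
  · intro h u hu
    rw [hdep u hu ζ (Φ^[k] x) fun w hw _ => (h w hw).symm, ← Function.iterate_succ_apply' Φ,
      iterate_eq_of_rank_lt hdep x x hu ((hrank u).trans (Nat.lt_succ_self k)) (hrank u)]
    exact h u hu
  · intro h u hu
    have hfix : ∀ l, ∀ u ∈ Λ, Φ^[l] ζ u = ζ u := by
      intro l
      induction l with
      | zero => exact fun _ _ => rfl
      | succ l ih =>
        intro u hu
        rw [Function.iterate_succ_apply', hdep u hu _ ζ fun w hw _ => ih w hw, h u hu]
    rw [iterate_eq_of_rank_lt hdep x ζ hu (hrank u) (hrank u), hfix k u hu]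

/-- The sampling rule at `u`, in terms of all preceding sites. -/
theorem seqStep_eq (μ : Measure (Zd d → S)) (θ : ℝ) (r₀ : ℕ) (Λ : Finset (Zd d))
    (y : Zd d → SeqSite) (ζ : Zd d → S) (u : Zd d) :
    seqStep μ θ r₀ Λ y ζ u = siteRule μ θ r₀ (y u).2.1
      ((Λ.filter fun w => (y w).1 < (y u).1).image fun w => w - u) (shiftConfig u ζ) (y u).2.2 := by
  refine congrFun (siteRule_congr μ θ r₀ _ (fun w hw => ?_) fun _ _ _ => rfl) _
  rw [mem_latticeBall] at hw
  simp only [mem_knownSites, hw, true_and, Finset.mem_coe, Finset.mem_image, Finset.mem_filter]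
  constructor
  · exact fun h => ⟨w + u, h, by simp⟩
  · rintro ⟨w', h, rfl⟩
    simpa using h

/-- Sequential sampling in a finite set produces the law of the field. -/
theorem iidLaw_iterate_seqStep {μ : Measure (Zd d → S)} [IsProbabilityMeasure μ]
    (hinv : TranslationInvariant μ) {p : unitInterval} {θ : ℝ} {r₀ : ℕ}
    (hp : (p : ℝ) = 1 - θ) (h0 : 0 < θ) (h1 : θ < 1)
    (hsum : ∀ (W : Finset (Zd d)) (x : Zd d → S), (0 : Zd d) ∉ W → μ (cyl W x) ≠ 0 →
      ∀ j, 1 - θ ^ (j + 1) ≤ ∑ s, lowerProb μ (r₀ + j) W x s)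
    (Λ : Finset (Zd d)) (x ζ : Zd d → S) {k : ℕ} (hk : Λ.card < k) :
    iidLaw d (seqLaw p) {y | (seqStep μ θ r₀ Λ y)^[k] x ∈ cyl Λ ζ} = μ (cyl Λ ζ) := by
  classical
  -- The labels, extended from `Λ` to the lattice.
  let ext : (Λ → unitInterval) → Zd d → unitInterval := fun t v => if h : v ∈ Λ then t ⟨v, h⟩ else 0
  let past : (Λ → unitInterval) → Zd d → Finset (Zd d) := fun t u =>
    Λ.filter fun w => ext t w < ext t u
  let C : Zd d → Finset (Zd d) → Set (ℕ × unitInterval) := fun u P =>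
    {q | siteRule μ θ r₀ q.1 (P.image fun w => w - u) (shiftConfig u ζ) q.2 = ζ u}
  let B : Set ((Λ → unitInterval) × (Λ → ℕ × unitInterval)) :=
    {z | ∀ u : Λ, z.2 u ∈ C u (past z.1 u)}
  have hCm : ∀ u P, MeasurableSet (C u P) := fun u P =>
    (measurable_from_prod_countable_right (f := fun q : ℕ × unitInterval =>
      siteRule μ θ r₀ q.1 (P.image fun w => w - u) (shiftConfig u ζ) q.2)
      fun j => measurable_siteRule μ θ r₀ j _ _) (measurableSet_singleton (ζ u))
  have hextm : ∀ v, Measurable fun t : Λ → unitInterval => ext t v := by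
    intro v
    by_cases hv : v ∈ Λ
    · simp only [ext, hv, dite_true]
      exact measurable_pi_apply _
    · simp only [ext, hv, dite_false]
      exact measurable_const
  have hBm : MeasurableSet B := by
    have : B = ⋂ u : Λ, ⋃ P : Finset (Zd d), {z | past z.1 u = P} ∩ {z | z.2 u ∈ C u P} := by
      ext z
      simp [B]
    rw [this]
    refine MeasurableSet.iInter fun u => MeasurableSet.iUnion fun P => MeasurableSet.inter ?_ ?_
    · have h2 : MeasurableSet {t : Λ → unitInterval | past t u = P} := by
        have : {t : Λ → unitInterval | past t u = P} =
            ⋂ v : Zd d, {t | (v ∈ Λ ∧ ext t v < ext t u) ↔ v ∈ P} := by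
          ext t
          simp [past, Finset.ext_iff]
        rw [this]
        refine MeasurableSet.iInter fun v => ?_
        have h3 : MeasurableSet {t : Λ → unitInterval | v ∈ Λ ∧ ext t v < ext t u} :=
          (MeasurableSet.const _).inter (measurableSet_lt (f := fun t => ext t v) (g := fun t => ext t u)
            (hextm v) (hextm u))
        by_cases hvP : v ∈ P
        · simpa [hvP] using h3
        · simp only [hvP, iff_false]
          exact h3.compl
      exact measurable_fst h2
    · exact ((measurable_pi_apply u).comp measurable_snd) (hCm u P)
  have hset : {y : Zd d → SeqSite | (seqStep μ θ r₀ Λ y)^[k] x ∈ cyl Λ ζ} =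
      Λ.restrict (π := fun _ => SeqSite) ⁻¹'
        (MeasurableEquiv.arrowProdEquivProdArrow unitInterval (ℕ × unitInterval) Λ ⁻¹' B) := by
    ext y
    rw [Set.mem_ofPred_eq, iterate_seqStep_mem_cyl_iff μ θ r₀ Λ y x ζ hk]
    have hpast : ∀ u ∈ Λ, past (fun i : Λ => (y i).1) u =
        Λ.filter fun w => (y w).1 < (y u).1 := by
      intro u hu
      refine Finset.filter_congr fun w hw => ?_
      simp [ext, hu, hw]
    constructor
    · intro h u
      have := h u u.2
      rw [seqStep_eq, ← hpast u u.2] at this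
      exact this
    · intro h u hu
      rw [seqStep_eq, ← hpast u hu]
      exact h ⟨u, hu⟩
  rw [hset, ← Measure.map_apply (Finset.measurable_restrict Λ)
    ((MeasurableEquiv.measurable _) hBm), iidLaw, Measure.infinitePi_map_restrict]
  have hmp := measurePreserving_arrowProdEquivProdArrow unitInterval (ℕ × unitInterval) Λ
    (fun _ => volume) fun _ => (geometricMeasure p).prod volume
  have := hmp.measure_preimage hBm.nullMeasurableSet
  simp only [seqLaw]
  rw [this, Measure.prod_apply hBm]
  have hae : ∀ᵐ t ∂(Measure.pi fun _ : Λ => (volume : Measure unitInterval)),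
      (Measure.pi fun _ : Λ => (geometricMeasure p).prod volume) (Prod.mk t ⁻¹' B) =
        μ (cyl Λ ζ) := by
    filter_upwards [ae_injective_pi] with t ht
    have hbox : Prod.mk t ⁻¹' B = Set.pi Set.univ fun u : Λ => C u (past t u) := by
      ext q
      simp [B]
    rw [hbox, Measure.pi_pi, Finset.prod_coe_sort Λ fun u =>
      ((geometricMeasure p).prod volume) (C u (past t u))]
    refine prod_eq_of_chain (ext t) (fun A => μ (cyl A ζ)) (by simp) _ Λ ?_ fun u hu => ?_
    · intro v hv w hw hvw
      simp only [Finset.mem_coe] at hv hw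
      simp only [ext, hv, hw, dite_true] at hvw
      exact congrArg Subtype.val (ht hvw)
    · change _ * μ (cyl (past t u) ζ) = μ (cyl (insert u (past t u)) ζ)
      set P := past t u with hP
      have huP : u ∉ P := fun h => lt_irrefl _ (Finset.mem_filter.1 h).2
      by_cases hnull : μ (cyl P ζ) = 0
      · rw [hnull, mul_zero]
        exact (measure_mono_null (cyl_mono (Finset.subset_insert u P) ζ) hnull).symm
      have hW : (0 : Zd d) ∉ P.image fun w => w - u := by
        intro h
        obtain ⟨w, hw, hwu⟩ := Finset.mem_image.1 h
        exact huP (by rwa [sub_eq_zero.1 hwu] at hw)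
      have hx : μ (cyl (P.image fun w => w - u) (shiftConfig u ζ)) ≠ 0 := by
        rwa [hinv.measure_cyl]
      have hrule := measure_siteRule hp h0 h1 hW hx (hsum _ _ hW hx) (ζ u)
      change ((geometricMeasure p).prod volume) {q | _} * _ = _
      rw [hrule, ← hinv.measure_cyl P u ζ, ← hinv.measure_cyl (insert u P) u ζ,
        ← ofReal_measureReal, ← ENNReal.ofReal_mul (condProb_nonneg _ _ _ _), condProb_mul,
        ofReal_measureReal]
      congr 1
      ext z
      simp [mem_cyl, shiftConfig, and_comm]
  rw [lintegral_congr_ae hae]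
  simp

end Sequential

/-! ### The clan of ancestors of a site -/

section Clan

variable {d : ℕ} {S : Type*}

/-- A map of a configuration and a further variable which depends on finitely many coordinates of
the configuration is jointly measurable if it is measurable in the further variable. -/
theorem measurable_uncurry_of_dependsOn_finset [MeasurableSpace S] [DiscreteMeasurableSpace S]
    [Finite S] {Ω Z : Type*} [MeasurableSpace Ω] [MeasurableSpace Z]
    (A : Finset (Zd d)) (f : (Zd d → S) → Ω → Z)
    (h : ∀ x x', (∀ v ∈ A, x v = x' v) → f x = f x') (hf : ∀ x, Measurable (f x)) :
    Measurable fun p : (Zd d → S) × Ω => f p.1 p.2 := by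
  obtain hS | hS := isEmpty_or_nonempty (Zd d → S)
  · have : IsEmpty ((Zd d → S) × Ω) := inferInstance
    exact measurable_of_empty _
  have hfac : Function.FactorsThrough f (A.restrict (π := fun _ => S)) := fun x x' hx =>
    h x x' fun v hv => congrFun hx ⟨v, hv⟩
  have : Nonempty (Ω → Z) := ⟨f hS.some⟩
  have hg : ∀ a : A → S, Measurable (Function.extend (A.restrict (π := fun _ => S)) f
      (fun _ => f hS.some) a) := by
    intro a
    by_cases ha : ∃ x, A.restrict (π := fun _ => S) x = a
    · obtain ⟨x, rfl⟩ := ha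
      rw [hfac.extend_apply]
      exact hf x
    · rw [Function.extend_apply' _ _ _ ha]
      exact hf _
  have hm := (measurable_from_prod_countable_right (f := fun q : (A → S) × Ω =>
    Function.extend (A.restrict (π := fun _ => S)) f (fun _ => f hS.some) q.1 q.2) hg).comp
    (((Finset.measurable_restrict A).comp measurable_fst).prodMk measurable_snd :
      Measurable fun p : (Zd d → S) × Ω => (A.restrict p.1, p.2))
  convert hm using 1
  ext p
  simp only [Function.comp_apply]
  rw [hfac.extend_apply]

/-- The sites which are reached from the origin in `n` steps, each of which goes to a preceding
site in the range of the current site. -/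
def IsAncestor (r₀ : ℕ) (y : Zd d → SeqSite) : ℕ → Zd d → Prop
  | 0, u => u = 0
  | n + 1, u => ∃ w, IsAncestor r₀ y n w ∧ latticeDist u w ≤ r₀ + (y w).2.1 ∧ (y u).1 < (y w).1

/-- The event that all ancestors of the origin, together with their ranges, lie in the ball of
radius `r`. -/
def clanEvent (d r₀ r : ℕ) : Set (Zd d → SeqSite) :=
  {y | ∀ n u, IsAncestor r₀ y n u → ∀ w, latticeDist w u ≤ r₀ + (y u).2.1 → latticeDist w 0 ≤ r}

theorem clanEvent_congr {r₀ r : ℕ} {y y' : Zd d → SeqSite} (hy : y ∈ clanEvent d r₀ r)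
    (h : ∀ v, latticeDist v 0 ≤ r → y' v = y v) : y' ∈ clanEvent d r₀ r := by
  have key : ∀ n u, IsAncestor r₀ y' n u → IsAncestor r₀ y n u := by
    intro n
    induction n with
    | zero => exact fun u hu => hu
    | succ n ih =>
      rintro u ⟨w, hw, hdist, hlt⟩
      have hw' := ih w hw
      have hwy : y' w = y w := h w (hy n w hw' w (by simp))
      rw [hwy] at hdist hlt
      have huy : y' u = y u := h u (hy n w hw' u hdist)
      rw [huy] at hlt
      exact ⟨w, hw', hdist, hlt⟩
  intro n u hu w hw
  have hu' := key n u hu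
  have huy : y' u = y u := h u (hy n u hu' u (by simp))
  rw [huy] at hw
  exact hy n u hu' w hw

theorem measurable_label (u : Zd d) : Measurable fun y : Zd d → SeqSite => (y u).1 :=
  measurable_fst.comp (measurable_pi_apply u)

theorem measurable_level (u : Zd d) : Measurable fun y : Zd d → SeqSite => (y u).2.1 :=
  measurable_fst.comp (measurable_snd.comp (measurable_pi_apply u))

theorem measurableSet_label_lt (u w : Zd d) :
    MeasurableSet {y : Zd d → SeqSite | (y u).1 < (y w).1} :=
  measurableSet_lt (f := fun y : Zd d → SeqSite => (y u).1) (g := fun y => (y w).1)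
    (measurable_label u) (measurable_label w)

theorem measurableSet_range (r₀ : ℕ) (u w : Zd d) :
    MeasurableSet {y : Zd d → SeqSite | latticeDist u w ≤ r₀ + (y w).2.1} :=
  measurable_level w (MeasurableSet.of_discrete (s := {j | latticeDist u w ≤ r₀ + j}))

theorem measurableSet_isAncestor (r₀ n : ℕ) (u : Zd d) :
    MeasurableSet {y : Zd d → SeqSite | IsAncestor r₀ y n u} := by
  induction n generalizing u with
  | zero => exact MeasurableSet.const _
  | succ n ih =>
    have : {y : Zd d → SeqSite | IsAncestor r₀ y (n + 1) u} =
        ⋃ w, {y | IsAncestor r₀ y n w} ∩ ({y | latticeDist u w ≤ r₀ + (y w).2.1} ∩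
          {y | (y u).1 < (y w).1}) := by
      ext y
      simp [IsAncestor]
    rw [this]
    exact MeasurableSet.iUnion fun w => (ih w).inter
      ((measurableSet_range r₀ u w).inter (measurableSet_label_lt u w))

theorem measurableSet_clanEvent (r₀ r : ℕ) : MeasurableSet (clanEvent d r₀ r) := by
  have : clanEvent d r₀ r = ⋂ n, ⋂ u, ⋂ w, ({y | IsAncestor r₀ y n u}ᶜ ∪
      ({y | latticeDist w u ≤ r₀ + (y u).2.1}ᶜ ∪ {_y | latticeDist w 0 ≤ r})) := by
    ext y
    simp only [clanEvent, Set.mem_ofPred_eq, Set.mem_iInter, Set.mem_union, Set.mem_compl_iff]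
    refine forall₂_congr fun n u => ⟨fun h w => ?_, fun h hu w hw => ?_⟩
    · by_cases hu : IsAncestor r₀ y n u
      · by_cases hw : latticeDist w u ≤ r₀ + (y u).2.1
        · exact Or.inr (Or.inr (h hu w hw))
        · exact Or.inr (Or.inl hw)
      · exact Or.inl hu
    · rcases h w with h | h | h
      · exact (h hu).elim
      · exact (h hw).elim
      · exact h
  rw [this]
  exact MeasurableSet.iInter fun n => MeasurableSet.iInter fun u => MeasurableSet.iInter fun w =>
    (measurableSet_isAncestor r₀ n u).compl.union
      ((measurableSet_range r₀ w u).compl.union (MeasurableSet.const _))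

variable [MeasurableSpace S] [Fintype S] [Nonempty S]

/-- If the clan of the origin lies in a ball, then the outcome of sequential sampling at the origin
is determined by the randomness in this ball. -/
theorem iterate_seqStep_zero_eq (μ : Measure (Zd d → S)) [DiscreteMeasurableSpace S] (θ : ℝ)
    {r₀ r : ℕ} {y y' : Zd d → SeqSite} (hy : y ∈ clanEvent d r₀ r)
    (h : ∀ v, latticeDist v 0 ≤ r → y' v = y v) {Λ Λ' : Set (Zd d)}
    (hΛ : ∀ v, latticeDist v 0 ≤ r → v ∈ Λ) (hΛ' : ∀ v, latticeDist v 0 ≤ r → v ∈ Λ')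
    (x x' : Zd d → S) {k k' : ℕ} (hk : (latticeBall (0 : Zd d) r).card < k)
    (hk' : (latticeBall (0 : Zd d) r).card < k') :
    (seqStep μ θ r₀ Λ y')^[k] x 0 = (seqStep μ θ r₀ Λ' y)^[k'] x' 0 := by
  classical
  set A := (latticeBall (0 : Zd d) r).filter fun u => ∃ n, IsAncestor r₀ y n u with hA
  have hrank : (A.filter fun w => (y w).1 < (y 0).1).card ≤ (latticeBall (0 : Zd d) r).card :=
    (Finset.card_filter_le _ _).trans (Finset.card_filter_le _ _)
  refine iterate_eq_of_rank_lt (A := A) (t := fun u => (y u).1) (fun u hu x x' hx => ?_) x x'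
    (by simp only [hA, Finset.mem_filter, mem_latticeBall]; exact ⟨by simp, 0, rfl⟩)
    (hrank.trans_lt hk) (hrank.trans_lt hk')
  simp only [hA, Finset.mem_filter, mem_latticeBall] at hu
  obtain ⟨hur, n, hn⟩ := hu
  have hyu : y' u = y u := h u hur
  have hball : ∀ w, latticeDist w 0 ≤ r₀ + (y u).2.1 → latticeDist (w + u) 0 ≤ r := fun w hw =>
    hy n u hn (w + u) (by simpa using (latticeDist_add_right w 0 u).trans_le hw)
  unfold seqStep
  rw [hyu]
  refine congrFun (siteRule_congr μ θ r₀ _ (fun w hw => ?_) fun w hw _ => ?_) _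
  · rw [mem_latticeBall] at hw
    have hwr := hball w hw
    simp only [mem_knownSites, hyu, h _ hwr, hΛ _ hwr, hΛ' _ hwr]
  · rw [mem_knownSites, hyu] at hw
    have hwr := hball w hw.1
    rw [h _ hwr] at hw
    refine hx _ ?_ hw.2.2
    simp only [hA, Finset.mem_filter, mem_latticeBall]
    exact ⟨hwr, n + 1, u, hn, by simpa using (latticeDist_add_right w 0 u).trans_le hw.1, hw.2.2⟩

theorem measurable_iterate_seqStep [DiscreteMeasurableSpace S] (μ : Measure (Zd d → S)) (θ : ℝ)
    (r₀ : ℕ) (Λ : Set (Zd d)) (x : Zd d → S) (k : ℕ) :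
    Measurable fun y => (seqStep μ θ r₀ Λ y)^[k] x := by
  induction k with
  | zero => exact measurable_const
  | succ k ih =>
    simp_rw [Function.iterate_succ_apply']
    refine measurable_pi_lambda _ fun u => measurable_to_countable' fun s => ?_
    have : (fun y => seqStep μ θ r₀ Λ y ((seqStep μ θ r₀ Λ y)^[k] x) u) ⁻¹' {s} =
        ⋃ j : ℕ, ⋃ P : Finset (Zd d), {y | (y u).2.1 = j} ∩ ({y | knownSites r₀ Λ y u = P} ∩
          {y | siteRule μ θ r₀ j P (shiftConfig u ((seqStep μ θ r₀ Λ y)^[k] x)) (y u).2.2 = s}) := by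
      ext y
      simp only [seqStep, Set.mem_preimage, Set.mem_singleton_iff, Set.mem_iUnion, Set.mem_inter_iff,
        Set.mem_ofPred_eq]
      constructor
      · exact fun h => ⟨_, _, rfl, rfl, h⟩
      · rintro ⟨_, _, rfl, rfl, h⟩
        exact h
    rw [this]
    refine MeasurableSet.iUnion fun j => MeasurableSet.iUnion fun P => MeasurableSet.inter ?_
      (MeasurableSet.inter ?_ ?_)
    · exact measurable_level u (measurableSet_singleton j)
    · have : {y : Zd d → SeqSite | knownSites r₀ Λ y u = P} = ⋂ w : Zd d,
          {y | (latticeDist w 0 ≤ r₀ + (y u).2.1 ∧ w + u ∈ Λ ∧ (y (w + u)).1 < (y u).1) ↔ w ∈ P} := by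
        ext y
        simp [Finset.ext_iff, mem_knownSites]
      rw [this]
      refine MeasurableSet.iInter fun w => ?_
      have h3 : MeasurableSet {y : Zd d → SeqSite | latticeDist w 0 ≤ r₀ + (y u).2.1 ∧
          w + u ∈ Λ ∧ (y (w + u)).1 < (y u).1} :=
        (measurable_level u (MeasurableSet.of_discrete (s := {j | latticeDist w 0 ≤ r₀ + j}))).inter
          ((MeasurableSet.const _).inter (measurableSet_label_lt (w + u) u))
      by_cases hwP : w ∈ P
      · simpa [hwP] using h3
      · simp only [hwP, iff_false]
        exact h3.compl
    · have hm := measurable_uncurry_of_dependsOn_finset P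
        (fun x' => siteRule μ θ r₀ j P x') (fun x₁ x₂ h => siteRule_congr μ θ r₀ j
          (fun _ _ => Iff.rfl) fun v hv _ => h v hv) fun x' => measurable_siteRule μ θ r₀ j P x'
      exact (hm.comp (((measurable_shiftConfig u).comp ih).prodMk
        (measurable_snd.comp (measurable_snd.comp (measurable_pi_apply u)))))
        (measurableSet_singleton s)

end Clan

/-! ### Exponential tails of the clan of ancestors -/

section Tails

theorem ENNReal.tsum_prod_fin {β : Type*} (g : β → ℝ≥0∞) (n : ℕ) :
    ∑' e : Fin n → β, ∏ i, g (e i) = (∑' b, g b) ^ n := by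
  induction n with
  | zero => simp
  | succ n ih =>
    rw [← (Fin.consEquiv fun _ => β).tsum_eq, ENNReal.tsum_prod', pow_succ', ← ENNReal.tsum_mul_right]
    refine tsum_congr fun b => ?_
    rw [← ih, ← ENNReal.tsum_mul_left]
    refine tsum_congr fun e => ?_
    simp [Fin.prod_univ_succ, Fin.consEquiv]

/-- The labels of `n` given sites decrease along the given order with probability at most
`1 / n!`. -/
theorem measure_strictAnti_le (n : ℕ) :
    (Measure.pi fun _ : Fin n => (volume : Measure unitInterval)) {t | StrictAnti t} ≤
      (n.factorial : ℝ≥0∞)⁻¹ := by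
  set P := Measure.pi fun _ : Fin n => (volume : Measure unitInterval) with hP
  have hm : MeasurableSet {t : Fin n → unitInterval | StrictAnti t} := by
    have : {t : Fin n → unitInterval | StrictAnti t} =
        ⋂ i : Fin n, ⋂ j : Fin n, ⋂ _ : i < j, {t | t j < t i} := by
      ext t
      simp [StrictAnti]
    rw [this]
    exact MeasurableSet.iInter fun i => MeasurableSet.iInter fun j => MeasurableSet.iInter fun _ =>
      measurableSet_lt (f := fun t : Fin n → unitInterval => t j) (g := fun t => t i)
        (measurable_pi_apply j) (measurable_pi_apply i)
  -- The events that the labels decrease along a permuted order are disjoint and equiprobable.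
  let E : Equiv.Perm (Fin n) → Set (Fin n → unitInterval) := fun σ => {t | StrictAnti (t ∘ σ)}
  have hσ : ∀ σ : Equiv.Perm (Fin n), Measurable fun t : Fin n → unitInterval => t ∘ σ := fun σ =>
    measurable_pi_lambda _ fun i => measurable_pi_apply (σ i)
  have hmap : ∀ σ : Equiv.Perm (Fin n), P.map (fun t => t ∘ σ) = P := by
    intro σ
    have := Measure.map_infinitePi_infinitePi_of_inj
      (P := fun _ : Fin n => (volume : Measure unitInterval)) (f := σ) σ.injective
    simp only [Measure.infinitePi_eq_pi] at this
    exact this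
  have hE : ∀ σ, P (E σ) = P {t | StrictAnti t} := by
    intro σ
    conv_rhs => rw [← hmap σ]
    rw [Measure.map_apply (hσ σ) hm]
    rfl
  have hdisj : Set.PairwiseDisjoint (Finset.univ : Finset (Equiv.Perm (Fin n))) E := by
    intro σ _ τ _ hne
    refine Set.disjoint_left.2 fun t hσt hτt => hne ?_
    have hmono : StrictMono (τ.trans σ.symm) := by
      intro i j hij
      have h1 : t (τ j) < t (τ i) := hτt hij
      simp only [Equiv.trans_apply]
      by_contra hle
      have h2 : t (σ (σ.symm (τ i))) ≤ t (σ (σ.symm (τ j))) := hσt.antitone (not_lt.1 hle)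
      simp only [Equiv.apply_symm_apply] at h2
      exact absurd h1 h2.not_gt
    have hid : ⇑(τ.trans σ.symm) = id := (hmono.range_inj strictMono_id).1
      (by rw [Set.range_id, (τ.trans σ.symm).surjective.range_eq])
    ext i
    have := congrFun hid i
    simp only [Equiv.trans_apply, id_eq, Equiv.symm_apply_eq] at this
    rw [this]
  have hsum : ∑ σ : Equiv.Perm (Fin n), P (E σ) ≤ 1 := by
    rw [← measure_biUnion_finset hdisj fun σ _ => hσ σ hm]
    exact prob_le_one
  simp only [hE, Finset.sum_const, Finset.card_univ, Fintype.card_perm, Fintype.card_fin,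
    nsmul_eq_mul] at hsum
  rw [ENNReal.le_inv_iff_mul_le, mul_comm]
  exact hsum

/-- The position after `i` steps of a path from the origin with increments `e`. -/
def pathPos {d k : ℕ} (e : Fin k → Zd d) (i : ℕ) : Zd d :=
  ∑ j ∈ Finset.univ.filter (fun j : Fin k => (j : ℕ) < i), e j

theorem pathPos_zero {d k : ℕ} (e : Fin k → Zd d) : pathPos e 0 = 0 := by
  simp [pathPos]

theorem pathPos_succ {d k : ℕ} (e : Fin k → Zd d) (i : Fin k) :
    pathPos e (i + 1) = pathPos e i + e i := by
  have : Finset.univ.filter (fun j : Fin k => (j : ℕ) < i + 1) =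
      insert i (Finset.univ.filter (fun j : Fin k => (j : ℕ) < i)) := by
    ext j
    simp only [Finset.mem_filter, Finset.mem_univ, true_and, Finset.mem_insert, Fin.ext_iff]
    omega
  rw [pathPos, this, Finset.sum_insert (by simp), add_comm]
  rfl

theorem pathPos_sub {d k : ℕ} (f : ℕ → Zd d) (h0 : f 0 = 0) {i : ℕ} (hi : i ≤ k) :
    pathPos (fun j : Fin k => f (j + 1) - f j) i = f i := by
  induction i with
  | zero => rw [pathPos_zero, h0]
  | succ i ih =>
    have := pathPos_succ (fun j : Fin k => f (j + 1) - f j) ⟨i, hi⟩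
    simp only at this
    rw [this, ih (by omega)]
    simp

theorem latticeDist_add_le {d : ℕ} (u v : Zd d) :
    latticeDist (u + v) 0 ≤ latticeDist u 0 + latticeDist v 0 := by
  have := latticeDist_triangle (u + v) v 0
  have h := latticeDist_add_right u 0 v
  rw [zero_add] at h
  omega

theorem latticeDist_pathPos_le {d k : ℕ} (e : Fin k → Zd d) (i : ℕ) :
    latticeDist (pathPos e i) 0 ≤ ∑ j, latticeDist (e j) 0 := by
  have h : ∀ s : Finset (Fin k), latticeDist (∑ j ∈ s, e j) 0 ≤ ∑ j ∈ s, latticeDist (e j) 0 := by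
    intro s
    induction s using Finset.induction_on with
    | empty => simp
    | insert a s ha ih =>
      rw [Finset.sum_insert ha, Finset.sum_insert ha]
      exact (latticeDist_add_le _ _).trans (by omega)
  exact (h _).trans (Finset.sum_le_sum_of_subset (Finset.filter_subset _ _))

/-- The event that the path with increments `e` is a path of ancestors, the last increment being
only required to be in range. -/
def pathEvent {d k : ℕ} (r₀ : ℕ) (e : Fin k → Zd d) : Set (Zd d → SeqSite) :=
  {y | StrictAnti (fun i : Fin k => (y (pathPos e i)).1) ∧
    ∀ i : Fin k, latticeDist (e i) 0 ≤ r₀ + (y (pathPos e i)).2.1}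

theorem IsAncestor.exists_path {d r₀ : ℕ} {y : Zd d → SeqSite} {n : ℕ} {u : Zd d}
    (h : IsAncestor r₀ y n u) : ∃ f : ℕ → Zd d, f 0 = 0 ∧ f n = u ∧ ∀ i < n,
      latticeDist (f (i + 1)) (f i) ≤ r₀ + (y (f i)).2.1 ∧ (y (f (i + 1))).1 < (y (f i)).1 := by
  induction n generalizing u with
  | zero => exact ⟨fun _ => 0, rfl, h.symm, fun i hi => by omega⟩
  | succ n ih =>
    obtain ⟨w, hw, hdist, hlt⟩ := h
    obtain ⟨f, hf0, hfn, hf⟩ := ih hw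
    refine ⟨fun i => if i ≤ n then f i else u, by simp [hf0], by simp, fun i hi => ?_⟩
    obtain hin | rfl := Nat.lt_succ_iff_lt_or_eq.1 hi
    · simp only [hin.le, if_true, Nat.succ_le_of_lt hin]
      exact hf i hin
    · simpa [hfn] using ⟨hdist, hlt⟩

theorem compl_clanEvent_subset {d : ℕ} (r₀ r : ℕ) :
    (clanEvent d r₀ r)ᶜ ⊆ ⋃ n : ℕ, ⋃ e : Fin (n + 1) → Zd d,
      ⋃ _ : r < ∑ j, latticeDist (e j) 0, pathEvent r₀ e := by
  intro y hy
  simp only [clanEvent, Set.mem_compl_iff, Set.mem_ofPred_eq, not_forall, not_le] at hy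
  obtain ⟨n, u, hu, w, hw, hwr⟩ := hy
  obtain ⟨f, hf0, hfn, hf⟩ := hu.exists_path
  set f' : ℕ → Zd d := fun i => if i ≤ n then f i else w with hf'
  have hpos : ∀ i ≤ n + 1, pathPos (fun j : Fin (n + 1) => f' (j + 1) - f' j) i = f' i :=
    fun i hi => pathPos_sub f' (by simp [hf', hf0]) hi
  simp only [Set.mem_iUnion]
  refine ⟨n, fun j => f' (j + 1) - f' j, ?_, ?_, ?_⟩
  · refine hwr.trans_le ?_
    have := latticeDist_pathPos_le (fun j : Fin (n + 1) => f' (j + 1) - f' j) (n + 1)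
    rw [hpos _ le_rfl] at this
    simpa [hf'] using this
  · refine Fin.strictAnti_iff_succ_lt.2 fun i => ?_
    rw [hpos _ (by omega), hpos _ (by omega)]
    have hi := i.2
    simp only [Fin.val_succ, Fin.val_castSucc, hf', hi.le, Nat.succ_le_of_lt hi, if_true]
    exact (hf i hi).2
  · intro i
    rw [hpos _ (by omega), latticeDist_sub_left, zero_add]
    obtain hi | hi := Nat.lt_succ_iff_lt_or_eq.1 i.2
    · simp only [hf', hi.le, Nat.succ_le_of_lt hi, if_true]
      exact (hf i hi).1
    · simpa [hf', hi, hfn] using hw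

theorem measure_pathEvent_le {d k : ℕ} (p : unitInterval) (r₀ : ℕ) (e : Fin k → Zd d) :
    iidLaw d (seqLaw p) (pathEvent r₀ e) ≤
      (k.factorial : ℝ≥0∞)⁻¹ * ∏ i, geometricMeasure p {j | latticeDist (e i) 0 ≤ r₀ + j} := by
  by_cases hinj : Function.Injective fun i : Fin k => pathPos e i
  · let B : Set ((Fin k → unitInterval) × (Fin k → ℕ × unitInterval)) :=
      {t | StrictAnti t} ×ˢ Set.pi Set.univ fun i : Fin k =>
        {j | latticeDist (e i) 0 ≤ r₀ + j} ×ˢ Set.univ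
    have hBm : MeasurableSet B := by
      refine MeasurableSet.prod ?_ (MeasurableSet.univ_pi fun i =>
        (MeasurableSet.of_discrete).prod MeasurableSet.univ)
      have : {t : Fin k → unitInterval | StrictAnti t} =
          ⋂ i : Fin k, ⋂ j : Fin k, ⋂ _ : i < j, {t | t j < t i} := by
        ext t
        simp [StrictAnti]
      rw [this]
      exact MeasurableSet.iInter fun i => MeasurableSet.iInter fun j => MeasurableSet.iInter fun _ =>
        measurableSet_lt (f := fun t : Fin k → unitInterval => t j) (g := fun t => t i)
          (measurable_pi_apply j) (measurable_pi_apply i)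
    have hset : pathEvent r₀ e = (fun (y : Zd d → SeqSite) (i : Fin k) => y (pathPos e i)) ⁻¹'
        (MeasurableEquiv.arrowProdEquivProdArrow unitInterval (ℕ × unitInterval) (Fin k) ⁻¹' B) := by
      ext y
      simp only [B, Set.mem_preimage, Set.mem_prod, Set.mem_pi, Set.mem_univ, true_implies, and_true]
      exact Iff.rfl
    have hmap := (Measure.map_infinitePi_infinitePi_of_inj (P := fun _ : Zd d => seqLaw p)
      hinj).trans (Measure.infinitePi_eq_pi (μ := fun _ : Fin k => seqLaw p))
    have hmp := (measurePreserving_arrowProdEquivProdArrow unitInterval (ℕ × unitInterval) (Fin k)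
      (fun _ => volume) fun _ => (geometricMeasure p).prod volume).measure_preimage
      hBm.nullMeasurableSet
    rw [hset, ← Measure.map_apply (measurable_pi_lambda _ fun i => measurable_pi_apply _)
      ((MeasurableEquiv.measurable _) hBm), iidLaw, hmap]
    simp only [seqLaw]
    rw [hmp, Measure.prod_prod, Measure.pi_pi]
    refine mul_le_mul' (measure_strictAnti_le k) (le_of_eq ?_)
    refine Finset.prod_congr rfl fun i _ => ?_
    rw [Measure.prod_prod, measure_univ, mul_one]
  · have : pathEvent r₀ e = ∅ := by
      refine Set.eq_empty_of_forall_notMem fun y hy => hinj fun i j hij => ?_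
      exact hy.1.injective (congrArg (fun v => (y v).1) hij)
    rw [this, measure_empty]
    exact zero_le

theorem geometricMeasure_le {p : unitInterval} {θ : ℝ} (hp : (p : ℝ) = 1 - θ) (h0 : 0 < θ)
    (h1 : θ < 1) (r₀ a : ℕ) :
    geometricMeasure p {j | a ≤ r₀ + j} ≤ ENNReal.ofReal (θ⁻¹ ^ r₀ * θ ^ a) := by
  have hp0 : p ≠ 0 := by
    rintro rfl
    simp at hp
    linarith
  obtain ha | ha := le_total a r₀
  · refine prob_le_one.trans ?_
    rw [← ENNReal.ofReal_one]
    refine ENNReal.ofReal_le_ofReal ?_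
    obtain ⟨b, rfl⟩ := Nat.exists_eq_add_of_le ha
    rw [pow_add, mul_right_comm, ← mul_pow, inv_mul_cancel₀ h0.ne', one_pow, one_mul]
    exact one_le_pow₀ ((one_le_inv₀ h0).2 h1.le)
  · obtain ⟨b, rfl⟩ := Nat.exists_eq_add_of_le ha
    have hset : {j : ℕ | r₀ + b ≤ r₀ + j} = ⋃ i : ℕ, {b + i} := by
      ext j
      simp only [Set.mem_ofPred_eq, Set.mem_iUnion, Set.mem_singleton_iff]
      exact ⟨fun h => ⟨j - b, by omega⟩, fun ⟨i, hi⟩ => by omega⟩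
    rw [hset]
    refine (measure_iUnion_le _).trans (le_of_eq ?_)
    simp_rw [geometricMeasure_singleton hp0, hp, sub_sub_cancel]
    have hs : HasSum (fun i : ℕ => θ ^ (b + i) * (1 - θ)) (θ ^ b) := by
      have h := ((hasSum_geometric_of_lt_one h0.le h1).mul_left (θ ^ b)).mul_right (1 - θ)
      rw [mul_assoc, inv_mul_cancel₀ (by linarith), mul_one] at h
      simpa [pow_add] using h
    rw [← ENNReal.ofReal_tsum_of_nonneg (fun i => mul_nonneg (pow_nonneg h0.le _) (by linarith))
      hs.summable, hs.tsum_eq, pow_add, ← mul_assoc, ← mul_pow, inv_mul_cancel₀ h0.ne', one_pow,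
      one_mul]

theorem tsum_pow_latticeDist_ne_top {η : ℝ} (h0 : 0 < η) (h1 : η < 1) (d : ℕ) :
    ∑' v : Zd d, ENNReal.ofReal (η ^ latticeDist v 0) ≠ ⊤ := by
  have h : ∀ v : Zd d, ENNReal.ofReal (η ^ latticeDist v 0) =
      ∏ i, ENNReal.ofReal (η ^ (v i).natAbs) := by
    intro v
    rw [← ENNReal.ofReal_prod_of_nonneg fun i _ => pow_nonneg h0.le _, Finset.prod_pow_eq_pow_sum]
    simp [latticeDist]
  simp_rw [h]
  rw [ENNReal.tsum_prod_fin (fun z : ℤ => ENNReal.ofReal (η ^ z.natAbs)) d]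
  refine ENNReal.pow_ne_top ?_
  have hs : Summable fun z : ℤ => η ^ z.natAbs := by
    have hg := summable_geometric_of_lt_one h0.le h1
    exact Summable.of_nat_of_neg (by simpa using hg) (by simpa using hg)
  rw [← ENNReal.ofReal_tsum_of_nonneg (fun z => pow_nonneg h0.le _) hs]
  exact ENNReal.ofReal_ne_top

theorem tsum_pow_div_factorial_ne_top {M : ℝ≥0∞} (hM : M ≠ ⊤) :
    ∑' n : ℕ, ((n + 1).factorial : ℝ≥0∞)⁻¹ * M ^ (n + 1) ≠ ⊤ := by
  have hs : Summable fun n : ℕ => M.toReal ^ (n + 1) / (n + 1).factorial :=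
    (summable_nat_add_iff 1).2 (Real.summable_pow_div_factorial M.toReal)
  have h : ∀ n : ℕ, ((n + 1).factorial : ℝ≥0∞)⁻¹ * M ^ (n + 1) =
      ENNReal.ofReal (M.toReal ^ (n + 1) / (n + 1).factorial) := by
    intro n
    rw [ENNReal.ofReal_div_of_pos (by positivity), ENNReal.ofReal_pow ENNReal.toReal_nonneg,
      ENNReal.ofReal_toReal hM, ENNReal.ofReal_natCast, mul_comm, div_eq_mul_inv]
  simp_rw [h]
  rw [← ENNReal.ofReal_tsum_of_nonneg (fun n => by positivity) hs]
  exact ENNReal.ofReal_ne_top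

/-- The clan of ancestors of the origin has exponential tails. -/
theorem exists_measure_compl_clanEvent_le (d : ℕ) {p : unitInterval} {η : ℝ}
    (hp : (p : ℝ) = 1 - η ^ 2) (h0 : 0 < η) (h1 : η < 1) (r₀ : ℕ) :
    ∃ K : ℝ≥0∞, K ≠ ⊤ ∧ ∀ r, iidLaw d (seqLaw p) (clanEvent d r₀ r)ᶜ ≤ ENNReal.ofReal (η ^ r) * K := by
  set c : ℝ := (η ^ 2)⁻¹ ^ r₀ with hc
  have hc0 : 0 ≤ c := by positivity
  set M : ℝ≥0∞ := ∑' v : Zd d, ENNReal.ofReal (c * η ^ latticeDist v 0) with hM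
  have hMtop : M ≠ ⊤ := by
    simp_rw [hM, ENNReal.ofReal_mul hc0]
    rw [ENNReal.tsum_mul_left]
    exact ENNReal.mul_ne_top ENNReal.ofReal_ne_top (tsum_pow_latticeDist_ne_top h0 h1 d)
  refine ⟨_, tsum_pow_div_factorial_ne_top hMtop, fun r => ?_⟩
  have hη2 : η ^ 2 < 1 := pow_lt_one₀ h0.le h1 two_ne_zero
  have hpath : ∀ (n : ℕ) (e : Fin (n + 1) → Zd d),
      iidLaw d (seqLaw p) (⋃ _ : r < ∑ j, latticeDist (e j) 0, pathEvent r₀ e) ≤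
        ENNReal.ofReal (η ^ r) * (((n + 1).factorial : ℝ≥0∞)⁻¹ *
          ∏ i, ENNReal.ofReal (c * η ^ latticeDist (e i) 0)) := by
    intro n e
    by_cases hr : r < ∑ j, latticeDist (e j) 0
    · simp only [hr, Set.iUnion_true]
      refine (measure_pathEvent_le p r₀ e).trans ?_
      rw [mul_left_comm]
      refine mul_le_mul_right ?_ _
      calc ∏ i, geometricMeasure p {j | latticeDist (e i) 0 ≤ r₀ + j}
          ≤ ∏ i, ENNReal.ofReal (c * (η ^ 2) ^ latticeDist (e i) 0) :=
            Finset.prod_le_prod' fun i _ => geometricMeasure_le hp (by positivity) hη2 _ _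
        _ = ∏ i, (ENNReal.ofReal (η ^ latticeDist (e i) 0) *
              ENNReal.ofReal (c * η ^ latticeDist (e i) 0)) := by
            refine Finset.prod_congr rfl fun i _ => ?_
            rw [← ENNReal.ofReal_mul (by positivity)]
            congr 1
            ring
        _ = ENNReal.ofReal (η ^ ∑ i, latticeDist (e i) 0) *
              ∏ i, ENNReal.ofReal (c * η ^ latticeDist (e i) 0) := by
            rw [Finset.prod_mul_distrib, ← ENNReal.ofReal_prod_of_nonneg fun i _ => by positivity,
              Finset.prod_pow_eq_pow_sum]
        _ ≤ _ := mul_le_mul_left (ENNReal.ofReal_le_ofReal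
            (pow_le_pow_of_le_one h0.le h1.le hr.le)) _
    · simp [hr]
  calc iidLaw d (seqLaw p) (clanEvent d r₀ r)ᶜ
      ≤ ∑' n : ℕ, ∑' e : Fin (n + 1) → Zd d,
          iidLaw d (seqLaw p) (⋃ _ : r < ∑ j, latticeDist (e j) 0, pathEvent r₀ e) :=
        (measure_mono (compl_clanEvent_subset r₀ r)).trans ((measure_iUnion_le _).trans
          (ENNReal.tsum_le_tsum fun n => measure_iUnion_le _))
    _ ≤ ∑' n : ℕ, ∑' e : Fin (n + 1) → Zd d, ENNReal.ofReal (η ^ r) *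
          (((n + 1).factorial : ℝ≥0∞)⁻¹ * ∏ i, ENNReal.ofReal (c * η ^ latticeDist (e i) 0)) :=
        ENNReal.tsum_le_tsum fun n => ENNReal.tsum_le_tsum fun e => hpath n e
    _ = _ := by
        simp_rw [ENNReal.tsum_mul_left]
        congr 1
        refine tsum_congr fun n => ?_
        rw [ENNReal.tsum_prod_fin fun v : Zd d => ENNReal.ofReal (c * η ^ latticeDist v 0)]

end Tails

/-! ### Exponential tails under strong spatial mixing -/

section Strong

variable {d : ℕ} {S : Type*} [Fintype S] [MeasurableSpace S] [DiscreteMeasurableSpace S]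

theorem latticeBall_mono {c : Zd d} {r r' : ℕ} (h : r ≤ r') : latticeBall c r ⊆ latticeBall c r' :=
  fun v hv => by
    rw [mem_latticeBall] at hv ⊢
    omega

/-- The sampling rule of range `r₀ + j` has enough certain mass if `r₀` is large. -/
theorem StrongSpatialMixing.exists_range {μ : Measure (Zd d → S)} [IsProbabilityMeasure μ]
    (hmrf : IsMarkovRandomField μ) {ρ : ℕ → ℝ≥0} (hs : StrongSpatialMixing μ ρ)
    (hρ : AntitoneOn ρ (Set.Ici 1)) {C c : ℝ} (hC : 0 < C) (hc : 0 < c)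
    (hdecay : ∀ n : ℕ, 1 ≤ n → (ρ n : ℝ) ≤ C * Real.exp (-c * n)) :
    ∃ r₀ : ℕ, ∀ (W : Finset (Zd d)) (x : Zd d → S), (0 : Zd d) ∉ W → μ (cyl W x) ≠ 0 →
      ∀ j, 1 - Real.exp (-c) ^ (j + 1) ≤ ∑ s, lowerProb μ (r₀ + j) W x s := by
  set θ := Real.exp (-c) with hθ
  have h0 : 0 < θ := Real.exp_pos _
  have h1 : θ < 1 := (Real.exp_lt_exp.2 (by linarith)).trans_eq Real.exp_zero
  have hexp : ∀ n : ℕ, Real.exp (-c * n) = θ ^ n := fun n => by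
    rw [hθ, ← Real.exp_nat_mul, mul_comm]
  obtain ⟨r₀, hr₀⟩ := exists_pow_lt_of_lt_one (y := θ) (x := 1 / (2 * Fintype.card S * C + 1))
    (by positivity) h1
  refine ⟨r₀, fun W x hW hx j => ?_⟩
  refine le_trans ?_ (hs.one_sub_le_sum_lowerProb hmrf hρ hW hx (r₀ + j))
  have h2 := hdecay (r₀ + j + 1) (by omega)
  rw [hexp, add_assoc, pow_add] at h2
  rw [lt_div_iff₀ (by positivity)] at hr₀
  have h3 : θ ^ r₀ * (2 * Fintype.card S * C) ≤ 1 := by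
    have : 0 < θ ^ r₀ := pow_pos h0 _
    linarith
  have h4 : 0 ≤ θ ^ (j + 1) := pow_nonneg h0.le _
  have h5 : (Fintype.card S : ℝ) * (2 * ρ (r₀ + j + 1)) ≤
      Fintype.card S * (2 * (C * (θ ^ r₀ * θ ^ (j + 1)))) := by
    rw [add_assoc]
    gcongr
  have h6 : (Fintype.card S : ℝ) * (2 * (C * (θ ^ r₀ * θ ^ (j + 1)))) =
      θ ^ r₀ * (2 * Fintype.card S * C) * θ ^ (j + 1) := by ring
  have h7 := mul_le_mul_of_nonneg_right h3 h4
  linarith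

theorem ExponentialStrongSpatialMixing.isFfiidWithExponentialTails
    {μ : Measure (Zd d → S)} [IsProbabilityMeasure μ] (hinv : TranslationInvariant μ)
    (hmrf : IsMarkovRandomField μ) (h : ExponentialStrongSpatialMixing μ) :
    IsFfiidWithExponentialTails μ := by
  obtain ⟨ρ, ⟨hρ, _⟩, ⟨C, c, hC, hc, hdecay⟩, hs⟩ := h
  obtain ⟨r₀, hsum⟩ := hs.exists_range hmrf hρ hC hc hdecay
  set θ := Real.exp (-c) with hθ
  set η := Real.exp (-(c / 2)) with hη
  have h0 : 0 < η := Real.exp_pos _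
  have h1 : η < 1 := (Real.exp_lt_exp.2 (by linarith)).trans_eq Real.exp_zero
  have hθη : θ = η ^ 2 := by
    rw [hη, ← Real.exp_nat_mul, hθ]
    congr 1
    push_cast
    ring
  have hθ0 : 0 < θ := Real.exp_pos _
  have hθ1 : θ < 1 := (Real.exp_lt_exp.2 (by linarith)).trans_eq Real.exp_zero
  have hne : Nonempty (Zd d → S) := by
    by_contra hempty
    rw [not_nonempty_iff] at hempty
    exact IsProbabilityMeasure.ne_zero μ (Measure.eq_zero_of_isEmpty μ)
  have hS : Nonempty S := ⟨hne.some 0⟩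
  let p : unitInterval := ⟨1 - θ, by linarith, by linarith⟩
  have hp : (p : ℝ) = 1 - θ := rfl
  let s₀ : S := Classical.arbitrary S
  let x₀ : Zd d → S := fun _ => s₀
  let D : ℕ → Set (Zd d → SeqSite) := clanEvent d r₀
  let N : ℕ → ℕ := fun r => (latticeBall (0 : Zd d) r).card + 1
  let H : ℕ → (Zd d → SeqSite) → S := fun r y => (seqStep μ θ r₀ Set.univ y)^[N r] x₀ 0
  let F : ℕ → (Zd d → SeqSite) × Unit → Zd d → S := fun n q =>
    (seqStep μ θ r₀ (latticeBall (0 : Zd d) n) q.1)^[N n] x₀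
  have hNmono : ∀ {i j : ℕ}, i ≤ j → (latticeBall (0 : Zd d) i).card < N j := fun hij =>
    Nat.lt_succ_of_le (Finset.card_le_card (latticeBall_mono hij))
  have hHle : ∀ i j y, i ≤ j → y ∈ D i → H i y = H j y := fun i j y hij hy =>
    iterate_seqStep_zero_eq μ θ hy (fun _ _ => rfl) (fun _ _ => trivial) (fun _ _ => trivial) _ _
      (hNmono le_rfl) (hNmono hij)
  have hH : ∀ i j y, y ∈ D i → y ∈ D j → H i y = H j y := fun i j y hi hj =>
    (le_total i j).elim (fun hij => hHle i j y hij hi) fun hij => (hHle j i y hij hj).symm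
  have hloc : ∀ i y y', y ∈ D i → (∀ v, latticeDist v 0 ≤ i → y' v = y v) →
      y' ∈ D i ∧ H i y' = H i y := fun i y y' hy hyy' =>
    ⟨clanEvent_congr hy hyy', iterate_seqStep_zero_eq μ θ hy hyy' (fun _ _ => trivial)
      (fun _ _ => trivial) _ _ (hNmono le_rfl) (hNmono le_rfl)⟩
  obtain ⟨K, hK, hKtail⟩ := exists_measure_compl_clanEvent_le d (p := p) (hp.trans (by rw [hθη]))
    h0 h1 r₀
  have hDnull : iidLaw d (seqLaw p) (⋂ i, (D i)ᶜ) = 0 := by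
    have hlim : Tendsto (fun r : ℕ => ENNReal.ofReal (η ^ r) * K) atTop (𝓝 0) := by
      have h2 : Tendsto (fun r : ℕ => ENNReal.ofReal (η ^ r)) atTop (𝓝 0) := by
        have := ENNReal.tendsto_ofReal (tendsto_pow_atTop_nhds_zero_of_lt_one h0.le h1)
        rwa [ENNReal.ofReal_zero] at this
      have := ENNReal.Tendsto.mul_const (b := K) h2 (Or.inr hK)
      rwa [zero_mul] at this
    refine le_antisymm (ge_of_tendsto' hlim fun r => ?_) zero_le
    exact (measure_mono (Set.iInter_subset _ r)).trans (hKtail r)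
  have hF : ∀ i v, ∀ᶠ n in atTop, ∀ (y : Zd d → SeqSite) (z : Unit), shiftConfig v y ∈ D i →
      F n (y, z) v = H i (shiftConfig v y) := by
    intro i v
    filter_upwards [eventually_ge_atTop (i + latticeDist v 0)] with n hn y z hy
    have hshift := iterate_seqStep_shiftConfig μ θ r₀ (latticeBall (0 : Zd d) n : Set (Zd d)) y x₀ v
      (N n)
    have hv : F n (y, z) v = shiftConfig v (F n (y, z)) 0 := by simp [shiftConfig]
    rw [hv]
    change shiftConfig v ((seqStep μ θ r₀ (latticeBall (0 : Zd d) n) y)^[N n] x₀) 0 = _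
    rw [← hshift]
    refine iterate_seqStep_zero_eq μ θ hy (fun _ _ => rfl) (fun w hw => ?_) (fun _ _ => trivial) _ _
      (hNmono (by omega)) (hNmono le_rfl)
    simp only [Set.mem_ofPred_eq, Finset.mem_coe, mem_latticeBall]
    exact (latticeDist_add_le w v).trans (by omega)
  have hlaw : ∀ (W : Finset (Zd d)) (ζ : Zd d → S), ∀ᶠ n in atTop,
      ((iidLaw d (seqLaw p)).prod (Measure.dirac ())) {q | F n q ∈ cyl W ζ} = μ (cyl W ζ) := by
    intro W ζ
    obtain ⟨n₀, hn₀⟩ : ∃ n₀, ∀ v ∈ W, latticeDist v 0 ≤ n₀ :=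
      ⟨W.sup fun v => latticeDist v 0, fun v hv => Finset.le_sup (f := fun v => latticeDist v 0) hv⟩
    filter_upwards [eventually_ge_atTop n₀] with n hn
    have hWn : W ⊆ latticeBall (0 : Zd d) n := fun v hv => mem_latticeBall.2 ((hn₀ v hv).trans hn)
    have hm := measurable_iterate_seqStep μ θ r₀ (latticeBall (0 : Zd d) n : Set (Zd d)) x₀ (N n)
    have hset : {q : (Zd d → SeqSite) × Unit | F n q ∈ cyl W ζ} =
        ((fun y => (seqStep μ θ r₀ (latticeBall (0 : Zd d) n) y)^[N n] x₀) ⁻¹' cyl W ζ) ×ˢ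
          Set.univ := by
      ext q
      simp [F]
    rw [hset, Measure.prod_prod, measure_univ, mul_one, ← Measure.map_apply hm (measurableSet_cyl _ _)]
    refine cyl_eq_of_subset hWn (fun ζ' => ?_) ζ
    rw [Measure.map_apply hm (measurableSet_cyl _ _)]
    exact iidLaw_iterate_seqStep hinv hp hθ0 hθ1 hsum _ x₀ ζ' (hNmono le_rfl)
  refine ⟨SeqSite, inferInstance, seqLaw p, inferInstance, _,
    isCoding_of_determined hH (measurableSet_clanEvent r₀) (fun r =>
      (measurable_pi_apply 0).comp (measurable_iterate_seqStep μ θ r₀ Set.univ x₀ (N r)))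
      hDnull hF hlaw s₀,
    isFinitary_of_determined (rad := fun i => i) hH hloc hDnull s₀,
    η⁻¹ * (K.toReal + 1), c / 2, by positivity, by linarith, fun r hr => ?_⟩
  have hsub : {y | (r : ℕ∞) ≤ codingRadius (fun y v => determinedValue D H s₀ (shiftConfig v y)) y} ⊆
      (D (r - 1))ᶜ := by
    intro y hy hyD
    have h2 := (hy : (r : ℕ∞) ≤ _).trans
      (codingRadius_le_of_determined (rad := fun i => i) hH hloc s₀ hyD)
    have : r ≤ r - 1 := by exact_mod_cast h2
    omega
  refine (measure_mono hsub).trans ((hKtail (r - 1)).trans ?_)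
  conv_lhs => rw [← ENNReal.ofReal_toReal hK, ← ENNReal.ofReal_mul (by positivity)]
  refine ENNReal.ofReal_le_ofReal ?_
  have hexp : Real.exp (-(c / 2) * r) = η ^ (r - 1) * η := by
    rw [← pow_succ, Nat.sub_add_cancel hr, hη, ← Real.exp_nat_mul, mul_comm]
  rw [hexp]
  have : η⁻¹ * (K.toReal + 1) * (η ^ (r - 1) * η) = η ^ (r - 1) * (K.toReal + 1) := by
    field_simp
  rw [this]
  have : 0 < η ^ (r - 1) := pow_pos h0 _
  nlinarith

end Strong

/-! ### Ratio mixing -/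

section Ratio

theorem sum_mul_div_ge {ι : Type*} [Fintype ι] {a b p : ι → ℝ} (ha : ∀ i, 0 ≤ a i)
    (hb : ∀ i, 0 ≤ b i) (hp : ∀ i, 0 ≤ p i) (hp1 : ∑ i, p i = 1) {ε : ℝ}
    (hae : ∑ i, |a i - p i| ≤ ε) (hbe : ∑ i, |b i - p i| ≤ ε) :
    1 - 2 * ε ≤ ∑ i, a i * b i / p i := by
  have key : ∀ i, p i - |a i - p i| - |b i - p i| ≤ a i * b i / p i := by
    intro i
    obtain h0 | hpos := (hp i).eq_or_lt
    · rw [← h0]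
      simp only [sub_zero, div_zero, zero_sub]
      linarith [abs_nonneg (a i), abs_nonneg (b i)]
    · rw [le_div_iff₀ hpos]
      have h1 := neg_abs_le (a i - p i)
      have h2 := neg_abs_le (b i - p i)
      set s := |a i - p i| with hs
      set t := |b i - p i| with ht
      have hs0 : 0 ≤ s := abs_nonneg _
      have ht0 : 0 ≤ t := abs_nonneg _
      -- `(p - s) (p - t) ≤ a b`, if the left-hand factors are nonnegative.
      by_cases hsp : p i - s - t ≤ 0
      · have := mul_nonneg (ha i) (hb i)
        nlinarith
      · push Not at hsp
        have h3 : (p i - s) * (p i - t) ≤ a i * b i :=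
          mul_le_mul (by linarith) (by linarith) (by linarith) (ha i)
        nlinarith [mul_nonneg hs0 ht0]
  calc 1 - 2 * ε ≤ ∑ i, p i - ∑ i, |a i - p i| - ∑ i, |b i - p i| := by linarith
    _ = ∑ i, (p i - |a i - p i| - |b i - p i|) := by
        rw [Finset.sum_sub_distrib, Finset.sum_sub_distrib]
    _ ≤ _ := Finset.sum_le_sum fun i _ => key i

theorem condProb_empty {d : ℕ} {S : Type*} [MeasurableSpace S] [DiscreteMeasurableSpace S]
    {μ : Measure (Zd d → S)} [IsProbabilityMeasure μ] (ζ : Zd d → S) (E : Set (Zd d → S)) :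
    condProb μ ∅ ζ E = μ.real E := by
  rw [condProb_eq_div]
  simp

variable {d : ℕ} {S : Type*} [Fintype S] [MeasurableSpace S] [DiscreteMeasurableSpace S]
  {μ : Measure (Zd d → S)} [IsProbabilityMeasure μ]

/-- Weak spatial mixing implies ratio mixing: the patterns in a ball and on the boundary of a
concentric ball of twice the radius are asymptotically independent, uniformly and in the sense of
ratios. The reason is that both patterns barely influence the law on an intermediate sphere, which
separates them. -/
theorem WeakSpatialMixing.ratio_mixing (hμ : IsMarkovRandomField μ) {ρ : ℕ → ℝ≥0}
    (hw : WeakSpatialMixing μ ρ) (hρ : AntitoneOn ρ (Set.Ici 1)) {q : ℕ} (hq : 1 ≤ q)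
    (ξ τ : Zd d → S) :
    (1 - 4 * ((2 * (3 * q + 1) + 1 : ℕ) ^ d * ρ q)) * μ.real (cyl (latticeBall 0 (2 * q)) ξ) *
      μ.real (cyl (bdry (latticeBall 0 (4 * q))) τ) ≤
    μ.real (cyl (latticeBall 0 (2 * q)) ξ ∩ cyl (bdry (latticeBall 0 (4 * q))) τ) := by
  classical
  set U := latticeBall (0 : Zd d) (2 * q) with hU
  set B := bdry (latticeBall (0 : Zd d) (4 * q)) with hB
  set M := bdry (latticeBall (0 : Zd d) (3 * q)) with hM
  set V := latticeBall (0 : Zd d) (4 * q) \ U with hV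
  by_cases hξ : μ (cyl U ξ) = 0
  · have : μ.real (cyl U ξ) = 0 := by simp [measureReal_def, hξ]
    rw [this, mul_zero, zero_mul]
    exact measureReal_nonneg
  by_cases hτ : μ (cyl B τ) = 0
  · have : μ.real (cyl B τ) = 0 := by simp [measureReal_def, hτ]
    rw [this, mul_zero]
    exact measureReal_nonneg
  have hne : Nonempty S := ⟨ξ 0⟩
  have hMdist : ∀ v ∈ M, latticeDist v 0 = 3 * q + 1 := fun v hv =>
    latticeDist_of_mem_bdry_latticeBall hv
  have hBdist : ∀ v ∈ B, latticeDist v 0 = 4 * q + 1 := fun v hv =>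
    latticeDist_of_mem_bdry_latticeBall hv
  have hMV : M ⊆ V := fun v hv => by
    have := hMdist v hv
    simp only [hV, hU, Finset.mem_sdiff, mem_latticeBall]
    omega
  have hVU : Disjoint V U := Finset.sdiff_disjoint
  have hVB : Disjoint V B := Finset.disjoint_left.2 fun v hv hvB => by
    have := hBdist v hvB
    simp only [hV, hU, Finset.mem_sdiff, mem_latticeBall] at hv
    omega
  have hdist : ∀ u ∈ M, ∀ v ∈ bdry V, q ≤ latticeDist u v := by
    intro u hu v hv
    have h1 := hMdist u hu
    have h2 := (mem_bdry.1 hv).1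
    simp only [hV, hU, Finset.mem_sdiff, mem_latticeBall, not_and_or, not_not] at h2
    have h3 := latticeDist_triangle u v 0
    have h4 := latticeDist_triangle v u 0
    have h5 := latticeDist_comm u v
    omega
  set ε : ℝ := 2 * (((2 * (3 * q + 1) + 1 : ℕ) : ℝ) ^ d * ρ q) with hε
  have hcard : (M.card : ℝ) ≤ ((2 * (3 * q + 1) + 1 : ℕ) : ℝ) ^ d := by
    have h1 : M ⊆ latticeBall (0 : Zd d) (3 * q + 1) := fun v hv => by
      rw [mem_latticeBall, hMdist v hv]
    exact_mod_cast (Finset.card_le_card h1).trans (card_latticeBall_le 0 (3 * q + 1))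
  -- The law on the intermediate sphere barely depends on a pattern outside of the annulus `V`.
  have hclose : ∀ (A : Finset (Zd d)) (ζ : Zd d → S), Disjoint V A → μ (cyl A ζ) ≠ 0 →
      ∑ m : M → S, |condProb μ A ζ (patternEvent M m) - μ.real (patternEvent M m)| ≤ ε := by
    intro A ζ hA hζ
    have h1 := hw.sum_abs_condProb_sub_le hμ hρ V hMV hA (Finset.disjoint_empty_right V) hζ
      (ζ' := ζ) (by simp) hq hdist
    simp_rw [condProb_empty] at h1
    refine h1.trans ?_
    rw [hε]
    gcongr
  have hmain := sum_mul_div_ge (fun m => condProb_nonneg μ U ξ (patternEvent M m))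
    (fun m => condProb_nonneg μ B τ (patternEvent M m)) (fun m => measureReal_nonneg)
    (p := fun m : M → S => μ.real (patternEvent M m))
    (by
      have := sum_real_inter_restrict μ M MeasurableSet.univ
      simpa using this)
    (hclose U ξ hVU hξ) (hclose B τ hVB hτ)
  have hterm : ∀ m : M → S, μ.real (cyl U ξ ∩ cyl B τ ∩ patternEvent M m) =
      condProb μ U ξ (patternEvent M m) * condProb μ B τ (patternEvent M m) /
        μ.real (patternEvent M m) * (μ.real (cyl U ξ) * μ.real (cyl B τ)) := by
    intro m
    obtain ⟨m', hm'⟩ := exists_restrict_eq M m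
    have hMB : ∀ v ∈ B, v ∉ M := fun v hv hvM => by
      have h1 := hMdist v hvM
      have h2 := hBdist v hv
      omega
    let ζ : Zd d → S := fun v => if v ∈ M then m' v else τ v
    have hζM : cyl M ζ = patternEvent M m := by
      rw [patternEvent, ← hm', restrict_preimage_singleton]
      exact cyl_congr fun v hv => by simp [ζ, hv]
    have hζB : cyl B ζ = cyl B τ := cyl_congr fun v hv => by simp [ζ, hMB v hv]
    have hMarkov := hμ.condProb_mul_of_bdry_subset (latticeBall (0 : Zd d) (3 * q)) (U := U)
      (A := M ∪ B) (fun v hv => by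
        simp only [hU, mem_latticeBall] at hv ⊢
        omega)
      (Finset.disjoint_left.2 fun v hv hvA => by
        rw [mem_latticeBall] at hv
        rcases Finset.mem_union.1 hvA with h | h
        · have := hMdist v h
          omega
        · have := hBdist v h
          omega)
      Finset.subset_union_left {U.restrict ξ} ζ
    rw [restrict_preimage_singleton, cyl_union, hζM, hζB, condProb_eq_div, ← hM, hζM] at hMarkov
    have h1 := condProb_mul μ U ξ (patternEvent M m)
    have h2 := condProb_mul μ B τ (patternEvent M m)
    have h3 : cyl U ξ ∩ cyl B τ ∩ patternEvent M m = cyl U ξ ∩ (patternEvent M m ∩ cyl B τ) := by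
      rw [Set.inter_assoc, Set.inter_comm (cyl B τ)]
    rw [h3, ← hMarkov, Set.inter_comm (patternEvent M m) (cyl U ξ),
      Set.inter_comm (patternEvent M m) (cyl B τ), ← h1, ← h2]
    ring
  have hsum := sum_real_inter_restrict μ M
    ((measurableSet_cyl U ξ).inter (measurableSet_cyl B τ))
  rw [← hsum]
  simp only [patternEvent] at hterm hmain
  simp_rw [hterm]
  rw [← Finset.sum_mul]
  have hnn : 0 ≤ μ.real (cyl U ξ) * μ.real (cyl B τ) :=
    mul_nonneg measureReal_nonneg measureReal_nonneg
  calc _ = (1 - 2 * ε) * (μ.real (cyl U ξ) * μ.real (cyl B τ)) := by rw [hε]; ring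
    _ ≤ _ := mul_le_mul_of_nonneg_right hmain hnn

end Ratio

/-! ### Coupling a family of laws with a common part -/

section Coupling

/-- Three independent uniform variables. -/
abbrev UnifTriple : Type := unitInterval × unitInterval × unitInterval

/-- The event that a coin with success probability `p`, which is tossed with the first uniform
variable, shows heads. -/
noncomputable def coin (p : ℝ) : Set UnifTriple :=
  {u | sampler (fun b : Bool => if b then p else 1 - p) u.1 = true}

theorem measurableSet_coin (p : ℝ) : MeasurableSet (coin p) :=
  ((measurable_sampler _).comp measurable_fst) (measurableSet_singleton true)

theorem volume_coin {p : ℝ} (h0 : 0 ≤ p) (h1 : p ≤ 1) :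
    (volume : Measure UnifTriple) (coin p) = ENNReal.ofReal p := by
  have hset : coin p = (sampler (fun b : Bool => if b then p else 1 - p) ⁻¹' {true}) ×ˢ Set.univ := by
    ext u
    simp [coin]
  rw [hset, Measure.volume_eq_prod, Measure.prod_prod, measure_univ, mul_one,
    volume_sampler_preimage (by intro b; cases b <;> simp [h0, h1]) (by simp)]
  simp

variable {A B : Type*} [Fintype A] [MeasurableSpace A] [DiscreteMeasurableSpace A]

/-- The mass of the fibre of `π` over `b`. -/
noncomputable def fibreMass (π : A → B) (p : A → ℝ) (b : B) : ℝ :=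
  open Classical in ∑ a with π a = b, p a

theorem exists_fibreSampler {π : A → B} (hπ : Function.Surjective π) (p : A → ℝ) (b : B) :
    ∃ f : unitInterval → A, Measurable f ∧ (∀ t, π (f t) = b) ∧
      ((∀ a, 0 ≤ p a) → fibreMass π p b ≠ 0 → ∀ a, π a = b →
        volume (f ⁻¹' {a}) = ENNReal.ofReal (p a / fibreMass π p b)) := by
  classical
  have : Nonempty {a // π a = b} := (hπ b).elim fun a ha => ⟨⟨a, ha⟩⟩
  refine ⟨fun t => (sampler (fun a : {a // π a = b} => p a / fibreMass π p b) t : {a // π a = b}),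
    measurable_subtype_coe.comp (measurable_sampler _), fun t =>
      (sampler (fun a : {a // π a = b} => p a / fibreMass π p b) t : {a // π a = b}).2,
    fun hp hb a ha => ?_⟩
  have hset : (fun t => ((sampler (fun a : {a // π a = b} => p a / fibreMass π p b) t :
      {a // π a = b}) : A)) ⁻¹' {a} =
      sampler (fun a : {a // π a = b} => p a / fibreMass π p b) ⁻¹' {⟨a, ha⟩} := by
    ext t
    simp [Subtype.ext_iff]
  have hb0 : 0 ≤ fibreMass π p b := Finset.sum_nonneg fun a _ => hp a
  rw [hset, volume_sampler_preimage (w := fun a : {a // π a = b} => p a / fibreMass π p b)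
    (fun a => div_nonneg (hp a) hb0)]
  rw [← Finset.sum_div, div_eq_one_iff_eq hb, fibreMass]
  exact (Finset.sum_subtype (Finset.univ.filter fun a => π a = b) (by simp) p).symm

variable [Fintype B] [MeasurableSpace B] [DiscreteMeasurableSpace B] [Nonempty B]

theorem exists_coupledSample {π : A → B} (hπ : Function.Surjective π) (κ : B → ℝ) (p : A → ℝ) :
    ∃ g : UnifTriple → A, Measurable g ∧
      (∀ u ∈ coin (1 / 2), π (g u) = sampler κ u.2.1) ∧
      ((∀ b, 0 ≤ κ b) → ∑ b, κ b = 1 → (∀ a, 0 ≤ p a) → ∑ a, p a = 1 →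
        (∀ b, κ b ≤ 2 * fibreMass π p b) → ∀ a, volume (g ⁻¹' {a}) = ENNReal.ofReal (p a)) := by
  classical
  have : Nonempty A := (hπ (Classical.arbitrary B)).elim fun a _ => ⟨a⟩
  choose f hfm hfπ hf using exists_fibreSampler hπ p
  -- The residual law `w` is what has to be added to the fibrewise samples to obtain `p`.
  set w : A → ℝ := fun a => p a * (2 - κ (π a) / fibreMass π p (π a)) with hw
  have hcoin : Measurable fun u : UnifTriple => f (sampler κ u.2.1) u.2.2 :=
    (measurable_from_prod_countable_right (f := fun q : B × unitInterval => f q.1 q.2) hfm).comp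
      (((measurable_sampler κ).comp (measurable_fst.comp measurable_snd)).prodMk
        (measurable_snd.comp measurable_snd))
  refine ⟨fun u => if u ∈ coin (1 / 2) then f (sampler κ u.2.1) u.2.2 else sampler w u.2.2,
    Measurable.ite (measurableSet_coin _) hcoin
      ((measurable_sampler w).comp (measurable_snd.comp measurable_snd)),
    fun u hu => by simp only [if_pos hu, hfπ], fun hκ hκ1 hp hp1 hle a => ?_⟩
  set m := fibreMass π p with hm
  have hm0 : ∀ b, 0 ≤ m b := fun b => Finset.sum_nonneg fun a _ => hp a
  have hκm : ∀ b, κ b / m b ≤ 2 := fun b => div_le_of_le_mul₀ (hm0 b) zero_le_two (hle b)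
  have hw0 : ∀ a, 0 ≤ w a := fun a => mul_nonneg (hp a) (by linarith [hκm (π a)])
  have hκmul : ∀ b, m b * (κ b / m b) = κ b := by
    intro b
    by_cases hb : m b = 0
    · have h1 := hle b
      rw [hb, mul_zero] at h1
      rw [hb, zero_mul]
      linarith [hκ b]
    · exact mul_div_cancel₀ _ hb
  have hw1 : ∑ a, w a = 1 := by
    have h1 : ∑ a, p a * (κ (π a) / m (π a)) = 1 := by
      rw [← Finset.sum_fiberwise Finset.univ π, ← hκ1]
      refine Finset.sum_congr rfl fun b _ => ?_
      rw [← hκmul b, hm, fibreMass, Finset.sum_mul]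
      refine Finset.sum_congr rfl fun a ha => ?_
      rw [(Finset.mem_filter.1 ha).2]
      rfl
    simp only [hw, mul_sub, Finset.sum_sub_distrib]
    rw [h1, ← Finset.sum_mul, hp1]
    norm_num
  let J : Set unitInterval := sampler (fun b : Bool => if b then (1 / 2 : ℝ) else 1 - 1 / 2) ⁻¹' {true}
  have hJm : MeasurableSet J := measurable_sampler _ (measurableSet_singleton true)
  have hJ : volume J = ENNReal.ofReal (1 / 2) :=
    volume_sampler_preimage (by intro b; cases b <;> norm_num) (by norm_num) true
  have hJc : volume Jᶜ = ENNReal.ofReal (1 / 2) := by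
    rw [prob_compl_eq_one_sub hJm, hJ, ← ENNReal.ofReal_one, ← ENNReal.ofReal_sub _ (by norm_num)]
    norm_num
  have hset : (fun u : UnifTriple =>
        if u ∈ coin (1 / 2) then f (sampler κ u.2.1) u.2.2 else sampler w u.2.2) ⁻¹' {a} =
      J ×ˢ ((sampler κ ⁻¹' {π a}) ×ˢ (f (π a) ⁻¹' {a})) ∪
        Jᶜ ×ˢ (Set.univ ×ˢ (sampler w ⁻¹' {a})) := by
    ext u
    have hu : u ∈ coin (1 / 2) ↔ u.1 ∈ J := Iff.rfl
    simp only [Set.mem_preimage, Set.mem_singleton_iff, Set.mem_union, Set.mem_prod,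
      Set.mem_compl_iff, Set.mem_univ, true_and]
    by_cases h : u.1 ∈ J
    · simp only [hu, h, if_true, true_and, not_true_eq_false, false_and, or_false]
      constructor
      · intro ha
        have h2 : sampler κ u.2.1 = π a := by rw [← ha, hfπ]
        exact ⟨h2, h2 ▸ ha⟩
      · rintro ⟨h1, h2⟩
        rw [h1, h2]
    · simp only [hu, h, if_false, false_and, not_false_eq_true, true_and, false_or]
  rw [hset, measure_union (Set.disjoint_left.2 fun u h1 h2 => h2.1 h1.1)
    (hJm.compl.prod (MeasurableSet.univ.prod (measurable_sampler w (measurableSet_singleton a))))]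
  simp only [Measure.volume_eq_prod, Measure.prod_prod, hJ, hJc, measure_univ, one_mul,
    volume_sampler_preimage hκ hκ1, volume_sampler_preimage hw0 hw1]
  have hfib : ENNReal.ofReal (κ (π a)) * volume (f (π a) ⁻¹' {a}) =
      ENNReal.ofReal (p a * (κ (π a) / m (π a))) := by
    by_cases hb : m (π a) = 0
    · have h1 := hle (π a)
      rw [hb, mul_zero] at h1
      have h2 : κ (π a) = 0 := le_antisymm h1 (hκ _)
      simp [h2]
    · rw [hf (π a) hp hb a rfl, ← ENNReal.ofReal_mul (hκ _)]
      congr 1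
      ring
  rw [hfib, ← mul_add, ← ENNReal.ofReal_add (mul_nonneg (hp a) (div_nonneg (hκ _) (hm0 _))) (hw0 a),
    ← ENNReal.ofReal_mul (by norm_num)]
  congr 1
  simp only [hw]
  ring

/-- A sample from the law `p` whose image under `π` is, with probability `1 / 2`, a sample from `κ`
which does not depend on `p`. This requires that `κ / 2` is a lower bound of the image of `p`. -/
noncomputable def coupledSample {π : A → B} (hπ : Function.Surjective π) (κ : B → ℝ) (p : A → ℝ) :
    UnifTriple → A := (exists_coupledSample hπ κ p).choose

variable {π : A → B} (hπ : Function.Surjective π)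

theorem measurable_coupledSample (κ : B → ℝ) (p : A → ℝ) : Measurable (coupledSample hπ κ p) :=
  (exists_coupledSample hπ κ p).choose_spec.1

theorem map_coupledSample_of_mem_coin (κ : B → ℝ) (p : A → ℝ) {u : UnifTriple}
    (hu : u ∈ coin (1 / 2)) : π (coupledSample hπ κ p u) = sampler κ u.2.1 :=
  (exists_coupledSample hπ κ p).choose_spec.2.1 u hu

theorem volume_coupledSample_preimage {κ : B → ℝ} {p : A → ℝ} (hκ : ∀ b, 0 ≤ κ b)
    (hκ1 : ∑ b, κ b = 1) (hp : ∀ a, 0 ≤ p a) (hp1 : ∑ a, p a = 1)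
    (hle : ∀ b, κ b ≤ 2 * fibreMass π p b) (a : A) :
    volume (coupledSample hπ κ p ⁻¹' {a}) = ENNReal.ofReal (p a) :=
  (exists_coupledSample hπ κ p).choose_spec.2.2 hκ hκ1 hp hp1 hle a

end Coupling

/-! ### Resampling blocks -/

section Block

variable {d : ℕ} {S : Type*}

/-- The restriction map from patterns in the ball of radius `4 * q` to patterns in the ball of
radius `2 * q`. -/
def innerPattern (d : ℕ) (S : Type*) (q : ℕ) (a : latticeBall (0 : Zd d) (4 * q) → S) :
    latticeBall (0 : Zd d) (2 * q) → S :=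
  fun v => a ⟨v, latticeBall_mono (by omega) v.2⟩

theorem innerPattern_surjective {d : ℕ} {S : Type*} [Nonempty S] (q : ℕ) :
    Function.Surjective (innerPattern d S q) := by
  intro b
  obtain ⟨ζ, hζ⟩ := exists_restrict_eq (latticeBall (0 : Zd d) (2 * q)) b
  exact ⟨(latticeBall (0 : Zd d) (4 * q)).restrict ζ, by rw [← hζ]; rfl⟩

variable [Fintype S] [MeasurableSpace S] [DiscreteMeasurableSpace S] [Nonempty S]

/-- Resampling of the pattern in the ball of radius `4 * q` around the origin according to the
conditional law given the values `x` on the boundary of this ball. The samples for different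
boundary values coincide, with probability `1 / 2`, on the ball of radius `2 * q`. -/
noncomputable def blockRule (μ : Measure (Zd d → S)) (q : ℕ) (x : Zd d → S) (u : UnifTriple) :
    latticeBall (0 : Zd d) (4 * q) → S :=
  coupledSample (innerPattern_surjective (d := d) (S := S) q)
    (fun b => μ.real (patternEvent (latticeBall 0 (2 * q)) b))
    (fun a => condProb μ (bdry (latticeBall 0 (4 * q))) x (patternEvent (latticeBall 0 (4 * q)) a)) u

theorem blockRule_congr (μ : Measure (Zd d → S)) (q : ℕ) {x x' : Zd d → S}
    (h : ∀ v ∈ bdry (latticeBall 0 (4 * q)), x v = x' v) : blockRule μ q x = blockRule μ q x' := by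
  unfold blockRule
  simp_rw [condProb_congr μ h]

theorem measurable_blockRule (μ : Measure (Zd d → S)) (q : ℕ) (x : Zd d → S) :
    Measurable (blockRule μ q x) := 
  measurable_coupledSample (innerPattern_surjective q) _ _

theorem blockRule_eq_of_mem_coin (μ : Measure (Zd d → S)) (q : ℕ) (x x' : Zd d → S) {u : UnifTriple}
    (hu : u ∈ coin (1 / 2)) {v : Zd d} (hv : v ∈ latticeBall (0 : Zd d) (2 * q)) :
    blockRule μ q x u ⟨v, latticeBall_mono (by omega) hv⟩ =
      blockRule μ q x' u ⟨v, latticeBall_mono (by omega) hv⟩ := by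
  have h : ∀ x, innerPattern d S q (blockRule μ q x u) = _ := fun x =>
    map_coupledSample_of_mem_coin (innerPattern_surjective (d := d) (S := S) q) _ _ hu
  exact congrFun ((h x).trans (h x').symm) ⟨v, hv⟩

theorem volume_blockRule_preimage {μ : Measure (Zd d → S)} [IsProbabilityMeasure μ]
    (hμ : IsMarkovRandomField μ) {ρ : ℕ → ℝ≥0} (hw : WeakSpatialMixing μ ρ)
    (hρ : AntitoneOn ρ (Set.Ici 1)) {q : ℕ} (hq : 1 ≤ q)
    (hsmall : 8 * ((2 * (3 * q + 1) + 1 : ℕ) ^ d * (ρ q : ℝ)) ≤ 1) {x : Zd d → S}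
    (hx : μ (cyl (bdry (latticeBall 0 (4 * q))) x) ≠ 0)
    (a : latticeBall (0 : Zd d) (4 * q) → S) :
    volume (blockRule μ q x ⁻¹' {a}) = ENNReal.ofReal
      (condProb μ (bdry (latticeBall 0 (4 * q))) x (patternEvent (latticeBall 0 (4 * q)) a)) := by
  refine volume_coupledSample_preimage (innerPattern_surjective q) (fun b => measureReal_nonneg) ?_
    (fun a => condProb_nonneg _ _ _ _) (sum_condProb_restrict μ _ _ hx) (fun b => ?_) a
  · have := sum_real_inter_restrict μ (latticeBall (0 : Zd d) (2 * q)) MeasurableSet.univ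
    simpa using this
  -- This is the ratio mixing property.
  obtain ⟨ξ, hξ⟩ := exists_restrict_eq (latticeBall (0 : Zd d) (2 * q)) b
  have hξ' : patternEvent (latticeBall (0 : Zd d) (2 * q)) b = cyl (latticeBall 0 (2 * q)) ξ := by
    rw [patternEvent, ← hξ, restrict_preimage_singleton]
  have hfib : fibreMass (innerPattern d S q) (fun a => condProb μ (bdry (latticeBall 0 (4 * q))) x
      (patternEvent (latticeBall 0 (4 * q)) a)) b =
      condProb μ (bdry (latticeBall 0 (4 * q))) x (cyl (latticeBall 0 (2 * q)) ξ) := by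
    rw [fibreMass]
    simp only [condProb]
    rw [← measureReal_biUnion_finset]
    · congr 1
      ext y
      simp only [Set.mem_iUnion, Finset.mem_filter_univ, exists_prop, patternEvent, Set.mem_preimage,
        Set.mem_singleton_iff, exists_eq_right', ← hξ']
      rfl
    · intro a _ a' _ haa'
      exact Set.disjoint_left.2 fun y hy hy' => haa' (hy.symm.trans hy')
    · exact fun a _ => Finset.measurable_restrict _ (measurableSet_singleton a)
  rw [hfib, hξ', condProb_eq_div, ← mul_div_assoc, le_div_iff₀]
  · have h1 := hw.ratio_mixing hμ hρ hq ξ x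
    rw [Set.inter_comm] at h1
    have h2 : 0 ≤ μ.real (cyl (latticeBall 0 (2 * q)) ξ) *
      μ.real (cyl (bdry (latticeBall 0 (4 * q))) x) :=
      mul_nonneg measureReal_nonneg measureReal_nonneg
    nlinarith
  · exact (measureReal_nonneg).lt_of_ne' fun h0 => hx ((measureReal_eq_zero_iff).1 h0)

end Block

section Update

variable {d : ℕ} {S : Type*}

theorem latticeDist_sub_right_self (v c : Zd d) : latticeDist (v - c) 0 = latticeDist v c := by
  rw [latticeDist_sub_left, zero_add]

/-- The points of `𝒞` are so far from each other that the blocks of radius `4 * q` around them,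
together with their boundaries, are disjoint. -/
def BlockSeparated (q : ℕ) (𝒞 : Set (Zd d)) : Prop :=
  ∀ c ∈ 𝒞, ∀ c' ∈ 𝒞, c ≠ c' → 8 * q + 2 < latticeDist c c'

theorem BlockSeparated.eq_of_near {q : ℕ} {𝒞 : Set (Zd d)} (h : BlockSeparated q 𝒞) {c c' v : Zd d}
    (hc : c ∈ 𝒞) (hc' : c' ∈ 𝒞) (hv : latticeDist v c ≤ 4 * q + 1)
    (hv' : latticeDist v c' ≤ 4 * q + 1) : c = c' := by
  by_contra hne
  have h1 := h c hc c' hc' hne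
  have h2 := latticeDist_triangle c v c'
  rw [latticeDist_comm c v] at h2
  omega

theorem BlockSeparated.mono {q : ℕ} {𝒞 𝒞' : Set (Zd d)} (h : BlockSeparated q 𝒞) (h' : 𝒞' ⊆ 𝒞) :
    BlockSeparated q 𝒞' := fun c hc c' hc' => h c (h' hc) c' (h' hc')

variable [Fintype S] [MeasurableSpace S] [DiscreteMeasurableSpace S] [Nonempty S]

/-- Simultaneous resampling of the blocks around the points of `𝒞`. If a vertex is in several
blocks, then an arbitrary one of them counts; this does not happen for separated blocks. -/
noncomputable def blockUpdate (μ : Measure (Zd d → S)) (q : ℕ) (𝒞 : Set (Zd d))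
    (ω : Zd d → UnifTriple) (x : Zd d → S) (v : Zd d) : S :=
  open Classical in
  if h : ∃ c ∈ 𝒞, latticeDist v c ≤ 4 * q then
    blockRule μ q (shiftConfig h.choose x) (ω h.choose)
      ⟨v - h.choose, mem_latticeBall.2
        ((latticeDist_sub_right_self _ _).trans_le h.choose_spec.2)⟩
  else x v

theorem blockUpdate_of_mem (μ : Measure (Zd d → S)) {q : ℕ} {𝒞 : Set (Zd d)}
    (h : BlockSeparated q 𝒞) (ω : Zd d → UnifTriple) (x : Zd d → S) {c v : Zd d} (hc : c ∈ 𝒞)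
    (hv : latticeDist v c ≤ 4 * q) :
    blockUpdate μ q 𝒞 ω x v = blockRule μ q (shiftConfig c x) (ω c)
      ⟨v - c, mem_latticeBall.2 ((latticeDist_sub_right_self _ _).trans_le hv)⟩ := by
  have hex : ∃ c ∈ 𝒞, latticeDist v c ≤ 4 * q := ⟨c, hc, hv⟩
  have heq : hex.choose = c := h.eq_of_near hex.choose_spec.1 hc
    (hex.choose_spec.2.trans (Nat.le_succ _)) (hv.trans (Nat.le_succ _))
  rw [blockUpdate, dif_pos hex]
  congr! 2
  rw [heq]

theorem blockUpdate_of_forall_lt (μ : Measure (Zd d → S)) {q : ℕ} {𝒞 : Set (Zd d)}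
    (ω : Zd d → UnifTriple) (x : Zd d → S) {v : Zd d} (hv : ∀ c ∈ 𝒞, 4 * q < latticeDist v c) :
    blockUpdate μ q 𝒞 ω x v = x v := by
  rw [blockUpdate, dif_neg]
  rintro ⟨c, hc, hvc⟩
  exact absurd (hv c hc) (by omega)

theorem blockUpdate_congr (μ : Measure (Zd d → S)) {q : ℕ} {𝒞 𝒞' : Set (Zd d)}
    (h : BlockSeparated q 𝒞) (h' : BlockSeparated q 𝒞') {ω ω' : Zd d → UnifTriple} {x x' : Zd d → S}
    {v : Zd d} (h𝒞 : ∀ c, latticeDist c v ≤ 4 * q → (c ∈ 𝒞 ↔ c ∈ 𝒞'))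
    (hω : ∀ c, latticeDist c v ≤ 4 * q → ω c = ω' c)
    (hx : ∀ u, latticeDist u v ≤ 8 * q + 1 → x u = x' u) :
    blockUpdate μ q 𝒞 ω x v = blockUpdate μ q 𝒞' ω' x' v := by
  by_cases hex : ∃ c ∈ 𝒞, latticeDist v c ≤ 4 * q
  · obtain ⟨c, hc, hv⟩ := hex
    have hv' : latticeDist c v ≤ 4 * q := by rwa [latticeDist_comm]
    rw [blockUpdate_of_mem μ h ω x hc hv, blockUpdate_of_mem μ h' ω' x' ((h𝒞 c hv').1 hc) hv,
      hω c hv', blockRule_congr μ q (x := shiftConfig c x) (x' := shiftConfig c x')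
        fun u hu => hx _ ?_]
    have h1 := latticeDist_of_mem_bdry_latticeBall hu
    have h2 := latticeDist_triangle (u + c) c v
    have h3 := latticeDist_sub_right_self (u + c) c
    rw [add_sub_cancel_right] at h3
    omega
  · push Not at hex
    rw [blockUpdate_of_forall_lt μ ω x hex, blockUpdate_of_forall_lt μ ω' x' fun c hc => ?_,
      hx v (by simp)]
    by_contra hlt
    push Not at hlt
    exact absurd (hex c ((h𝒞 c (by rwa [latticeDist_comm])).2 hc)) (by omega)

theorem blockUpdate_shiftConfig (μ : Measure (Zd d → S)) {q : ℕ} {𝒞 𝒞' : Set (Zd d)}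
    (h : BlockSeparated q 𝒞) (h' : BlockSeparated q 𝒞') (ω : Zd d → UnifTriple) (x : Zd d → S)
    (u v : Zd d) (h𝒞 : ∀ c, c ∈ 𝒞' ↔ c + u ∈ 𝒞) :
    blockUpdate μ q 𝒞' (shiftConfig u ω) (shiftConfig u x) v = blockUpdate μ q 𝒞 ω x (v + u) := by
  by_cases hex : ∃ c ∈ 𝒞', latticeDist v c ≤ 4 * q
  · obtain ⟨c, hc, hv⟩ := hex
    rw [blockUpdate_of_mem μ h' _ _ hc hv, blockUpdate_of_mem μ h ω x ((h𝒞 c).1 hc)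
      (by rwa [latticeDist_add_right])]
    simp only [shiftConfig_shiftConfig, add_sub_add_right_eq_sub]
    rfl
  · push Not at hex
    rw [blockUpdate_of_forall_lt μ _ _ hex, blockUpdate_of_forall_lt μ ω x fun c hc => ?_]
    · rfl
    have := hex (c - u) ((h𝒞 _).2 (by simpa using hc))
    rwa [← latticeDist_add_right _ _ u, sub_add_cancel] at this

theorem measurable_blockUpdate (μ : Measure (Zd d → S)) {q : ℕ} {Ω : Type*} [MeasurableSpace Ω]
    {𝒞 : Ω → Set (Zd d)} (h : ∀ b, BlockSeparated q (𝒞 b)) (h𝒞 : ∀ c, MeasurableSet {b | c ∈ 𝒞 b}) :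
    Measurable fun p : Ω × (Zd d → UnifTriple) × (Zd d → S) =>
      blockUpdate μ q (𝒞 p.1) p.2.1 p.2.2 := by
  refine measurable_pi_lambda _ fun v => ?_
  have hrule : ∀ c, Measurable fun p : Ω × (Zd d → UnifTriple) × (Zd d → S) =>
      blockRule μ q (shiftConfig c p.2.2) (p.2.1 c) := by
    intro c
    have h1 : Measurable fun p : (Zd d → S) × UnifTriple => blockRule μ q p.1 p.2 :=
      measurable_uncurry_of_dependsOn_finset (bdry (latticeBall (0 : Zd d) (4 * q)))
        (fun x => blockRule μ q x) (fun x x' hx => blockRule_congr μ q hx)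
        fun x => measurable_blockRule μ q x
    have h2 : Measurable fun p : Ω × (Zd d → UnifTriple) × (Zd d → S) => shiftConfig c p.2.2 :=
      (measurable_shiftConfig c).comp (measurable_snd.comp measurable_snd)
    have h3 : Measurable fun p : Ω × (Zd d → UnifTriple) × (Zd d → S) => p.2.1 c :=
      (measurable_pi_apply c).comp (measurable_fst.comp measurable_snd)
    have h4 := Measurable.comp (g := fun p : (Zd d → S) × UnifTriple => blockRule μ q p.1 p.2)
      (f := fun p : Ω × (Zd d → UnifTriple) × (Zd d → S) => (shiftConfig c p.2.2, p.2.1 c)) h1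
      (h2.prodMk h3)
    exact h4
  refine measurable_to_countable' fun s => ?_
  have hset : (fun p : Ω × (Zd d → UnifTriple) × (Zd d → S) =>
      blockUpdate μ q (𝒞 p.1) p.2.1 p.2.2 v) ⁻¹' {s} =
      (⋃ c ∈ latticeBall v (4 * q), {p | c ∈ 𝒞 p.1} ∩ {p | ∃ hc : v - c ∈ latticeBall 0 (4 * q),
        blockRule μ q (shiftConfig c p.2.2) (p.2.1 c) ⟨v - c, hc⟩ = s}) ∪
      ((⋂ c ∈ latticeBall v (4 * q), {p | c ∈ 𝒞 p.1}ᶜ) ∩ {p | p.2.2 v = s}) := by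
    ext p
    simp only [Set.mem_preimage, Set.mem_singleton_iff, Set.mem_union, Set.mem_iUnion,
      Set.mem_inter_iff, Set.mem_ofPred_eq, Set.mem_iInter, Set.mem_compl_iff, mem_latticeBall,
      latticeDist_sub_right_self, exists_prop]
    by_cases hex : ∃ c ∈ 𝒞 p.1, latticeDist v c ≤ 4 * q
    · obtain ⟨c, hc, hv⟩ := hex
      have hv' : latticeDist c v ≤ 4 * q := by rwa [latticeDist_comm]
      rw [blockUpdate_of_mem μ (h _) _ _ hc hv]
      constructor
      · exact fun hs => Or.inl ⟨c, hv', hc, hv, hs⟩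
      · rintro (⟨c', hv₁, hc₁, hv₂, hs⟩ | ⟨hno, _⟩)
        · obtain rfl := (h p.1).eq_of_near (v := v) hc hc₁ (by omega) (by omega)
          exact hs
        · exact absurd hc (hno c hv')
    · push Not at hex
      rw [blockUpdate_of_forall_lt μ _ _ hex]
      constructor
      · refine fun hs => Or.inr ⟨fun c hv hc => ?_, hs⟩
        have := hex c hc
        rw [latticeDist_comm] at this
        omega
      · rintro (⟨c, _, hc, hv, _⟩ | ⟨_, hs⟩)
        · exact absurd (hex c hc) (by omega)
        · exact hs
  rw [hset]
  refine MeasurableSet.union (Finset.measurableSet_biUnion _ fun c _ =>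
    ((h𝒞 c).preimage measurable_fst).inter ?_)
    ((Finset.measurableSet_biInter _ fun c _ => ((h𝒞 c).preimage measurable_fst).compl).inter ?_)
  · by_cases hc : v - c ∈ latticeBall 0 (4 * q)
    · have : {p : Ω × (Zd d → UnifTriple) × (Zd d → S) |
          ∃ hc : v - c ∈ latticeBall 0 (4 * q),
            blockRule μ q (shiftConfig c p.2.2) (p.2.1 c) ⟨v - c, hc⟩ = s} =
          (fun p => blockRule μ q (shiftConfig c p.2.2) (p.2.1 c) ⟨v - c, hc⟩) ⁻¹' {s} := by
        ext p
        simp [hc]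
      rw [this]
      exact ((measurable_pi_apply _).comp (hrule c)) (measurableSet_singleton s)
    · simp [hc]
  · exact (measurableSet_eval_eq v s).preimage (measurable_snd.comp measurable_snd)

/-- The union of the blocks around the points of a finite set. -/
noncomputable def blocks (q : ℕ) (C : Finset (Zd d)) : Finset (Zd d) :=
  open Classical in C.biUnion fun c => latticeBall c (4 * q)

theorem mem_blocks {q : ℕ} {C : Finset (Zd d)} {v : Zd d} :
    v ∈ blocks q C ↔ ∃ c ∈ C, latticeDist v c ≤ 4 * q := by
  simp [blocks]

/-- The pattern of `ζ` on the block around the origin. -/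
noncomputable def blockPattern (q : ℕ) (ζ : Zd d → S) : latticeBall (0 : Zd d) (4 * q) → S :=
  (latticeBall (0 : Zd d) (4 * q)).restrict ζ

/-- A pattern on a set which contains all blocks and their boundaries arises from resampling if and
only if the old configuration shows it outside of the blocks and, given this, each of the blocks
receives the right pattern. This event is a product. -/
theorem blockUpdate_preimage_cyl (μ : Measure (Zd d → S)) {q : ℕ} {C W : Finset (Zd d)}
    (h : BlockSeparated q (C : Set (Zd d)))
    (hW : ∀ c ∈ C, ∀ v, latticeDist v c ≤ 4 * q + 1 → v ∈ W) (ζ : Zd d → S) :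
    open Classical in
    {p : (Zd d → UnifTriple) × (Zd d → S) | blockUpdate μ q C p.1 p.2 ∈ cyl W ζ} =
      (Set.pi (C : Set (Zd d)) fun c =>
        blockRule μ q (shiftConfig c ζ) ⁻¹' {blockPattern q (shiftConfig c ζ)}) ×ˢ
      cyl (W \ blocks q C) ζ := by
  classical
  have hout : ∀ (ω : Zd d → UnifTriple) (x : Zd d → S), ∀ v ∉ blocks q C,
      blockUpdate μ q C ω x v = x v := by
    intro ω x v hv
    refine blockUpdate_of_forall_lt μ ω x fun c hc => ?_
    by_contra hlt
    exact hv (mem_blocks.2 ⟨c, hc, by omega⟩)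
  -- The values outside of the blocks determine the laws in the blocks.
  have hrule : ∀ x ∈ cyl (W \ blocks q C) ζ, ∀ c ∈ C,
      blockRule μ q (shiftConfig c x) = blockRule μ q (shiftConfig c ζ) := by
    intro x hx c hc
    refine blockRule_congr μ q fun v hv => hx _ ?_
    have h1 := latticeDist_of_mem_bdry_latticeBall hv
    have h2 := latticeDist_sub_right_self (v + c) c
    rw [add_sub_cancel_right, h1] at h2
    rw [Finset.mem_sdiff, mem_blocks]
    refine ⟨hW c hc _ h2.ge, ?_⟩
    rintro ⟨c', hc', hv'⟩
    obtain rfl := h.eq_of_near (v := v + c) hc hc' (by omega) (by omega)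
    omega
  ext p
  simp only [Set.mem_ofPred_eq, Set.mem_prod, Set.mem_pi, Set.mem_preimage, Set.mem_singleton_iff]
  constructor
  · intro hp
    have hx : p.2 ∈ cyl (W \ blocks q C) ζ := by
      intro v hv
      rw [Finset.mem_sdiff] at hv
      rw [← hp v hv.1, hout _ _ v hv.2]
    refine ⟨fun c hc => ?_, hx⟩
    rw [← hrule p.2 hx c hc]
    ext ⟨v, hv⟩
    have hv' : latticeDist (v + c) c ≤ 4 * q := by
      rw [← latticeDist_sub_right_self, add_sub_cancel_right]
      exact mem_latticeBall.1 hv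
    have h1 := blockUpdate_of_mem μ h p.1 p.2 hc hv'
    rw [hp _ (hW c hc _ (by omega))] at h1
    simp only [add_sub_cancel_right] at h1
    rw [← h1]
    rfl
  · rintro ⟨hω, hx⟩ v hv
    by_cases hvC : v ∈ blocks q C
    · obtain ⟨c, hc, hvc⟩ := mem_blocks.1 hvC
      rw [blockUpdate_of_mem μ h p.1 p.2 hc hvc, hrule p.2 hx c hc, hω c hc]
      simp [blockPattern, shiftConfig]
    · rw [hout _ _ v hvC]
      exact hx v (Finset.mem_sdiff.2 ⟨hv, hvC⟩)

variable {μ : Measure (Zd d → S)} [IsProbabilityMeasure μ]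

/-- The Markov property, for a block which is resampled given a pattern that surrounds it. -/
theorem volume_blockRule_mul (hinv : TranslationInvariant μ) (hμ : IsMarkovRandomField μ)
    {ρ : ℕ → ℝ≥0} (hw : WeakSpatialMixing μ ρ) (hρ : AntitoneOn ρ (Set.Ici 1)) {q : ℕ} (hq : 1 ≤ q)
    (hsmall : 8 * ((2 * (3 * q + 1) + 1 : ℕ) ^ d * (ρ q : ℝ)) ≤ 1) (c : Zd d) {A : Finset (Zd d)}
    (hA : ∀ v ∈ A, 4 * q < latticeDist v c) (hbA : ∀ v, latticeDist v c = 4 * q + 1 → v ∈ A)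
    (ζ : Zd d → S) :
    volume (blockRule μ q (shiftConfig c ζ) ⁻¹' {blockPattern q (shiftConfig c ζ)}) *
        μ (cyl A ζ) = μ (cyl (latticeBall c (4 * q)) ζ ∩ cyl A ζ) := by
  classical
  -- Everything is translated so that the block is centred at the origin.
  set A' := A.image fun w => w - c with hA'
  have hmem : ∀ v, v ∈ A' ↔ v + c ∈ A := by
    intro v
    simp [hA', sub_eq_iff_eq_add]
  have hdist : ∀ v : Zd d, latticeDist v 0 = latticeDist (v + c) c := fun v => by
    rw [← latticeDist_sub_right_self (v + c), add_sub_cancel_right]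
  have hball : (latticeBall c (4 * q)).image (fun w => w - c) = latticeBall 0 (4 * q) := by
    ext v
    simp [sub_eq_iff_eq_add, hdist]
  rw [← cyl_union, ← hinv.measure_cyl A c ζ, ← hinv.measure_cyl (latticeBall c (4 * q) ∪ A) c ζ,
    Finset.image_union, hball, ← hA', cyl_union]
  set ζ' := shiftConfig c ζ
  by_cases h0 : μ (cyl A' ζ') = 0
  · rw [h0, mul_zero]
    exact (measure_mono_null Set.inter_subset_right h0).symm
  have hbA' : bdry (latticeBall (0 : Zd d) (4 * q)) ⊆ A' := fun v hv => (hmem v).2 <| hbA _ <| by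
    rw [← hdist, latticeDist_of_mem_bdry_latticeBall hv]
  have hdisj : Disjoint (latticeBall (0 : Zd d) (4 * q)) A' := Finset.disjoint_left.2 fun v hv hvA => by
    have := hA _ ((hmem v).1 hvA)
    rw [mem_latticeBall, hdist] at hv
    omega
  have h1 := hμ.condProb_mul_of_bdry_subset (latticeBall (0 : Zd d) (4 * q)) subset_rfl hdisj hbA'
    {blockPattern q ζ'} ζ'
  rw [volume_blockRule_preimage hμ hw hρ hq hsmall
    (fun h => h0 (measure_mono_null (cyl_mono hbA' ζ') h)), ← ofReal_measureReal,
    ← ENNReal.ofReal_mul (condProb_nonneg _ _ _ _), h1, ofReal_measureReal, blockPattern,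
    restrict_preimage_singleton]

theorem prod_volume_blockRule_mul (hinv : TranslationInvariant μ) (hμ : IsMarkovRandomField μ)
    {ρ : ℕ → ℝ≥0} (hw : WeakSpatialMixing μ ρ) (hρ : AntitoneOn ρ (Set.Ici 1)) {q : ℕ} (hq : 1 ≤ q)
    (hsmall : 8 * ((2 * (3 * q + 1) + 1 : ℕ) ^ d * (ρ q : ℝ)) ≤ 1) (W : Finset (Zd d))
    (ζ : Zd d → S) (C : Finset (Zd d)) (h : BlockSeparated q (C : Set (Zd d)))
    (hW : ∀ c ∈ C, ∀ v, latticeDist v c ≤ 4 * q + 1 → v ∈ W) :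
    open Classical in
    (∏ c ∈ C, volume (blockRule μ q (shiftConfig c ζ) ⁻¹' {blockPattern q (shiftConfig c ζ)})) *
      μ (cyl (W \ blocks q C) ζ) = μ (cyl W ζ) := by
  classical
  induction C using Finset.induction_on with
  | empty => simp [blocks]
  | insert c C hc ih =>
    rw [Finset.coe_insert] at h
    rw [Finset.prod_insert hc, mul_comm (volume _), mul_assoc,
      volume_blockRule_mul hinv hμ hw hρ hq hsmall c (fun v hv => ?_) (fun v hv => ?_) ζ, ← cyl_union]
    · rw [← ih (h.mono (Set.subset_insert _ _)) fun c' hc' => hW c' (Finset.mem_insert_of_mem hc')]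
      congr 4
      ext v
      simp only [Finset.mem_union, mem_latticeBall, Finset.mem_sdiff, mem_blocks, Finset.mem_insert,
        exists_eq_or_imp, not_or]
      constructor
      · rintro (hv | ⟨hv, -, hv'⟩)
        · refine ⟨hW c (Finset.mem_insert_self _ _) v (by omega), ?_⟩
          rintro ⟨c', hc', hv'⟩
          obtain rfl := h.eq_of_near (v := v) (Set.mem_insert _ _) (Set.mem_insert_of_mem _ hc')
            (by omega) (by omega)
          exact hc hc'
        · exact ⟨hv, hv'⟩
      · rintro ⟨hv, hv'⟩
        by_cases hvc : latticeDist v c ≤ 4 * q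
        · exact Or.inl hvc
        · exact Or.inr ⟨hv, hvc, hv'⟩
    · rw [Finset.mem_sdiff, mem_blocks] at hv
      by_contra hlt
      exact hv.2 ⟨c, Finset.mem_insert_self _ _, by omega⟩
    · rw [Finset.mem_sdiff, mem_blocks]
      refine ⟨hW c (Finset.mem_insert_self _ _) v hv.le, ?_⟩
      rintro ⟨c', hc', hv'⟩
      obtain rfl := h.eq_of_near (v := v) (Set.mem_insert _ _)
        (by simpa using hc') (by omega) (by omega)
      omega

/-- Resampling separated blocks preserves the law of the field. -/
theorem measure_blockUpdate (hinv : TranslationInvariant μ) (hμ : IsMarkovRandomField μ)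
    {ρ : ℕ → ℝ≥0} (hw : WeakSpatialMixing μ ρ) (hρ : AntitoneOn ρ (Set.Ici 1)) {q : ℕ} (hq : 1 ≤ q)
    (hsmall : 8 * ((2 * (3 * q + 1) + 1 : ℕ) ^ d * (ρ q : ℝ)) ≤ 1) {𝒞 : Set (Zd d)}
    (h : BlockSeparated q 𝒞) (W : Finset (Zd d)) (ζ : Zd d → S) :
    ((iidLaw d (volume : Measure UnifTriple)).prod μ)
      {p | blockUpdate μ q 𝒞 p.1 p.2 ∈ cyl W ζ} = μ (cyl W ζ) := by
  classical
  -- Only the finitely many blocks that meet `W` matter.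
  set C : Finset (Zd d) := (W.biUnion fun v => latticeBall v (4 * q)).filter fun c => c ∈ 𝒞 with hC
  have hsub : (C : Set (Zd d)) ⊆ 𝒞 := fun c hc => (Finset.mem_filter.1 hc).2
  have hsep := h.mono hsub
  have heq : ∀ ω x, ∀ v ∈ W, blockUpdate μ q 𝒞 ω x v = blockUpdate μ q C ω x v := by
    intro ω x v hv
    refine blockUpdate_congr μ h hsep (fun c hc => ⟨fun hc' => ?_, fun hc' => hsub hc'⟩)
      (fun _ _ => rfl) fun _ _ => rfl
    exact Finset.mem_filter.2 ⟨Finset.mem_biUnion.2 ⟨v, hv, mem_latticeBall.2 hc⟩, hc'⟩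
  set W' := W ∪ C.biUnion fun c => latticeBall c (4 * q + 1) with hW'
  have hmeas : Measurable fun p : (Zd d → UnifTriple) × (Zd d → S) =>
      blockUpdate μ q (C : Set (Zd d)) p.1 p.2 := by
    have h1 := measurable_blockUpdate μ (Ω := Unit) (𝒞 := fun _ => (C : Set (Zd d)))
      (fun _ => hsep) fun c => MeasurableSet.const _
    have h2 : Measurable fun p : (Zd d → UnifTriple) × (Zd d → S) => ((), p) :=
      measurable_const.prodMk measurable_id
    exact Measurable.comp (f := fun p : (Zd d → UnifTriple) × (Zd d → S) => ((), p)) h1 h2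
  have hset : {p : (Zd d → UnifTriple) × (Zd d → S) | blockUpdate μ q 𝒞 p.1 p.2 ∈ cyl W ζ} =
      (fun p : (Zd d → UnifTriple) × (Zd d → S) => blockUpdate μ q (C : Set (Zd d)) p.1 p.2) ⁻¹'
        cyl W ζ := by
    ext p
    exact forall₂_congr fun v hv => by rw [heq p.1 p.2 v hv]
  rw [hset, ← Measure.map_apply hmeas (measurableSet_cyl _ _)]
  refine cyl_eq_of_subset (W' := W') Finset.subset_union_left (fun ζ => ?_) ζ
  have hWC : ∀ c ∈ C, ∀ v, latticeDist v c ≤ 4 * q + 1 → v ∈ W' := fun c hc v hv =>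
    Finset.mem_union_right _ (Finset.mem_biUnion.2 ⟨c, hc, mem_latticeBall.2 hv⟩)
  rw [Measure.map_apply hmeas (measurableSet_cyl _ _)]
  change ((iidLaw d (volume : Measure UnifTriple)).prod μ)
      {p | blockUpdate μ q (C : Set (Zd d)) p.1 p.2 ∈ cyl W' ζ} = _
  rw [blockUpdate_preimage_cyl μ hsep hWC, Measure.prod_prod, iidLaw, Measure.infinitePi_pi
    _ fun c _ => measurable_blockRule μ q _ (measurableSet_singleton _)]
  exact prod_volume_blockRule_mul hinv hμ hw hρ hq hsmall W' ζ C hsep hWC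

end Update

/-! ### Resampling random blocks -/

section Centres

variable {d : ℕ}

/-- The probability that a vertex is a candidate for the centre of a block. It is half the inverse
of the number of vertices in a ball which is somewhat larger than the block. -/
noncomputable def candidateProb (d q : ℕ) : ℝ := 1 / (2 * (latticeBall (0 : Zd d) (9 * q + 2)).card)

/-- The candidates for the centres of blocks of radius `4 * q`. -/
def candidates (q : ℕ) (b : Zd d → UnifTriple) : Set (Zd d) := {c | b c ∈ coin (candidateProb d q)}

/-- The centres of blocks: the candidates which are far from all other candidates. -/
def centres (q : ℕ) (b : Zd d → UnifTriple) : Set (Zd d) :=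
  {c | c ∈ candidates q b ∧ ∀ c' ∈ candidates q b, latticeDist c' c ≤ 8 * q + 2 → c' = c}

theorem blockSeparated_centres (q : ℕ) (b : Zd d → UnifTriple) :
    BlockSeparated q (centres q b) := by
  intro c hc c' hc' hne
  by_contra hlt
  exact hne (hc'.2 c hc.1 (by omega))

theorem measurableSet_mem_candidates (q : ℕ) (c : Zd d) :
    MeasurableSet {b | c ∈ candidates q b} :=
  (measurableSet_coin _).preimage (measurable_pi_apply c)

theorem measurableSet_mem_centres (q : ℕ) (c : Zd d) : MeasurableSet {b | c ∈ centres q b} := by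
  have : {b : Zd d → UnifTriple | c ∈ centres q b} =
      {b | c ∈ candidates q b} ∩ ⋂ c', ({b | c' ∈ candidates q b}ᶜ ∪
        {_b | latticeDist c' c ≤ 8 * q + 2 → c' = c}) := by
    ext b
    simp only [centres, Set.mem_ofPred_eq, Set.mem_inter_iff, Set.mem_iInter, Set.mem_union,
      Set.mem_compl_iff, ← imp_iff_not_or]
  rw [this]
  exact (measurableSet_mem_candidates q c).inter (MeasurableSet.iInter fun c' =>
    (measurableSet_mem_candidates q c').compl.union (MeasurableSet.const _))

theorem mem_centres_congr {q : ℕ} {b b' : Zd d → UnifTriple} {c : Zd d}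
    (h : ∀ c', latticeDist c' c ≤ 8 * q + 2 → b c' = b' c') :
    c ∈ centres q b ↔ c ∈ centres q b' := by
  have h' : ∀ c', latticeDist c' c ≤ 8 * q + 2 → (c' ∈ candidates q b ↔ c' ∈ candidates q b') :=
    fun c' hc' => by simp only [candidates, Set.mem_ofPred_eq, h c' hc']
  refine and_congr (h' c (by simp)) (forall_congr' fun c' => ?_)
  by_cases hc' : latticeDist c' c ≤ 8 * q + 2
  · rw [h' c' hc']
  · simp [hc']

theorem mem_centres_shiftConfig (q : ℕ) (b : Zd d → UnifTriple) (u c : Zd d) :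
    c ∈ centres q (shiftConfig u b) ↔ c + u ∈ centres q b := by
  refine and_congr Iff.rfl ⟨fun h c' hc' hdist => ?_, fun h c' hc' hdist => ?_⟩
  · have := h (c' - u) (by simpa [candidates, shiftConfig] using hc')
      (by rwa [← latticeDist_add_right _ _ u, sub_add_cancel])
    rw [← this, sub_add_cancel]
  · exact add_right_cancel (h (c' + u) hc' (by rwa [latticeDist_add_right]))

/-- The event that a neighbourhood of the origin is contained in a block which is resampled
independently of the current values: there is exactly one candidate in a ball, it is close to the
origin, and the coin of its block shows heads. -/
def renewalEvent (d q : ℕ) : Set ((Zd d → UnifTriple) × (Zd d → UnifTriple)) :=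
  {p | ∃ c ∈ latticeBall (0 : Zd d) q, p.2 c ∈ coin (1 / 2) ∧
    ∀ c' ∈ latticeBall (0 : Zd d) (9 * q + 2), c' ∈ candidates q p.1 ↔ c' = c}

theorem renewalEvent_congr {q : ℕ} {p p' : (Zd d → UnifTriple) × (Zd d → UnifTriple)}
    (h₁ : ∀ v, latticeDist v 0 ≤ 9 * q + 2 → p.1 v = p'.1 v)
    (h₂ : ∀ v, latticeDist v 0 ≤ 9 * q + 2 → p.2 v = p'.2 v) (hp : p ∈ renewalEvent d q) :
    p' ∈ renewalEvent d q := by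
  obtain ⟨c, hc, hcoin, huniq⟩ := hp
  refine ⟨c, hc, ?_, fun c' hc' => ?_⟩
  · rwa [← h₂ c ((mem_latticeBall.1 hc).trans (by omega))]
  · rw [← huniq c' hc']
    simp only [candidates, Set.mem_ofPred_eq, h₁ c' (mem_latticeBall.1 hc')]

/-- The part of the renewal event where the unique candidate is `c`. -/
def renewalBox (d q : ℕ) (c : Zd d) : Set ((Zd d → UnifTriple) × (Zd d → UnifTriple)) :=
  (Set.pi (latticeBall (0 : Zd d) (9 * q + 2) : Set (Zd d)) fun c' =>
    open Classical in if c' = c then coin (candidateProb d q) else (coin (candidateProb d q))ᶜ) ×ˢ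
  (Function.eval c ⁻¹' coin (1 / 2))

theorem measurableSet_renewalBox (q : ℕ) (c : Zd d) : MeasurableSet (renewalBox d q c) := by
  classical
  refine (MeasurableSet.pi (Set.to_countable _) fun c' _ => ?_).prod
    ((measurableSet_coin _).preimage (measurable_pi_apply c))
  split_ifs
  · exact measurableSet_coin _
  · exact (measurableSet_coin _).compl

theorem mem_renewalBox {q : ℕ} {c : Zd d} {p : (Zd d → UnifTriple) × (Zd d → UnifTriple)} :
    p ∈ renewalBox d q c ↔ p.2 c ∈ coin (1 / 2) ∧
      ∀ c' ∈ latticeBall (0 : Zd d) (9 * q + 2), c' ∈ candidates q p.1 ↔ c' = c := by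
  rw [renewalBox, Set.mem_prod, Set.mem_pi, and_comm]
  refine and_congr Iff.rfl (forall₂_congr fun c' _ => ?_)
  by_cases h : c' = c <;> simp [h, candidates]

theorem renewalEvent_eq (d q : ℕ) :
    renewalEvent d q = ⋃ c ∈ latticeBall (0 : Zd d) q, renewalBox d q c := by
  ext p
  simp only [renewalEvent, Set.mem_ofPred_eq, Set.mem_iUnion, mem_renewalBox, exists_prop]

theorem measurableSet_renewalEvent (d q : ℕ) : MeasurableSet (renewalEvent d q) := by
  rw [renewalEvent_eq]
  exact Finset.measurableSet_biUnion _ fun c _ => measurableSet_renewalBox q c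

theorem card_latticeBall_pos (c : Zd d) (r : ℕ) : 0 < (latticeBall c r).card :=
  Finset.card_pos.2 ⟨c, by simp⟩

theorem le_measure_renewalBox (q : ℕ) {c : Zd d} (hc : c ∈ latticeBall (0 : Zd d) q) :
    ENNReal.ofReal (1 / (8 * (latticeBall (0 : Zd d) (9 * q + 2)).card)) ≤
      ((iidLaw d (volume : Measure UnifTriple)).prod (iidLaw d volume)) (renewalBox d q c) := by
  classical
  set B := latticeBall (0 : Zd d) (9 * q + 2) with hB
  have hcB : c ∈ B := latticeBall_mono (by omega) hc
  have hN : 0 < B.card := card_latticeBall_pos _ _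
  have hN' : (1 : ℝ) ≤ B.card := by exact_mod_cast hN
  set p := candidateProb d q with hp
  have hp' : p = 1 / (2 * B.card) := rfl
  have hp0 : 0 ≤ p := by rw [hp']; positivity
  have hpN : B.card * p = 1 / 2 := by
    rw [hp']
    field_simp
  have hp1 : p ≤ 1 := by nlinarith
  have hcompl : (volume : Measure UnifTriple) (coin p)ᶜ = ENNReal.ofReal (1 - p) := by
    rw [prob_compl_eq_one_sub (measurableSet_coin p), volume_coin hp0 hp1, ← ENNReal.ofReal_one,
      ← ENNReal.ofReal_sub _ hp0]
  rw [renewalBox, Measure.prod_prod, iidLaw, Measure.infinitePi_pi _ fun c' _ => ?_,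
    (measurePreserving_eval_infinitePi (fun _ : Zd d => (volume : Measure UnifTriple))
      c).measure_preimage (measurableSet_coin _).nullMeasurableSet,
    volume_coin (by norm_num) (by norm_num), ← Finset.mul_prod_erase _ _ hcB, if_pos rfl,
    volume_coin hp0 hp1, Finset.prod_congr rfl (g := fun _ => ENNReal.ofReal (1 - p)),
    Finset.prod_const, Finset.card_erase_of_mem hcB, ← ENNReal.ofReal_pow (by linarith),
    ← ENNReal.ofReal_mul hp0, ← ENNReal.ofReal_mul (mul_nonneg hp0 (pow_nonneg (by linarith) _))]
  · refine ENNReal.ofReal_le_ofReal ?_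
    -- Bernoulli's inequality.
    have h1 := one_add_mul_le_pow (a := -p) (by linarith) (B.card - 1)
    have h2 : ((B.card - 1 : ℕ) : ℝ) ≤ B.card := by exact_mod_cast Nat.sub_le _ _
    have h3 : (1 / 2 : ℝ) ≤ (1 - p) ^ (B.card - 1) := by
      rw [sub_eq_add_neg]
      nlinarith
    have h4 : 1 / (8 * (B.card : ℝ)) = p * (1 / 2) * (1 / 2) := by
      rw [hp']
      field_simp
      norm_num
    rw [h4]
    gcongr
  · intro c' hc'
    rw [if_neg (Finset.ne_of_mem_erase hc'), hcompl]
  · split_ifs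
    · exact measurableSet_coin _
    · exact (measurableSet_coin _).compl

/-- The probability of the renewal event is bounded from below uniformly in the scale `q`: there
are of order `q ^ d` possible centres, and each of them is a candidate with a probability of order
`q ^ (-d)`. -/
theorem le_measure_renewalEvent {q : ℕ} (hq : d ∣ q) :
    ENNReal.ofReal (1 / (8 * (18 * d + 5) ^ d)) ≤
      ((iidLaw d (volume : Measure UnifTriple)).prod (iidLaw d volume)) (renewalEvent d q) := by
  obtain ⟨k, rfl⟩ := hq
  rw [renewalEvent_eq, measure_biUnion_finset _ fun c _ => measurableSet_renewalBox _ c]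
  · refine le_trans ?_ (Finset.card_nsmul_le_sum _ _ _ fun c hc => le_measure_renewalBox (d * k) hc)
    rw [← ENNReal.ofReal_nsmul]
    refine ENNReal.ofReal_le_ofReal ?_
    have h1 : ((k + 1 : ℕ) : ℝ) ^ d ≤ (latticeBall (0 : Zd d) (d * k)).card := by
      exact_mod_cast le_card_latticeBall (0 : Zd d) k
    have h2 : ((latticeBall (0 : Zd d) (9 * (d * k) + 2)).card : ℝ) ≤
        (18 * d + 5) ^ d * ((k + 1 : ℕ) : ℝ) ^ d := by
      have h3 : ((latticeBall (0 : Zd d) (9 * (d * k) + 2)).card : ℝ) ≤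
          ((2 * (9 * (d * k) + 2) + 1 : ℕ) : ℝ) ^ d := by
        exact_mod_cast card_latticeBall_le (0 : Zd d) _
      refine h3.trans ?_
      rw [← mul_pow]
      gcongr
      push_cast
      nlinarith [(Nat.cast_nonneg d : (0 : ℝ) ≤ d), (Nat.cast_nonneg k : (0 : ℝ) ≤ k)]
    have hN : (0 : ℝ) < (latticeBall (0 : Zd d) (9 * (d * k) + 2)).card := by
      exact_mod_cast card_latticeBall_pos _ _
    rw [nsmul_eq_mul, mul_one_div, div_le_div_iff₀ (by positivity) (by positivity)]
    have h4 : (0 : ℝ) < (18 * d + 5) ^ d := by positivity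
    nlinarith [mul_le_mul_of_nonneg_left h1 h4.le]
  · intro c hc c' hc' hne
    refine Set.disjoint_left.2 fun p hp hp' => hne ?_
    have hcB : c ∈ latticeBall (0 : Zd d) (9 * (d * k) + 2) := latticeBall_mono (by omega) hc
    exact ((mem_renewalBox.1 hp').2 c hcB).1 (((mem_renewalBox.1 hp).2 c hcB).2 rfl)

end Centres

section Step

variable {d : ℕ} {S : Type*} [Fintype S] [MeasurableSpace S] [DiscreteMeasurableSpace S]
  [Nonempty S]

/-- Simultaneous resampling of random blocks of radius `4 * q`. -/
noncomputable def blockStep (μ : Measure (Zd d → S)) (q : ℕ) (b ω : Zd d → UnifTriple)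
    (x : Zd d → S) : Zd d → S := blockUpdate μ q (centres q b) ω x

theorem blockStep_congr (μ : Measure (Zd d → S)) {q : ℕ} {b b' ω ω' : Zd d → UnifTriple}
    {x x' : Zd d → S} {v : Zd d} (hb : ∀ c, latticeDist c v ≤ 12 * q + 2 → b c = b' c)
    (hω : ∀ c, latticeDist c v ≤ 12 * q + 2 → ω c = ω' c)
    (hx : ∀ c, latticeDist c v ≤ 12 * q + 2 → x c = x' c) :
    blockStep μ q b ω x v = blockStep μ q b' ω' x' v := by
  refine blockUpdate_congr μ (blockSeparated_centres q b) (blockSeparated_centres q b')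
    (fun c hc => mem_centres_congr fun c' hc' => hb c' ?_) (fun c hc => hω c (by omega))
    fun u hu => hx u (by omega)
  have := latticeDist_triangle c' c v
  omega

theorem blockStep_shiftConfig (μ : Measure (Zd d → S)) (q : ℕ) (b ω : Zd d → UnifTriple)
    (x : Zd d → S) (u : Zd d) :
    blockStep μ q (shiftConfig u b) (shiftConfig u ω) (shiftConfig u x) =
      shiftConfig u (blockStep μ q b ω x) := by
  ext v
  exact blockUpdate_shiftConfig μ (blockSeparated_centres q b) (blockSeparated_centres q _) ω x u v
    (mem_centres_shiftConfig q b u)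

theorem blockStep_eq_of_mem_renewalEvent (μ : Measure (Zd d → S)) {q : ℕ}
    {b ω : Zd d → UnifTriple} (h : (b, ω) ∈ renewalEvent d q) (x x' : Zd d → S) {v : Zd d}
    (hv : latticeDist v 0 ≤ q) : blockStep μ q b ω x v = blockStep μ q b ω x' v := by
  obtain ⟨c, hc, hcoin, huniq⟩ := h
  rw [mem_latticeBall] at hc
  have hcent : c ∈ centres q b := by
    refine ⟨(huniq c (mem_latticeBall.2 (by omega))).2 rfl, fun c' hc' hdist =>
      (huniq c' (mem_latticeBall.2 ?_)).1 hc'⟩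
    have := latticeDist_triangle c' c 0
    omega
  have hvc : latticeDist v c ≤ 2 * q := by
    have h1 := latticeDist_triangle v 0 c
    rw [latticeDist_comm 0 c] at h1
    omega
  have hsep := blockSeparated_centres q b
  rw [blockStep, blockStep, blockUpdate_of_mem μ hsep ω x hcent (by omega),
    blockUpdate_of_mem μ hsep ω x' hcent (by omega)]
  exact blockRule_eq_of_mem_coin μ q _ _ hcoin
    (mem_latticeBall.2 ((latticeDist_sub_right_self v c).trans_le hvc))

theorem measurable_blockStep (μ : Measure (Zd d → S)) (q : ℕ) :
    Measurable fun p : ((Zd d → UnifTriple) × (Zd d → UnifTriple)) × (Zd d → S) =>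
      blockStep μ q p.1.1 p.1.2 p.2 := by
  have h1 := measurable_blockUpdate μ (𝒞 := centres q) (blockSeparated_centres q)
    (measurableSet_mem_centres q)
  exact Measurable.comp
    (f := (MeasurableEquiv.prodAssoc : ((Zd d → UnifTriple) × (Zd d → UnifTriple)) × (Zd d → S) ≃ᵐ _))
    h1 MeasurableEquiv.prodAssoc.measurable

theorem measurePreserving_blockStep {μ : Measure (Zd d → S)} [IsProbabilityMeasure μ]
    (hinv : TranslationInvariant μ) (hμ : IsMarkovRandomField μ)
    {ρ : ℕ → ℝ≥0} (hw : WeakSpatialMixing μ ρ) (hρ : AntitoneOn ρ (Set.Ici 1)) {q : ℕ} (hq : 1 ≤ q)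
    (hsmall : 8 * ((2 * (3 * q + 1) + 1 : ℕ) ^ d * (ρ q : ℝ)) ≤ 1) :
    MeasurePreserving (fun p : ((Zd d → UnifTriple) × (Zd d → UnifTriple)) × (Zd d → S) =>
      blockStep μ q p.1.1 p.1.2 p.2)
      (((iidLaw d (volume : Measure UnifTriple)).prod (iidLaw d volume)).prod μ) μ := by
  have hm := measurable_blockStep μ q
  refine ⟨hm, ?_⟩
  have := Measure.isProbabilityMeasure_map (f := fun p : ((Zd d → UnifTriple) ×
    (Zd d → UnifTriple)) × (Zd d → S) => blockStep μ q p.1.1 p.1.2 p.2)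
    (μ := ((iidLaw d (volume : Measure UnifTriple)).prod (iidLaw d volume)).prod μ) hm.aemeasurable
  refine measure_eq_of_cyl ∅ fun W _ ζ => ?_
  rw [Measure.map_apply hm (measurableSet_cyl W ζ)]
  set ν := iidLaw d (volume : Measure UnifTriple)
  rw [← (measurePreserving_prodAssoc ν ν μ).symm.measure_preimage_equiv,
    Measure.prod_apply ((MeasurableEquiv.measurable _)
      (hm (measurableSet_cyl W ζ)))]
  have h1 : ∀ b : Zd d → UnifTriple, (ν.prod μ) (Prod.mk b ⁻¹' (MeasurableEquiv.prodAssoc.symm ⁻¹'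
      ((fun p : ((Zd d → UnifTriple) × (Zd d → UnifTriple)) × (Zd d → S) =>
        blockStep μ q p.1.1 p.1.2 p.2) ⁻¹' cyl W ζ))) = μ (cyl W ζ) := fun b =>
    measure_blockUpdate hinv hμ hw hρ hq hsmall (blockSeparated_centres q b) W ζ
  simp_rw [h1]
  simp

end Step

/-! ### Layers of independent randomness -/

section Layers

/-- The law of a sequence of independent i.i.d. processes. -/
noncomputable def layersLaw (d : ℕ) : Measure (ℕ → Zd d → UnifTriple) :=
  Measure.infinitePi fun _ => iidLaw d (volume : Measure UnifTriple)

instance (d : ℕ) : IsProbabilityMeasure (layersLaw d) := by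
  unfold layersLaw
  infer_instance

/-- The single-site distribution of a process with a sequence of uniform triples at each site. -/
noncomputable def siteLaw : Measure (ℕ → UnifTriple) := Measure.infinitePi fun _ => volume

instance : IsProbabilityMeasure siteLaw := by
  unfold siteLaw
  infer_instance

/-- The layers of a process with a sequence of uniform triples at each site. -/
def layers {d : ℕ} (y : Zd d → ℕ → UnifTriple) (n : ℕ) (v : Zd d) : UnifTriple := y v n

theorem measurable_layers {d : ℕ} : Measurable (layers (d := d)) :=
  measurable_pi_lambda _ fun n => measurable_pi_lambda _ fun v =>
    (measurable_pi_apply n).comp (measurable_pi_apply v)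

theorem measurePreserving_layers (d : ℕ) :
    MeasurePreserving (layers (d := d)) (iidLaw d siteLaw) (layersLaw d) := by
  refine ⟨measurable_layers, ?_⟩
  have h1 : iidLaw d siteLaw = (Measure.infinitePi fun _ : Zd d × ℕ => (volume : Measure UnifTriple)).map
      (MeasurableEquiv.curry (Zd d) ℕ UnifTriple) :=
    (Measure.infinitePi_map_curry fun (_ : Zd d) (_ : ℕ) => (volume : Measure UnifTriple)).symm
  have h2 : layersLaw d = (Measure.infinitePi fun _ : ℕ × Zd d => (volume : Measure UnifTriple)).map
      (MeasurableEquiv.curry ℕ (Zd d) UnifTriple) :=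
    (Measure.infinitePi_map_curry fun (_ : ℕ) (_ : Zd d) => (volume : Measure UnifTriple)).symm
  have h3 := Measure.map_infinitePi_infinitePi_of_inj
    (P := fun _ : Zd d × ℕ => (volume : Measure UnifTriple)) (f := (Prod.swap : ℕ × Zd d → Zd d × ℕ))
    Prod.swap_injective
  rw [h1, h2, ← h3, Measure.map_map measurable_layers (MeasurableEquiv.measurable _),
    Measure.map_map (f := fun (ω : Zd d × ℕ → UnifTriple) (i : ℕ × Zd d) => ω i.swap)
      (MeasurableEquiv.measurable _) (measurable_pi_lambda _ fun _ => measurable_pi_apply _)]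
  rfl

theorem measurePreserving_head_tail {Z : Type*} [MeasurableSpace Z] (ν : Measure Z)
    [IsProbabilityMeasure ν] :
    MeasurePreserving (fun Y : ℕ → Z => (Y 0, fun n => Y (n + 1)))
      (Measure.infinitePi fun _ => ν) (ν.prod (Measure.infinitePi fun _ => ν)) := by
  have hm : Measurable fun Y : ℕ → Z => (Y 0, fun n => Y (n + 1)) :=
    (measurable_pi_apply 0).prodMk (measurable_pi_lambda _ fun n => measurable_pi_apply (n + 1))
  let cons : Z × (ℕ → Z) → ℕ → Z := fun p n => n.casesOn p.1 p.2
  have hcons : Measurable cons := measurable_pi_lambda _ fun n => by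
    cases n with
    | zero => exact measurable_fst
    | succ n => exact (measurable_pi_apply n).comp measurable_snd
  refine ⟨hm, ?_⟩
  have h : (ν.prod (Measure.infinitePi fun _ => ν)).map cons = Measure.infinitePi fun _ => ν := by
    classical
    refine Measure.eq_infinitePi _ fun s t ht => ?_
    set s' := s.preimage Nat.succ (Nat.succ_injective.injOn) with hs'
    have hset : cons ⁻¹' Set.pi s t = (if 0 ∈ s then t 0 else Set.univ) ×ˢ
        Set.pi (s' : Set ℕ) fun n => t (n + 1) := by
      ext p
      simp only [Set.mem_preimage, Set.mem_pi, Finset.mem_coe, Set.mem_prod, hs', Finset.mem_preimage]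
      constructor
      · intro hp
        refine ⟨?_, fun n hn => hp (n + 1) hn⟩
        split_ifs with h0
        · exact hp 0 h0
        · trivial
      · rintro ⟨h0, hp⟩ n hn
        cases n with
        | zero => rwa [if_pos hn] at h0
        | succ n => exact hp n hn
    rw [Measure.map_apply hcons (MeasurableSet.pi (Set.to_countable _) fun n _ => ht n), hset,
      Measure.prod_prod, Measure.infinitePi_pi _ fun n _ => ht _]
    have himg : ∏ n ∈ s', ν (t (n + 1)) = ∏ n ∈ s.erase 0, ν (t n) := by
      rw [← Finset.prod_image (s := s') (g := Nat.succ) (f := fun n => ν (t n))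
        (Nat.succ_injective.injOn)]
      congr 1
      ext n
      cases n <;> simp [hs']
    rw [himg]
    by_cases h0 : 0 ∈ s
    · rw [if_pos h0, Finset.mul_prod_erase s (fun n => ν (t n)) h0]
    · rw [if_neg h0, measure_univ, one_mul, Finset.erase_eq_of_notMem h0]
  conv_lhs => rw [← h, Measure.map_map hm hcons]
  exact Measure.map_id

/-- The first two layers and the remaining ones. -/
def splitLayers {d : ℕ} (Y : ℕ → Zd d → UnifTriple) :
    ((Zd d → UnifTriple) × (Zd d → UnifTriple)) × (ℕ → Zd d → UnifTriple) :=
  ((Y 0, Y 1), fun n => Y (n + 2))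

theorem measurePreserving_splitLayers (d : ℕ) : MeasurePreserving (splitLayers (d := d)) (layersLaw d)
    (((iidLaw d volume).prod (iidLaw d volume)).prod (layersLaw d)) := by
  have h1 := measurePreserving_head_tail (iidLaw d (volume : Measure UnifTriple))
  have h2 := ((MeasurePreserving.id (iidLaw d (volume : Measure UnifTriple))).prod h1).comp h1
  exact (measurePreserving_prodAssoc (iidLaw d (volume : Measure UnifTriple))
    (iidLaw d volume) (layersLaw d)).symm.comp h2

end Layers

section Iterate

variable {d : ℕ} {S : Type*} [Fintype S] [MeasurableSpace S] [DiscreteMeasurableSpace S]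
  [Nonempty S]

/-- Resampling of random blocks at the scales `qs 0`, …, `qs (n - 1)`, starting from the
configuration `z`. The step at the scale `qs k` uses the layer `2 * k` for the choice of the blocks
and the layer `2 * k + 1` for the resampling. The last scale `qs (n - 1)`, which is the largest in
the application, comes first, so that the smaller scales cannot carry information far. -/
noncomputable def blockIterate (μ : Measure (Zd d → S)) : (ℕ → ℕ) → ℕ → (ℕ → Zd d → UnifTriple) →
    (Zd d → S) → Zd d → S
  | _, 0, _, z => z
  | qs, n + 1, Y, z => blockStep μ (qs 0) (Y 0) (Y 1)
      (blockIterate μ (fun k => qs (k + 1)) n (fun k => Y (k + 2)) z)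

theorem blockIterate_shiftConfig (μ : Measure (Zd d → S)) (qs : ℕ → ℕ) (n : ℕ)
    (Y : ℕ → Zd d → UnifTriple) (z : Zd d → S) (u : Zd d) :
    blockIterate μ qs n (fun k => shiftConfig u (Y k)) (shiftConfig u z) =
      shiftConfig u (blockIterate μ qs n Y z) := by
  induction n generalizing qs Y with
  | zero => rfl
  | succ n ih => rw [blockIterate, blockIterate, ih, blockStep_shiftConfig]

theorem measurePreserving_blockIterate {μ : Measure (Zd d → S)} [IsProbabilityMeasure μ]
    (hinv : TranslationInvariant μ) (hμ : IsMarkovRandomField μ)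
    {ρ : ℕ → ℝ≥0} (hw : WeakSpatialMixing μ ρ) (hρ : AntitoneOn ρ (Set.Ici 1)) {qs : ℕ → ℕ}
    (hqs : ∀ k, 1 ≤ qs k)
    (hsmall : ∀ k, 8 * ((2 * (3 * qs k + 1) + 1 : ℕ) ^ d * (ρ (qs k) : ℝ)) ≤ 1) (n : ℕ) :
    MeasurePreserving (fun p : (ℕ → Zd d → UnifTriple) × (Zd d → S) =>
      blockIterate μ qs n p.1 p.2) ((layersLaw d).prod μ) μ := by
  induction n generalizing qs with
  | zero => exact measurePreserving_snd
  | succ n ih =>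
    have h1 := (measurePreserving_splitLayers d).prod (MeasurePreserving.id μ)
    have h2 := (measurePreserving_prodAssoc ((iidLaw d volume).prod (iidLaw d volume)) (layersLaw d)
      μ).comp h1
    have h3 := ((MeasurePreserving.id ((iidLaw d volume).prod (iidLaw d volume))).prod
      (ih (fun k => hqs (k + 1)) fun k => hsmall (k + 1))).comp h2
    exact (measurePreserving_blockStep hinv hμ hw hρ (hqs 0) (hsmall 0)).comp h3

theorem measurable_blockIterate (μ : Measure (Zd d → S)) (qs : ℕ → ℕ) (n : ℕ) :
    Measurable fun p : (ℕ → Zd d → UnifTriple) × (Zd d → S) => blockIterate μ qs n p.1 p.2 := by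
  induction n generalizing qs with
  | zero => exact measurable_snd
  | succ n ih =>
    have h1 : Measurable fun p : (ℕ → Zd d → UnifTriple) × (Zd d → S) =>
        ((fun k => p.1 (k + 2) : ℕ → Zd d → UnifTriple), p.2) :=
      (measurable_pi_lambda _ fun k => (measurable_pi_apply (k + 2)).comp measurable_fst).prodMk
        measurable_snd
    have h2 := (ih fun k => qs (k + 1)).comp h1
    have h3 : Measurable fun p : (ℕ → Zd d → UnifTriple) × (Zd d → S) => (p.1 0, p.1 1) :=
      ((measurable_pi_apply 0).comp measurable_fst).prodMk
        ((measurable_pi_apply 1).comp measurable_fst)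
    exact (measurable_blockStep μ (qs 0)).comp (h3.prodMk h2)

/-- The configuration `z` and the layers beyond `2 * n + 1` are irrelevant in a neighbourhood of
the origin if the renewal event occurs at level `n`. A step at scale `q` reads the values up to
distance `12 * q + 2`, so by `hs` the subsequent steps do not see beyond the ball of radius `qs n`,
where the configuration is renewed. -/
theorem blockIterate_eq_of_mem_renewalEvent (μ : Measure (Zd d → S)) {n : ℕ} {qs : ℕ → ℕ}
    {Y Y' : ℕ → Zd d → UnifTriple} (z z' : Zd d → S) {N N' s : ℕ} (hN : n < N) (hN' : n < N')
    (h : (Y (2 * n), Y (2 * n + 1)) ∈ renewalEvent d (qs n))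
    (hs : s + ∑ k ∈ Finset.range n, (12 * qs k + 2) ≤ qs n)
    (hY : ∀ j ≤ 2 * n + 1, ∀ v, latticeDist v 0 ≤ 13 * qs n + 2 → Y j v = Y' j v) {v : Zd d}
    (hv : latticeDist v 0 ≤ s) : blockIterate μ qs N Y z v = blockIterate μ qs N' Y' z' v := by
  induction n generalizing qs Y Y' N N' s v with
  | zero =>
    obtain ⟨N, rfl⟩ := Nat.exists_eq_succ_of_ne_zero hN.ne'
    obtain ⟨N', rfl⟩ := Nat.exists_eq_succ_of_ne_zero hN'.ne'
    rw [Finset.range_zero, Finset.sum_empty, add_zero] at hs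
    rw [blockIterate, blockIterate,
      blockStep_eq_of_mem_renewalEvent μ h _ (blockIterate μ (fun k => qs (k + 1)) N'
        (fun k => Y' (k + 2)) z') (hv.trans hs)]
    refine blockStep_congr μ (fun c hc => hY 0 (by omega) c ?_) (fun c hc => hY 1 (by omega) c ?_)
      fun _ _ => rfl
    · have := latticeDist_triangle c v 0
      omega
    · have := latticeDist_triangle c v 0
      omega
  | succ n ih =>
    obtain ⟨N, rfl⟩ := Nat.exists_eq_succ_of_ne_zero (Nat.ne_of_gt (Nat.zero_lt_of_lt hN))
    obtain ⟨N', rfl⟩ := Nat.exists_eq_succ_of_ne_zero (Nat.ne_of_gt (Nat.zero_lt_of_lt hN'))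
    rw [Finset.sum_range_succ'] at hs
    have hdist : ∀ c, latticeDist c v ≤ 12 * qs 0 + 2 → latticeDist c 0 ≤ s + (12 * qs 0 + 2) := by
      intro c hc
      have := latticeDist_triangle c v 0
      omega
    rw [blockIterate, blockIterate]
    refine blockStep_congr μ (fun c hc => hY 0 (by omega) c ?_) (fun c hc => hY 1 (by omega) c ?_)
      fun c hc => ?_
    · have := hdist c hc
      omega
    · have := hdist c hc
      omega
    · refine ih (qs := fun k => qs (k + 1)) (by omega) (by omega) h ?_ (fun j hj w hw =>
        hY (j + 2) (by omega) w hw) (hdist c hc)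
      omega

/-- A product bound, by independence of the renewal events at different levels. -/
theorem measure_forall_notMem_renewalEvent_le {κ : ℝ≥0∞} {qs : ℕ → ℕ}
    (hκ : ∀ k, ((iidLaw d (volume : Measure UnifTriple)).prod (iidLaw d volume))
      (renewalEvent d (qs k))ᶜ ≤ κ) (n : ℕ) :
    layersLaw d {Y | ∀ k < n, (Y (2 * k), Y (2 * k + 1)) ∉ renewalEvent d (qs k)} ≤ κ ^ n := by
  induction n generalizing qs with
  | zero => simp
  | succ n ih =>
    have hset : {Y : ℕ → Zd d → UnifTriple |
          ∀ k < n + 1, (Y (2 * k), Y (2 * k + 1)) ∉ renewalEvent d (qs k)} =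
        splitLayers ⁻¹' ((renewalEvent d (qs 0))ᶜ ×ˢ
          {Y | ∀ k < n, (Y (2 * k), Y (2 * k + 1)) ∉ renewalEvent d (qs (k + 1))}) := by
      ext Y
      simp only [Set.mem_ofPred_eq, Set.mem_preimage, splitLayers, Set.mem_prod, Set.mem_compl_iff]
      constructor
      · exact fun h => ⟨h 0 (by omega), fun k hk => h (k + 1) (by omega)⟩
      · rintro ⟨h0, h⟩ (_ | k) hk
        · exact h0
        · exact h k (by omega)
    have hm : MeasurableSet {Y : ℕ → Zd d → UnifTriple |
        ∀ k < n, (Y (2 * k), Y (2 * k + 1)) ∉ renewalEvent d (qs (k + 1))} := by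
      have : {Y : ℕ → Zd d → UnifTriple |
          ∀ k < n, (Y (2 * k), Y (2 * k + 1)) ∉ renewalEvent d (qs (k + 1))} =
          ⋂ k ∈ Finset.range n, (fun Y : ℕ → Zd d → UnifTriple => (Y (2 * k), Y (2 * k + 1))) ⁻¹'
            (renewalEvent d (qs (k + 1)))ᶜ := by
        ext Y
        simp
      rw [this]
      exact Finset.measurableSet_biInter _ fun k _ =>
        ((measurable_pi_apply _).prodMk (measurable_pi_apply _))
          (measurableSet_renewalEvent d _).compl
    rw [hset, (measurePreserving_splitLayers d).measure_preimage
      ((measurableSet_renewalEvent d _).compl.prod hm).nullMeasurableSet, Measure.prod_prod, pow_succ']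
    exact mul_le_mul' (hκ 0) (ih fun k => hκ (k + 1))

end Iterate

/-! ### Power-law tails under weak spatial mixing -/

section Weak

variable {d : ℕ} {S : Type*} [Fintype S] [MeasurableSpace S] [DiscreteMeasurableSpace S]

/-- An exponentially decaying rate function beats the volume of a ball. -/
theorem HasExponentialDecay.exists_forall_card_mul_le {ρ : ℕ → ℝ≥0} (h : HasExponentialDecay ρ)
    (d : ℕ) : ∃ q₀ : ℕ, 1 ≤ q₀ ∧ ∀ q, q₀ ≤ q →
      8 * ((2 * (3 * q + 1) + 1 : ℕ) ^ d * (ρ q : ℝ)) ≤ 1 := by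
  obtain ⟨C, c, hC, hc, hdecay⟩ := h
  have h0 : 0 < Real.exp (-c) := Real.exp_pos _
  have h1 : Real.exp (-c) < 1 := (Real.exp_lt_exp.2 (by linarith)).trans_eq Real.exp_zero
  have hlim := (tendsto_pow_const_mul_const_pow_of_abs_lt_one d
    (by rwa [abs_of_pos h0] : |Real.exp (-c)| < 1)).const_mul (8 * 9 ^ d * C)
  rw [mul_zero] at hlim
  obtain ⟨q₁, hq₁⟩ := eventually_atTop.1 (hlim.eventually (ge_mem_nhds zero_lt_one))
  refine ⟨max 1 q₁, le_max_left _ _, fun q hq => ?_⟩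
  have hq1 : 1 ≤ q := (le_max_left _ _).trans hq
  refine le_trans ?_ (hq₁ q ((le_max_right _ _).trans hq))
  have h2 : ((2 * (3 * q + 1) + 1 : ℕ) : ℝ) ≤ 9 * q := by
    have : 2 * (3 * q + 1) + 1 ≤ 9 * q := by omega
    exact_mod_cast this
  have h3 := hdecay q hq1
  have h4 : Real.exp (-c * q) = Real.exp (-c) ^ q := by rw [← Real.exp_nat_mul, mul_comm]
  rw [h4] at h3
  calc 8 * (((2 * (3 * q + 1) + 1 : ℕ) : ℝ) ^ d * (ρ q : ℝ))
      ≤ 8 * ((9 * q) ^ d * (C * Real.exp (-c) ^ q)) := by gcongr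
    _ = 8 * 9 ^ d * C * ((q : ℝ) ^ d * Real.exp (-c) ^ q) := by
        rw [mul_pow]
        ring

/-- The scales of the blocks. -/
def blockScale (d q₀ n : ℕ) : ℕ := d * q₀ * 16 ^ n

theorem sum_blockScale_le {d q₀ : ℕ} (h : 1 ≤ d * q₀) (n : ℕ) :
    ∑ k ∈ Finset.range n, (12 * blockScale d q₀ k + 2) ≤ blockScale d q₀ n := by
  induction n with
  | zero => simp
  | succ n ih =>
    rw [Finset.sum_range_succ]
    have h1 : 1 ≤ blockScale d q₀ n := Nat.mul_pos h (by positivity)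
    have h2 : blockScale d q₀ (n + 1) = 16 * blockScale d q₀ n := by
      simp only [blockScale, pow_succ]
      ring
    omega

/-- The event that the value at the origin is determined by the renewal event at level `n`. -/
def renewalAt (d q₀ n : ℕ) : Set (Zd d → ℕ → UnifTriple) :=
  {y | (layers y (2 * n), layers y (2 * n + 1)) ∈ renewalEvent d (blockScale d q₀ n)}

theorem measurableSet_renewalAt (d q₀ n : ℕ) : MeasurableSet (renewalAt d q₀ n) :=
  (((measurable_pi_apply _).comp measurable_layers).prodMk
    ((measurable_pi_apply _).comp measurable_layers)) (measurableSet_renewalEvent d _)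

theorem iidLaw_forall_notMem_renewalAt_le (d q₀ n : ℕ) :
    iidLaw d siteLaw {y | ∀ k < n, y ∉ renewalAt d q₀ k} ≤
      ENNReal.ofReal (1 - 1 / (8 * (18 * d + 5) ^ d)) ^ n := by
  refine le_trans ?_ (measure_forall_notMem_renewalEvent_le (d := d) (qs := blockScale d q₀) (fun k => ?_) n)
  · rw [← (measurePreserving_layers d).map_eq]
    exact Measure.le_map_apply measurable_layers.aemeasurable _
  · rw [prob_compl_eq_one_sub (measurableSet_renewalEvent d _), ENNReal.ofReal_sub _ (by positivity),
      ENNReal.ofReal_one]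
    exact tsub_le_tsub_left (le_measure_renewalEvent ((Dvd.intro _ rfl).mul_right _)) _

theorem ExponentialWeakSpatialMixing.isFfiidWithPowerLawTails (hd : 1 ≤ d)
    {μ : Measure (Zd d → S)} [IsProbabilityMeasure μ] (hinv : TranslationInvariant μ)
    (hmrf : IsMarkovRandomField μ) (h : ExponentialWeakSpatialMixing μ) :
    IsFfiidWithPowerLawTails μ := by
  obtain ⟨ρ, ⟨hρ, _⟩, hdecay, hw⟩ := h
  obtain ⟨q₀, hq₀, hsmall⟩ := hdecay.exists_forall_card_mul_le d
  have hne : Nonempty (Zd d → S) := by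
    by_contra hempty
    rw [not_nonempty_iff] at hempty
    exact IsProbabilityMeasure.ne_zero μ (Measure.eq_zero_of_isEmpty μ)
  have hS : Nonempty S := ⟨hne.some 0⟩
  let s₀ : S := Classical.arbitrary S
  let x₀ : Zd d → S := fun _ => s₀
  have hdq : 1 ≤ d * q₀ := Nat.mul_pos hd hq₀
  set qs := blockScale d q₀ with hqs
  have hq₀qs : ∀ k, q₀ ≤ qs k := fun k =>
    (Nat.le_mul_of_pos_left _ hd).trans (Nat.le_mul_of_pos_right _ (by positivity))
  let D : ℕ → Set (Zd d → ℕ → UnifTriple) := renewalAt d q₀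
  -- The steps up to level `n` read the balls of radius `12 * qs n + 2` around the vertices of the
  -- ball of radius `qs n`.
  let rad : ℕ → ℕ := fun n => 13 * qs n + 2
  let H : ℕ → (Zd d → ℕ → UnifTriple) → S := fun n y => blockIterate μ qs (n + 1) (layers y) x₀ 0
  let F : ℕ → (Zd d → ℕ → UnifTriple) × (Zd d → S) → Zd d → S := fun n p =>
    blockIterate μ qs n (layers p.1) p.2
  have hdet : ∀ {i N N' : ℕ} {y y' : Zd d → ℕ → UnifTriple} (z z' : Zd d → S), i < N → i < N' →
      y ∈ D i → (∀ v, latticeDist v 0 ≤ rad i → y' v = y v) →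
      blockIterate μ qs N (layers y) z 0 = blockIterate μ qs N' (layers y') z' 0 := by
    intro i N N' y y' z z' hN hN' hy hyy'
    refine blockIterate_eq_of_mem_renewalEvent μ z z' (s := 0) hN hN' hy ?_ (fun j _ v hv => ?_)
      (by simp)
    · rw [zero_add]
      exact sum_blockScale_le hdq i
    · simp only [layers, hyy' v hv]
  have hHle : ∀ i j y, i ≤ j → y ∈ D i → H i y = H j y := fun i j y hij hy =>
    hdet _ _ (by omega) (by omega) hy fun _ _ => rfl
  have hH : ∀ i j y, y ∈ D i → y ∈ D j → H i y = H j y := fun i j y hi hj =>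
    (le_total i j).elim (fun hij => hHle i j y hij hi) fun hij => (hHle j i y hij hj).symm
  have hloc : ∀ i y y', y ∈ D i → (∀ v, latticeDist v 0 ≤ rad i → y' v = y v) →
      y' ∈ D i ∧ H i y' = H i y := by
    intro i y y' hy hyy'
    refine ⟨renewalEvent_congr (fun v hv => ?_) (fun v hv => ?_) hy,
      (hdet _ _ (by omega) (by omega) hy hyy').symm⟩
    · have : latticeDist v 0 ≤ rad i := hv.trans (by change 9 * qs i + 2 ≤ 13 * qs i + 2; omega)
      simp only [layers, hyy' v this]
    · have : latticeDist v 0 ≤ rad i := hv.trans (by change 9 * qs i + 2 ≤ 13 * qs i + 2; omega)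
      simp only [layers, hyy' v this]
  set κ : ℝ := 1 - 1 / (8 * (18 * d + 5) ^ d) with hκ
  have hpow : (1 : ℝ) ≤ (18 * d + 5) ^ d :=
    one_le_pow₀ (by linarith [(Nat.cast_nonneg d : (0 : ℝ) ≤ d)])
  have hκ0 : 0 < κ := by
    rw [hκ, sub_pos, div_lt_one (by positivity)]
    linarith
  have hκ1 : κ < 1 := by
    rw [hκ]
    have : 0 < 1 / (8 * (18 * (d : ℝ) + 5) ^ d) := by positivity
    linarith
  have htail : ∀ n, iidLaw d siteLaw {y | ∀ k < n, y ∉ D k} ≤ ENNReal.ofReal (κ ^ n) := fun n => by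
    rw [ENNReal.ofReal_pow hκ0.le]
    exact iidLaw_forall_notMem_renewalAt_le d q₀ n
  have hDnull : iidLaw d siteLaw (⋂ i, (D i)ᶜ) = 0 := by
    have hlim : Tendsto (fun n : ℕ => ENNReal.ofReal (κ ^ n)) atTop (𝓝 0) := by
      have := ENNReal.tendsto_ofReal (tendsto_pow_atTop_nhds_zero_of_lt_one hκ0.le hκ1)
      rwa [ENNReal.ofReal_zero] at this
    refine le_antisymm (ge_of_tendsto' hlim fun n => ?_) zero_le
    refine (measure_mono ?_).trans (htail n)
    exact fun y hy k _ => Set.mem_iInter.1 hy k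
  have hF : ∀ i v, ∀ᶠ n in atTop, ∀ (y : Zd d → ℕ → UnifTriple) (z : Zd d → S),
      shiftConfig v y ∈ D i → F n (y, z) v = H i (shiftConfig v y) := by
    intro i v
    filter_upwards [eventually_gt_atTop i] with n hn y z hy
    have hv : F n (y, z) v = shiftConfig v (F n (y, z)) 0 := by simp [shiftConfig]
    rw [hv]
    change shiftConfig v (blockIterate μ qs n (layers y) z) 0 = _
    rw [← blockIterate_shiftConfig]
    exact hdet _ _ hn (Nat.lt_succ_self i) hy fun _ _ => rfl
  have hlaw : ∀ (W : Finset (Zd d)) (ζ : Zd d → S), ∀ᶠ n in atTop,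
      ((iidLaw d siteLaw).prod μ) {p | F n p ∈ cyl W ζ} = μ (cyl W ζ) := by
    refine fun W ζ => Eventually.of_forall fun n => ?_
    have h1 := (measurePreserving_blockIterate hinv hmrf hw hρ (fun k => hq₀.trans (hq₀qs k))
      (fun k => hsmall _ (hq₀qs k)) n).comp
      ((measurePreserving_layers d).prod (MeasurePreserving.id μ))
    exact h1.measure_preimage (measurableSet_cyl W ζ).nullMeasurableSet
  have hHm : ∀ i, Measurable (H i) := fun i => by
    have h1 : Measurable fun y : Zd d → ℕ → UnifTriple => (layers y, x₀) :=
      measurable_layers.prodMk measurable_const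
    exact (measurable_pi_apply 0).comp ((measurable_blockIterate μ qs (i + 1)).comp h1)
  -- The exponent `c` is such that `16 ^ (-c) = κ`.
  set c : ℝ := -Real.log κ / Real.log 16 with hc
  have hlog : 0 < Real.log 16 := Real.log_pos (by norm_num)
  have hc0 : 0 < c := div_pos (neg_pos.2 (Real.log_neg hκ0 hκ1)) hlog
  have h16 : (16 : ℝ) ^ (-c) = κ := by
    rw [Real.rpow_def_of_pos (by norm_num), hc]
    have : Real.log 16 * -(-Real.log κ / Real.log 16) = Real.log κ := by field_simp
    rw [this, Real.exp_log hκ0]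
  set A : ℕ := 15 * (d * q₀) with hA
  have hA0 : (0 : ℝ) < A := by
    have : 0 < A := by omega
    exact_mod_cast this
  have hrad : ∀ n, rad n ≤ A * 16 ^ n := fun n => by
    have h1 : 1 ≤ qs n := hq₀.trans (hq₀qs n)
    have h2 : A * 16 ^ n = 15 * qs n := by
      rw [hqs, blockScale, hA]
      ring
    simp only [rad]
    omega
  refine ⟨ℕ → UnifTriple, inferInstance, siteLaw, inferInstance, _,
    isCoding_of_determined hH (measurableSet_renewalAt d q₀) hHm hDnull hF hlaw s₀,
    isFinitary_of_determined (rad := rad) hH hloc hDnull s₀, (A : ℝ) ^ c, c,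
    Real.rpow_pos_of_pos hA0 _, hc0, fun r hr => ?_⟩
  have hex : ∃ n, r ≤ A * 16 ^ n := by
    obtain ⟨n, hn⟩ := pow_unbounded_of_one_lt r (by norm_num : 1 < 16)
    exact ⟨n, hn.le.trans (Nat.le_mul_of_pos_left _ (by omega))⟩
  classical
  set n := Nat.find hex with hn
  have hsub : {y | (r : ℕ∞) ≤ codingRadius (fun y v => determinedValue D H s₀ (shiftConfig v y)) y} ⊆
      {y | ∀ k < n, y ∉ D k} := by
    intro y hy k hk hyD
    have h1 := (hy : (r : ℕ∞) ≤ _).trans (codingRadius_le_of_determined (rad := rad) hH hloc s₀ hyD)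
    have h2 : r ≤ rad k := by exact_mod_cast h1
    exact Nat.find_min hex hk (h2.trans (hrad k))
  refine (measure_mono hsub).trans ((htail n).trans (ENNReal.ofReal_le_ofReal ?_))
  have hr0 : (0 : ℝ) < r := by exact_mod_cast hr
  have hrn : (r : ℝ) ≤ A * 16 ^ n := by exact_mod_cast Nat.find_spec hex
  have h1 : ((A : ℝ) * 16 ^ n) ^ (-c) ≤ (r : ℝ) ^ (-c) :=
    Real.rpow_le_rpow_of_nonpos hr0 hrn (by linarith)
  have h2 : ((A : ℝ) * 16 ^ n) ^ (-c) = (A : ℝ) ^ (-c) * κ ^ n := by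
    rw [Real.mul_rpow hA0.le (by positivity), ← Real.rpow_natCast 16 n, ← Real.rpow_mul (by norm_num),
      mul_comm (n : ℝ), Real.rpow_mul (by norm_num), h16, Real.rpow_natCast]
  calc κ ^ n = (A : ℝ) ^ c * ((A : ℝ) ^ (-c) * κ ^ n) := by
        rw [← mul_assoc, ← Real.rpow_add hA0, add_neg_cancel, Real.rpow_zero, one_mul]
    _ ≤ _ := by
        rw [← h2]
        exact mul_le_mul_of_nonneg_left h1 (Real.rpow_nonneg hA0.le _)

end Weak

/-- A translation-invariant finite-valued Markov random field on `ℤ^d`, `d ≥ 2`, with exponential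
weak (strong) spatial mixing is a finitary factor of an i.i.d. process with power-law
(exponential) tails for the coding radius. -/
theorem theorem1p1 {d : ℕ} (hd : 2 ≤ d) {S : Type*} [Fintype S] [MeasurableSpace S]
    [DiscreteMeasurableSpace S] (μ : Measure (Zd d → S)) [IsProbabilityMeasure μ]
    (hinv : TranslationInvariant μ) (hmrf : IsMarkovRandomField μ) :
    (ExponentialWeakSpatialMixing μ → IsFfiidWithPowerLawTails μ) ∧
    (ExponentialStrongSpatialMixing μ → IsFfiidWithExponentialTails μ) :=
  ⟨fun h => h.isFfiidWithPowerLawTails (one_le_two.trans hd) hinv hmrf,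
    fun h => h.isFfiidWithExponentialTails hinv hmrf⟩
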